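/- **Theorem (error estimates for the conservative Crank–Nicolson finite difference method).** Let $a<b$, $U=(a,b)$, $\beta\in\mathbb R$, let $V\in C^1(\overline U)$ be a real-valued potential, and let $\psi=\psi(x,t)$ be the solution of the Gross–Pitaevskii equation $$ i\,\psi_t=-\tfrac12\psi_{xx}+V(x)\psi+\beta|\psi|^2\psi,\qquad a<x<b,\ t>0, $$ with $\psi(x,0)=\psi_0(x)$ for $a\le x\le b$ and $\psi(a,t)=\psi(b,t)=0$ for $t>0$. Let $T>0$ be smaller than its maximal existence time, and assume $$ \psi\in C^3([0,T];W^{1,\infty}(U))\cap C^2([0,T];W^{3,\infty}(U))\cap C^0([0,T];W^{5,\infty}(U)\cap H^1_0(U)). $$ For an integer $M\ge 1$ and $\tau>0$ put $h=(b-a)/M$, $x_j=a+jh$ $(0\le j\le M)$, $t_n=n\tau$, $V_j=V(x_j)$. The conservative Crank–Nicolson finite difference (CNFD) scheme for the unknowns $\psi^n_j$ $(0\le j\le M,\ 0\le n\le T/\tau)$ is $$ i\,\frac{\psi^{n+1}_j-\psi^n_j}{\tau}=\Big[-\tfrac12\delta_x^2+V_j+\tfrac{\beta}{2}\big(|\psi^{n+1}_j|^2+|\psi^n_j|^2\big)\Big]\frac{\psi^{n+1}_j+\psi^n_j}{2},\qquad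 1\le j\le M-1,\ 0\le n\le \tfrac T\tau-1, $$ $$ \psi^{n+1}_0=\psi^{n+1}_M=0\quad(0\le n\le \tfrac T\tau-1),\qquad \psi^0_j=\psi_0(x_j)\quad(0\le j\le M), $$ where $\delta_x^2v_j=(v_{j+1}-2v_j+v_{j-1})/h^2$. Write $e^n_j=\psi(x_j,t_n)-\psi^n_j$, $\delta_x^+v_j=(v_{j+1}-v_j)/h$, $\|v\|_2^2=h\sum_{j=0}^{M-1}|v_j|^2$, $\|\delta_x^+v\|_2^2=h\sum_{j=0}^{M-1}|\delta_x^+v_j|^2$, $\|v\|_\infty=\max_{0\le j\le M}|v_j|$, and $M_1=\max_{0\le t\le T}\|\psi(\cdot,t)\|_{L^\infty(U)}$. Then there exist $h_0>0$, $\tau_0>0$ and a constant $C>0$, independent of $h$, $\tau$ and $n$, such that whenever $0<h\le h_0$ and $0<\tau\le\tau_0$, the CNFD scheme admits a unique solution $\psi^n$ $(0\le n\le T/\tau)$, and $$ \|e^n\|_2\le C(h^2+\tau^2),\qquad \|\delta_x^+e^n\|_2\le C(h^{3/2}+\tau^{3/2}),\qquad \|\psi^n\|_\infty\le 1+M_1,\qquad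 0\le n\le \tfrac T\tau. $$ If, in addition, either $\partial_nV=0$ on $\partial U$ (that is, $V'(a)=V'(b)=0$) or $\psi\in C^0([0,T];H^2_0(U))$, then the optimal estimates $$ \|e^n\|_2+\|\delta_x^+e^n\|_2\le C(h^2+\tau^2),\qquad \|\psi^n\|_\infty\le 1+M_1,\qquad 0\le n\le \tfrac T\tau $$ hold. -/

import Mathlib

open Set MeasureTheory
open scoped ENNReal ContDiff

noncomputable section

namespace GPE

/-! ### Sobolev spaces on the interval `(a, b)` -/

/-- Lebesgue measure on the open interval `U = (a, b)`. -/
abbrev intervalMeasure (a b : ℝ) : Measure ℝ := volume.restrict (Ioo a b)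

/-- `φ ∈ C_c^∞((a, b); ℂ)`. -/
structure IsTestFunction (a b : ℝ) (φ : ℝ → ℂ) : Prop where
  smooth : ContDiff ℝ ∞ φ
  compact : HasCompactSupport φ
  support_subset : tsupport φ ⊆ Ioo a b

/-- `g` is the weak (distributional) derivative of `f` on `(a, b)`; used only for `f`, `g` in
some `L^p(a, b)`, `p ≥ 1`, so that all integrals converge. -/
def IsWeakDeriv (a b : ℝ) (f g : ℝ → ℂ) : Prop :=
  ∀ φ : ℝ → ℂ, IsTestFunction a b φ →
    ∫ x in Ioo a b, f x * deriv φ x = - ∫ x in Ioo a b, g x * φ x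

theorem integrable_mul_of_continuous {a b : ℝ} {p : ℝ≥0∞} [hp : Fact (1 ≤ p)]
    (f : Lp ℂ p (intervalMeasure a b)) {φ : ℝ → ℂ} (hc : Continuous φ)
    (hs : HasCompactSupport φ) :
    Integrable (fun x => f x * φ x) (intervalMeasure a b) := by
  obtain ⟨C, hC⟩ := hs.exists_bound_of_continuous hc
  exact ((Lp.memLp f).integrable hp.out).mul_bdd (c := C) hc.aestronglyMeasurable
    (Filter.Eventually.of_forall hC)

/-- The Sobolev space `W^{k,p}(a, b)` of complex-valued functions.  An element is the tuple
`(u, u', …, u^{(k)})` of a function `u ∈ L^p(a, b)` with its weak derivatives, all in `L^p`, and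
the norm (inherited from the product) is `max_{0 ≤ i ≤ k} ‖u^{(i)}‖_{L^p}`. -/
def sobolevSpace (a b : ℝ) (k : ℕ) (p : ℝ≥0∞) [Fact (1 ≤ p)] :
    Submodule ℝ (Fin (k + 1) → Lp ℂ p (intervalMeasure a b)) where
  carrier := {u | ∀ i : Fin k, IsWeakDeriv a b (u i.castSucc) (u i.succ)}
  zero_mem' := by
    intro i φ _
    have h0 := Lp.coeFn_zero ℂ p (intervalMeasure a b)
    have h1 : ∫ x in Ioo a b,
        ((0 : Fin (k + 1) → Lp ℂ p (intervalMeasure a b)) i.castSucc) x * deriv φ x = 0 :=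
      integral_eq_zero_of_ae (by
        filter_upwards [h0] with x hx
        rw [Pi.zero_apply, hx, Pi.zero_apply, zero_mul])
    have h2 : ∫ x in Ioo a b,
        ((0 : Fin (k + 1) → Lp ℂ p (intervalMeasure a b)) i.succ) x * φ x = 0 :=
      integral_eq_zero_of_ae (by
        filter_upwards [h0] with x hx
        rw [Pi.zero_apply, hx, Pi.zero_apply, zero_mul])
    rw [h1, h2, neg_zero]
  add_mem' := by
    intro u v hu hv i φ hφ
    have key : ∀ (l : Fin (k + 1)) (χ : ℝ → ℂ), Continuous χ → HasCompactSupport χ →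
        ∫ x in Ioo a b, ((u + v) l) x * χ x =
          (∫ x in Ioo a b, u l x * χ x) + ∫ x in Ioo a b, v l x * χ x := by
      intro l χ hc hs
      rw [← integral_add (integrable_mul_of_continuous (u l) hc hs)
        (integrable_mul_of_continuous (v l) hc hs)]
      refine integral_congr_ae ?_
      filter_upwards [Lp.coeFn_add (u l) (v l)] with x hx
      rw [Pi.add_apply, hx, Pi.add_apply, add_mul]
    rw [key _ _ (hφ.smooth.continuous_deriv (by simp)) hφ.compact.deriv,
      key _ _ hφ.smooth.continuous hφ.compact, hu i φ hφ, hv i φ hφ]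
    ring
  smul_mem' := by
    intro c u hu i φ hφ
    have key : ∀ (l : Fin (k + 1)) (χ : ℝ → ℂ),
        ∫ x in Ioo a b, ((c • u) l) x * χ x = c • ∫ x in Ioo a b, u l x * χ x := by
      intro l χ
      rw [← integral_smul]
      refine integral_congr_ae ?_
      filter_upwards [Lp.coeFn_smul c (u l)] with x hx
      rw [Pi.smul_apply, hx, Pi.smul_apply, smul_mul_assoc]
    rw [key, key, hu i φ hφ, smul_neg]

/-- `H^k_0(a, b)`: the closure of `C_c^∞(a, b)` in `H^k(a, b) = W^{k,2}(a, b)`. -/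
def sobolevZero (a b : ℝ) (k : ℕ) : Set (sobolevSpace a b k 2) :=
  closure {u | ∃ φ : ℝ → ℂ, IsTestFunction a b φ ∧
    ∀ i : Fin (k + 1), u.1 i =ᵐ[intervalMeasure a b] iteratedDeriv i φ}

/-- `ψ ∈ C^m([0, T]; W^{k,p}(a, b))`, for `ψ = ψ(x, t)`. -/
def MemCW (a b T : ℝ) (m k : ℕ) (p : ℝ≥0∞) [Fact (1 ≤ p)] (ψ : ℝ → ℝ → ℂ) : Prop :=
  ∃ F : ℝ → sobolevSpace a b k p, ContDiffOn ℝ m F (Icc 0 T) ∧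
    ∀ t ∈ Icc 0 T, (F t).1 0 =ᵐ[intervalMeasure a b] fun x => ψ x t

/-- `ψ ∈ C^0([0, T]; H^k_0(a, b))`, for `ψ = ψ(x, t)`. -/
def MemCHZero (a b T : ℝ) (k : ℕ) (ψ : ℝ → ℝ → ℂ) : Prop :=
  ∃ F : ℝ → sobolevSpace a b k 2, ContinuousOn F (Icc 0 T) ∧
    ∀ t ∈ Icc 0 T, F t ∈ sobolevZero a b k ∧ (F t).1 0 =ᵐ[intervalMeasure a b] fun x => ψ x t

/-- `ψ ∈ C³([0,T]; W^{1,∞}) ∩ C²([0,T]; W^{3,∞}) ∩ C⁰([0,T]; W^{5,∞} ∩ H¹₀)`. -/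
structure Regular (a b T : ℝ) (ψ : ℝ → ℝ → ℂ) : Prop where
  c3_w1 : MemCW a b T 3 1 ∞ ψ
  c2_w3 : MemCW a b T 2 3 ∞ ψ
  c0_w5 : MemCW a b T 0 5 ∞ ψ
  c0_h10 : MemCHZero a b T 1 ψ

/-! ### The Gross–Pitaevskii equation -/

/-- `ψ = ψ(x, t)` is a (classical) solution on `[a, b] × [0, T]` of
`i ψ_t = -½ ψ_xx + V ψ + β |ψ|² ψ`, `ψ(x, 0) = ψ₀(x)`, `ψ(a, t) = ψ(b, t) = 0`. -/
structure IsSolution (a b T : ℝ) (V : ℝ → ℝ) (β : ℝ) (ψ₀ : ℝ → ℂ) (ψ : ℝ → ℝ → ℂ) : Prop where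
  continuousOn : ContinuousOn (fun q : ℝ × ℝ => ψ q.1 q.2) (Icc a b ×ˢ Icc 0 T)
  differentiable_time : ∀ x ∈ Ioo a b, ∀ t ∈ Ioo 0 T, DifferentiableAt ℝ (fun s => ψ x s) t
  contDiff_space : ∀ x ∈ Ioo a b, ∀ t ∈ Ioo 0 T, ContDiffAt ℝ 2 (fun y => ψ y t) x
  equation : ∀ x ∈ Ioo a b, ∀ t ∈ Ioo 0 T,
    Complex.I * deriv (fun s => ψ x s) t =
      -(1 / 2) * iteratedDeriv 2 (fun y => ψ y t) x + (V x : ℂ) * ψ x t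
        + (β : ℂ) * (‖ψ x t‖ : ℂ) ^ 2 * ψ x t
  initial : ∀ x ∈ Icc a b, ψ x 0 = ψ₀ x
  boundary : ∀ t ∈ Ioc 0 T, ψ a t = 0 ∧ ψ b t = 0

/-- `M₁ = max_{0 ≤ t ≤ T} ‖ψ(·, t)‖_{L^∞(a, b)}`. -/
def maxNorm (a b T : ℝ) (ψ : ℝ → ℝ → ℂ) : ℝ :=
  sSup ((fun t => (eLpNorm (fun x => ψ x t) ∞ (intervalMeasure a b)).toReal) '' Icc 0 T)

/-! ### Grid functions

A grid function `(v_j)_{0 ≤ j ≤ M}` is given by `v : ℕ → ℂ`, of which only the values at `j ≤ M`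
are ever used. -/

/-- `δ_x^+ v_j`. -/
def deltaPlus (h : ℝ) (v : ℕ → ℂ) (j : ℕ) : ℂ := (v (j + 1) - v j) / h

/-- `δ_x^2 v_j`, used for `j ≥ 1` only. -/
def deltaSq (h : ℝ) (v : ℕ → ℂ) (j : ℕ) : ℂ := (v (j + 1) - 2 * v j + v (j - 1)) / (h : ℂ) ^ 2

/-- The discrete `l²` norm, `‖v‖_2² = h ∑_{j=0}^{M-1} |v_j|²`. -/
def l2Norm (h : ℝ) (M : ℕ) (v : ℕ → ℂ) : ℝ := √(h * ∑ j ∈ Finset.range M, ‖v j‖ ^ 2)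

/-- The discrete `l^∞` norm, `max_{0 ≤ j ≤ M} |v_j|`. -/
def supNorm (M : ℕ) (v : ℕ → ℂ) : ℝ :=
  (Finset.range (M + 1)).sup' Finset.nonempty_range_add_one fun j => ‖v j‖

/-- `u n j = ψ_j^n` (`0 ≤ n ≤ T / τ`, `0 ≤ j ≤ M`) solves the conservative Crank–Nicolson finite
difference scheme with grid points `x_j = a + j h` and time step `τ`. -/
structure IsCNFD (a T : ℝ) (V : ℝ → ℝ) (β : ℝ) (ψ₀ : ℝ → ℂ) (M : ℕ) (h τ : ℝ)
    (u : ℕ → ℕ → ℂ) : Prop where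
  scheme : ∀ n : ℕ, ((n + 1 : ℕ) : ℝ) ≤ T / τ → ∀ j : ℕ, 1 ≤ j → j ≤ M - 1 →
    Complex.I * ((u (n + 1) j - u n j) / τ) =
      -(1 / 2) * deltaSq h (fun l => (u (n + 1) l + u n l) / 2) j
        + ((V (a + j * h) : ℂ) + (β : ℂ) / 2 * ((‖u (n + 1) j‖ : ℂ) ^ 2 + (‖u n j‖ : ℂ) ^ 2))
          * ((u (n + 1) j + u n j) / 2)
  boundary : ∀ n : ℕ, ((n + 1 : ℕ) : ℝ) ≤ T / τ → u (n + 1) 0 = 0 ∧ u (n + 1) M = 0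
  initial : ∀ j : ℕ, j ≤ M → u 0 j = ψ₀ (a + j * h)

/-- The error `e_j^n = ψ(x_j, t_n) - ψ_j^n`. -/
def err (a h τ : ℝ) (ψ : ℝ → ℝ → ℂ) (u : ℕ → ℕ → ℂ) (n j : ℕ) : ℂ :=
  ψ (a + j * h) (n * τ) - u n j

end GPE

end

/-! The proof is "consistency plus stability", with the discrete H¹ seminorm as the working norm.
Stability. A Crank–Nicolson step for the free equation with source g satisfies ‖v₁‖ ≤ ‖v₀‖ + τ‖g‖ in
the discrete l² norm and, if g vanishes at both ends, in the discrete H¹ seminorm (`LinStep.l2_le`,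
`LinStep.h1_le`). In one dimension the H¹ seminorm controls the maximum and makes zero-boundary grid
functions an algebra, so the cubic term is Lipschitz in both norms on H¹ balls (`cnTerm_sub_le`),
with constants free of h and τ. Hence no inverse inequality and no relation between h and τ is
needed. One step is solved by contraction (`exists_step`). Conservation of mass and energy bounds
every solution of a step a priori (`h1Norm_step_le`), so uniqueness holds among all solutions and
not only inside a ball. A discrete Gronwall argument, with a bootstrap keeping the error below 1 in
H¹, turns residual bounds into error bounds (`cnfd_convergence`). Consistency. The residual is O(h²
+ τ²) in l², and its difference quotients are O(h² + τ²) away from the ends. The H¹ estimate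
requires the residual to be extended by 0 to the end nodes. Its time part vanishes there anyway, but
its space part is of size h²|ψ_xxxx|, so the extension creates difference quotients of size h in the
two end cells. Each cell has weight h, which gives √h · h = h^{3/2}. Optimal order. At an end point
ψ, ψ_t, ψ_xx and ψ_txx vanish, and two formal differentiations of the equation give ψ_xxxx = 4V'ψ_x.
Either extra hypothesis kills the right-hand side (`SolutionData.f_four_boundary`), so ψ_xxxx = O(h)
near the ends and the loss of order disappears. Sobolev regularity enters through `evalRep`:
evaluating the continuous representative is a continuous linear functional, so it commutes with time
derivatives, and W^{1,∞} bounds become Lipschitz bounds in x. -/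

namespace GPE

/-! ### Discrete norms -/

section Grid

variable {h : ℝ} {M : ℕ}

/-- The grid function vanishes at both ends of the grid. -/
def ZeroBdry (M : ℕ) (v : ℕ → ℂ) : Prop := v 0 = 0 ∧ v M = 0

/-- The discrete `H¹` seminorm. -/
noncomputable def h1Norm (h : ℝ) (M : ℕ) (v : ℕ → ℂ) : ℝ := l2Norm h M (deltaPlus h v)

theorem ZeroBdry.add {v w : ℕ → ℂ} (hv : ZeroBdry M v) (hw : ZeroBdry M w) :
    ZeroBdry M (v + w) := by simp [ZeroBdry, hv.1, hv.2, hw.1, hw.2]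

theorem ZeroBdry.sub {v w : ℕ → ℂ} (hv : ZeroBdry M v) (hw : ZeroBdry M w) :
    ZeroBdry M (v - w) := by simp [ZeroBdry, hv.1, hv.2, hw.1, hw.2]

theorem ZeroBdry.mul_left {v : ℕ → ℂ} (hv : ZeroBdry M v) (w : ℕ → ℂ) :
    ZeroBdry M (w * v) := by simp [ZeroBdry, hv.1, hv.2]

theorem ZeroBdry.star {v : ℕ → ℂ} (hv : ZeroBdry M v) : ZeroBdry M (star v) := by
  simp [ZeroBdry, hv.1, hv.2]

theorem l2Norm_nonneg (v : ℕ → ℂ) : 0 ≤ l2Norm h M v := Real.sqrt_nonneg _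

theorem h1Norm_nonneg (v : ℕ → ℂ) : 0 ≤ h1Norm h M v := Real.sqrt_nonneg _

theorem l2Norm_sq (hh : 0 ≤ h) (v : ℕ → ℂ) :
    l2Norm h M v ^ 2 = h * ∑ j ∈ Finset.range M, ‖v j‖ ^ 2 :=
  Real.sq_sqrt (mul_nonneg hh (Finset.sum_nonneg fun _ _ => sq_nonneg _))

theorem l2Norm_eq (hh : 0 ≤ h) (v : ℕ → ℂ) :
    l2Norm h M v = √h * ‖WithLp.toLp 2 (fun i : Fin M => v i)‖ := by
  rw [l2Norm, Real.sqrt_mul hh, EuclideanSpace.norm_eq, Finset.sum_range]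

theorem l2Norm_add_le (hh : 0 ≤ h) (v w : ℕ → ℂ) :
    l2Norm h M (v + w) ≤ l2Norm h M v + l2Norm h M w := by
  rw [l2Norm_eq hh, l2Norm_eq hh, l2Norm_eq hh, ← mul_add]
  exact mul_le_mul_of_nonneg_left (norm_add_le (WithLp.toLp 2 fun i : Fin M => v i)
    (WithLp.toLp 2 fun i : Fin M => w i)) (Real.sqrt_nonneg _)

theorem l2Norm_mono (hh : 0 ≤ h) {v w : ℕ → ℂ} (H : ∀ j < M, ‖v j‖ ≤ ‖w j‖) :
    l2Norm h M v ≤ l2Norm h M w := by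
  refine Real.sqrt_le_sqrt (mul_le_mul_of_nonneg_left (Finset.sum_le_sum fun j hj => ?_) hh)
  exact pow_le_pow_left₀ (norm_nonneg _) (H j (Finset.mem_range.1 hj)) 2

theorem l2Norm_congr {v w : ℕ → ℂ} (H : ∀ j < M, ‖v j‖ = ‖w j‖) :
    l2Norm h M v = l2Norm h M w := by
  rw [l2Norm, l2Norm, Finset.sum_congr rfl fun j hj => by rw [H j (Finset.mem_range.1 hj)]]

theorem l2Norm_smul (c : ℂ) (v : ℕ → ℂ) : l2Norm h M (c • v) = ‖c‖ * l2Norm h M v := by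
  rw [l2Norm, l2Norm]
  have : h * ∑ j ∈ Finset.range M, ‖(c • v) j‖ ^ 2
      = ‖c‖ ^ 2 * (h * ∑ j ∈ Finset.range M, ‖v j‖ ^ 2) := by
    simp only [Pi.smul_apply, smul_eq_mul, norm_mul, mul_pow, ← Finset.mul_sum]; ring
  rw [this, Real.sqrt_mul (sq_nonneg _), Real.sqrt_sq (norm_nonneg _)]

/-- A pointwise bound `‖v j‖ ≤ c` for `j < M` bounds the discrete `l²` norm. -/
theorem l2Norm_le_of_bound (hh : 0 ≤ h) {v : ℕ → ℂ} {c : ℝ} (hc : 0 ≤ c)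
    (H : ∀ j < M, ‖v j‖ ≤ c) : l2Norm h M v ≤ √(h * M) * c := by
  rw [l2Norm, ← Real.sqrt_sq hc, ← Real.sqrt_mul (by positivity)]
  refine Real.sqrt_le_sqrt ?_
  rw [mul_assoc]
  refine mul_le_mul_of_nonneg_left ?_ hh
  calc ∑ j ∈ Finset.range M, ‖v j‖ ^ 2 ≤ ∑ _j ∈ Finset.range M, c ^ 2 :=
        Finset.sum_le_sum fun j hj =>
          pow_le_pow_left₀ (norm_nonneg _) (H j (Finset.mem_range.1 hj)) 2
    _ = M * c ^ 2 := by simp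

theorem eq_zero_of_l2Norm_eq_zero (hh : 0 < h) {v : ℕ → ℂ} (H : l2Norm h M v = 0) :
    ∀ j < M, v j = 0 := by
  intro j hj
  have h1 := l2Norm_sq (M := M) hh.le v
  rw [H] at h1
  have h2 : ∑ j ∈ Finset.range M, ‖v j‖ ^ 2 = 0 := by
    have := (mul_eq_zero.1 (h1.symm.trans (by norm_num))).resolve_left hh.ne'
    exact this
  have h3 := (Finset.sum_eq_zero_iff_of_nonneg fun _ _ => sq_nonneg _).1 h2 j
    (Finset.mem_range.2 hj)
  simpa using h3

theorem sum_norm_mul_le (hh : 0 ≤ h) (v w : ℕ → ℂ) :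
    h * ∑ j ∈ Finset.range M, ‖v j‖ * ‖w j‖ ≤ l2Norm h M v * l2Norm h M w := by
  rw [l2Norm, l2Norm, Real.sqrt_mul hh, Real.sqrt_mul hh]
  have := Real.sum_mul_le_sqrt_mul_sqrt (Finset.range M) (fun j => ‖v j‖) (fun j => ‖w j‖)
  calc h * ∑ j ∈ Finset.range M, ‖v j‖ * ‖w j‖
      ≤ h * (√(∑ j ∈ Finset.range M, ‖v j‖ ^ 2) * √(∑ j ∈ Finset.range M, ‖w j‖ ^ 2)) :=
        mul_le_mul_of_nonneg_left this hh
    _ = _ := by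
        conv_lhs => rw [← Real.mul_self_sqrt hh]
        ring

theorem deltaPlus_add (v w : ℕ → ℂ) :
    deltaPlus h (v + w) = deltaPlus h v + deltaPlus h w := by
  funext j; simp only [deltaPlus, Pi.add_apply]; ring

theorem deltaPlus_smul (c : ℂ) (v : ℕ → ℂ) : deltaPlus h (c • v) = c • deltaPlus h v := by
  funext j; simp only [deltaPlus, Pi.smul_apply, smul_eq_mul]; ring

theorem h1Norm_add_le (hh : 0 ≤ h) (v w : ℕ → ℂ) :
    h1Norm h M (v + w) ≤ h1Norm h M v + h1Norm h M w := by
  rw [h1Norm, deltaPlus_add]; exact l2Norm_add_le hh _ _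

theorem h1Norm_smul (c : ℂ) (v : ℕ → ℂ) : h1Norm h M (c • v) = ‖c‖ * h1Norm h M v := by
  rw [h1Norm, deltaPlus_smul, l2Norm_smul]; rfl

theorem h1Norm_star (v : ℕ → ℂ) : h1Norm h M (star v) = h1Norm h M v := by
  refine l2Norm_congr fun j _ => ?_
  simp only [deltaPlus, Pi.star_apply, norm_div, ← star_sub, norm_star]

theorem l2Norm_star (v : ℕ → ℂ) : l2Norm h M (star v) = l2Norm h M v :=
  l2Norm_congr fun j _ => by simp

theorem h1Norm_congr {v w : ℕ → ℂ} (H : ∀ j ≤ M, v j = w j) : h1Norm h M v = h1Norm h M w :=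
  l2Norm_congr fun j hj => by rw [deltaPlus, deltaPlus, H j hj.le, H (j + 1) hj]

/-- The discrete Sobolev inequality. -/
theorem norm_le_h1Norm (hh : 0 < h) {v : ℕ → ℂ} (hv : v 0 = 0) {j : ℕ} (hj : j ≤ M) :
    ‖v j‖ ≤ √(h * M) * h1Norm h M v := by
  have h1 : v j = ∑ i ∈ Finset.range j, (v (i + 1) - v i) := by
    rw [Finset.sum_range_sub, hv, sub_zero]
  have h2 : ∀ i, ‖v (i + 1) - v i‖ = h * (‖(1 : ℂ)‖ * ‖deltaPlus h v i‖) := by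
    intro i
    rw [deltaPlus, norm_div, Complex.norm_real, Real.norm_of_nonneg hh.le]
    rw [norm_one, one_mul, mul_div_cancel₀ _ hh.ne']
  calc ‖v j‖ ≤ ∑ i ∈ Finset.range j, ‖v (i + 1) - v i‖ := by
        rw [h1]; exact norm_sum_le _ _
    _ ≤ ∑ i ∈ Finset.range M, ‖v (i + 1) - v i‖ :=
        Finset.sum_le_sum_of_subset_of_nonneg (Finset.range_mono hj) fun _ _ _ => norm_nonneg _
    _ = h * ∑ i ∈ Finset.range M, ‖(1 : ℂ)‖ * ‖deltaPlus h v i‖ := by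
        rw [Finset.mul_sum]; exact Finset.sum_congr rfl fun i _ => h2 i
    _ ≤ l2Norm h M (fun _ => 1) * l2Norm h M (deltaPlus h v) :=
        sum_norm_mul_le hh.le (fun _ => 1) _
    _ = √(h * M) * h1Norm h M v := by simp [l2Norm, h1Norm]

theorem l2Norm_le_h1Norm (hh : 0 < h) {v : ℕ → ℂ} (hv : v 0 = 0) :
    l2Norm h M v ≤ h * M * h1Norm h M v := by
  refine (l2Norm_le_of_bound hh.le (mul_nonneg (Real.sqrt_nonneg _) (h1Norm_nonneg _))
    fun j hj => norm_le_h1Norm hh hv hj.le).trans_eq ?_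
  rw [← mul_assoc, Real.mul_self_sqrt (by positivity)]

/-- The discrete Gagliardo–Nirenberg inequality. -/
theorem norm_sq_le (hh : 0 < h) {v : ℕ → ℂ} (hv : ZeroBdry M v) {j : ℕ} (hj : j ≤ M) :
    ‖v j‖ ^ 2 ≤ 2 * l2Norm h M v * h1Norm h M v := by
  have h1 : ‖v j‖ ^ 2 = ∑ i ∈ Finset.range j, (‖v (i + 1)‖ ^ 2 - ‖v i‖ ^ 2) := by
    rw [Finset.sum_range_sub fun i => ‖v i‖ ^ 2, hv.1]; simp
  have h2 : ∀ i, ‖v (i + 1)‖ ^ 2 - ‖v i‖ ^ 2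
      ≤ h * (‖deltaPlus h v i‖ * ‖v (i + 1)‖) + h * (‖deltaPlus h v i‖ * ‖v i‖) := by
    intro i
    have e : ‖v (i + 1) - v i‖ = h * ‖deltaPlus h v i‖ := by
      rw [deltaPlus, norm_div, Complex.norm_real, Real.norm_of_nonneg hh.le,
        mul_div_cancel₀ _ hh.ne']
    have := norm_sub_norm_le (v (i + 1)) (v i)
    rw [e] at this
    nlinarith [norm_nonneg (v (i + 1)), norm_nonneg (v i)]
  have h0 : ∀ i, 0 ≤ h * (‖deltaPlus h v i‖ * ‖v (i + 1)‖) + h * (‖deltaPlus h v i‖ * ‖v i‖) :=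
    fun i => by positivity
  -- The shift replaces the summand at 0 by the one at M, and both are zero.
  have h3 : l2Norm h M (fun i => v (i + 1)) = l2Norm h M v := by
    rw [l2Norm, l2Norm]
    have e := Finset.sum_range_succ (fun i => ‖v i‖ ^ 2) M
    rw [Finset.sum_range_succ' (fun i => ‖v i‖ ^ 2) M] at e
    rw [hv.1, hv.2] at e
    simp only [norm_zero, ne_eq, OfNat.ofNat_ne_zero, not_false_eq_true, zero_pow, add_zero] at e
    rw [e]
  calc ‖v j‖ ^ 2 ≤ ∑ i ∈ Finset.range j,
          (h * (‖deltaPlus h v i‖ * ‖v (i + 1)‖) + h * (‖deltaPlus h v i‖ * ‖v i‖)) := by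
        rw [h1]; exact Finset.sum_le_sum fun i _ => h2 i
    _ ≤ ∑ i ∈ Finset.range M,
          (h * (‖deltaPlus h v i‖ * ‖v (i + 1)‖) + h * (‖deltaPlus h v i‖ * ‖v i‖)) :=
        Finset.sum_le_sum_of_subset_of_nonneg (Finset.range_mono hj) fun i _ _ => h0 i
    _ ≤ h1Norm h M v * l2Norm h M v + h1Norm h M v * l2Norm h M v := by
        rw [Finset.sum_add_distrib, ← Finset.mul_sum, ← Finset.mul_sum]
        have e1 := sum_norm_mul_le (M := M) hh.le (deltaPlus h v) (fun i => v (i + 1))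
        rw [h3] at e1
        exact add_le_add e1 (sum_norm_mul_le hh.le _ _)
    _ = _ := by ring

/-- The factor 2 is superfluous here; it makes the constant agree with that of `h1Norm_mul_le`, so
that both norms fit `GridNorm`. -/
theorem l2Norm_mul_le (hh : 0 < h) {v : ℕ → ℂ} (hv : v 0 = 0) (w : ℕ → ℂ) :
    l2Norm h M (v * w) ≤ 2 * √(h * M) * h1Norm h M v * l2Norm h M w := by
  have hc : 0 ≤ √(h * M) * h1Norm h M v := mul_nonneg (Real.sqrt_nonneg _) (h1Norm_nonneg _)
  calc l2Norm h M (v * w) ≤ l2Norm h M (((√(h * M) * h1Norm h M v : ℝ) : ℂ) • w) := by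
        refine l2Norm_mono hh.le fun j hj => ?_
        rw [Pi.mul_apply, Pi.smul_apply, norm_mul, norm_smul, Complex.norm_real,
          Real.norm_of_nonneg hc]
        exact mul_le_mul_of_nonneg_right (norm_le_h1Norm hh hv hj.le) (norm_nonneg _)
    _ = √(h * M) * h1Norm h M v * l2Norm h M w := by
        rw [l2Norm_smul, Complex.norm_real, Real.norm_of_nonneg hc]
    _ ≤ _ := by nlinarith [mul_nonneg hc (l2Norm_nonneg (h := h) (M := M) w)]

/-- Discrete product rule: δ(vw)_j = v_{j+1} δw_j + w_j δv_j, with the undifferenced factors bounded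
in maximum by the discrete Sobolev inequality. -/
theorem h1Norm_mul_le (hh : 0 < h) {v w : ℕ → ℂ} (hv : v 0 = 0) (hw : w 0 = 0) :
    h1Norm h M (v * w) ≤ 2 * √(h * M) * h1Norm h M v * h1Norm h M w := by
  have hc : ∀ v, 0 ≤ √(h * M) * h1Norm h M v :=
    fun v => mul_nonneg (Real.sqrt_nonneg _) (h1Norm_nonneg _)
  have key : ∀ v, v 0 = 0 → ∀ (w : ℕ → ℂ) (k : ℕ → ℕ), (∀ j < M, k j ≤ M) →
      l2Norm h M (fun j => v (k j) * w j) ≤ √(h * M) * h1Norm h M v * l2Norm h M w := by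
    intro v hv w k hk
    calc l2Norm h M (fun j => v (k j) * w j)
        ≤ l2Norm h M (((√(h * M) * h1Norm h M v : ℝ) : ℂ) • w) := by
          refine l2Norm_mono hh.le fun j hj => ?_
          rw [Pi.smul_apply, norm_mul, norm_smul, Complex.norm_real,
            Real.norm_of_nonneg (hc v)]
          exact mul_le_mul_of_nonneg_right (norm_le_h1Norm hh hv (hk j hj)) (norm_nonneg _)
      _ = _ := by rw [l2Norm_smul, Complex.norm_real, Real.norm_of_nonneg (hc v)]
  have e : deltaPlus h (v * w) = (fun j => v (j + 1) * deltaPlus h w j)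
      + fun j => w j * deltaPlus h v j := by
    funext j; simp only [deltaPlus, Pi.mul_apply, Pi.add_apply]; ring
  rw [h1Norm, e]
  refine (l2Norm_add_le hh.le _ _).trans ?_
  have h1 := key v hv (deltaPlus h w) (fun j => j + 1) fun j hj => hj
  have h2 := key w hw (deltaPlus h v) (fun j => j) fun j hj => hj.le
  unfold h1Norm at *
  linarith

end Grid

end GPE

namespace GPE

/-! ### The Crank–Nicolson step -/

section Step

variable {h τ : ℝ} {M : ℕ}

/-- Since 0 - 1 = 0 in ℕ, `deltaSq h v 0` is the one-sided value (v₁ - v₀)/h². This is why no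
boundary term appears at the lower end. -/
theorem sum_deltaSq_mul_aux (hh : h ≠ 0) (v w : ℕ → ℂ) (M : ℕ) :
    ∑ j ∈ Finset.range M, deltaSq h v j * star (w j) =
      -∑ j ∈ Finset.range M, deltaPlus h v j * star (deltaPlus h w j)
        + (v M - v (M - 1)) / (h : ℂ) ^ 2 * star (w M) := by
  have hc : (h : ℂ) ≠ 0 := Complex.ofReal_ne_zero.2 hh
  induction M with
  | zero => simp
  | succ M ih =>
    rw [Finset.sum_range_succ, Finset.sum_range_succ, ih]
    simp only [deltaSq, deltaPlus, star_div₀, star_sub, Nat.add_sub_cancel,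
      Complex.star_def, Complex.conj_ofReal]
    field_simp
    ring

/-- Summation by parts. -/
theorem sum_deltaSq_mul (hh : h ≠ 0) (v : ℕ → ℂ) {w : ℕ → ℂ} (hw : ZeroBdry M w) :
    ∑ j ∈ Finset.range M, deltaSq h v j * star (w j) =
      -∑ j ∈ Finset.range M, deltaPlus h v j * star (deltaPlus h w j) := by
  rw [sum_deltaSq_mul_aux hh, hw.2]; simp

theorem deltaSq_half (v w : ℕ → ℂ) (j : ℕ) :
    deltaSq h (fun l => (v l + w l) / 2) j = 1 / 2 * deltaSq h (v + w) j := by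
  simp only [deltaSq, Pi.add_apply]; ring

/-- One step of the Crank–Nicolson scheme for the free Schrödinger equation with source `g`. -/
def LinStep (h τ : ℝ) (M : ℕ) (v₀ v₁ g : ℕ → ℂ) : Prop :=
  ∀ j : ℕ, 1 ≤ j → j < M →
    Complex.I * ((v₁ j - v₀ j) / τ) =
      -(1 / 2) * deltaSq h (fun l => (v₁ l + v₀ l) / 2) j + g j

theorem LinStep.sub {v₀ v₁ g w₀ w₁ k : ℕ → ℂ} (hv : LinStep h τ M v₀ v₁ g)
    (hw : LinStep h τ M w₀ w₁ k) : LinStep h τ M (v₀ - w₀) (v₁ - w₁) (g - k) := by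
  intro j h1 h2
  have e1 := hv j h1 h2
  have e2 := hw j h1 h2
  simp only [deltaSq, Pi.sub_apply] at *
  linear_combination e1 - e2

/-- The energy identity behind both stability estimates. -/
theorem sq_sub_sq_of_real (hh : 0 ≤ h) (hτ : τ ≠ 0) {x₀ x₁ y : ℕ → ℂ} {r : ℝ}
    (H : h * ∑ j ∈ Finset.range M, Complex.I * ((x₁ j - x₀ j) / τ) * star (x₁ j + x₀ j) =
      r + h * ∑ j ∈ Finset.range M, y j * star (x₁ j + x₀ j)) :
    l2Norm h M x₁ ^ 2 - l2Norm h M x₀ ^ 2 =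
      τ * (h * ∑ j ∈ Finset.range M, y j * star (x₁ j + x₀ j) : ℂ).im := by
  have h1 : (h * ∑ j ∈ Finset.range M, Complex.I * ((x₁ j - x₀ j) / τ) * star (x₁ j + x₀ j) : ℂ).im
      = (h * ∑ j ∈ Finset.range M, (‖x₁ j‖ ^ 2 - ‖x₀ j‖ ^ 2)) / τ := by
    rw [Complex.im_ofReal_mul, Complex.im_sum, mul_div_assoc, Finset.sum_div]
    refine congrArg (h * ·) (Finset.sum_congr rfl fun j _ => ?_)
    rw [← Complex.normSq_eq_norm_sq, ← Complex.normSq_eq_norm_sq, Complex.normSq_apply,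
      Complex.normSq_apply]
    have : Complex.I * ((x₁ j - x₀ j) / τ) * star (x₁ j + x₀ j)
        = ((τ⁻¹ : ℝ) : ℂ) * (Complex.I * ((x₁ j - x₀ j) * star (x₁ j + x₀ j))) := by
      push_cast; ring
    rw [this, Complex.im_ofReal_mul]
    simp only [Complex.mul_im, Complex.I_re, Complex.I_im, Complex.mul_re, Complex.star_def,
      Complex.conj_re, Complex.conj_im, Complex.add_re, Complex.add_im, Complex.sub_re,
      Complex.sub_im]
    ring
  have h2 := congrArg Complex.im H
  rw [Complex.add_im, Complex.ofReal_im, zero_add, h1] at h2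
  rw [l2Norm_sq hh, l2Norm_sq hh, ← h2, mul_div_cancel₀ _ hτ, Finset.sum_sub_distrib]
  ring

/-- By Cauchy–Schwarz the right-hand side is at most τ‖y‖(‖x₁‖ + ‖x₀‖), and the common factor ‖x₁‖ +
‖x₀‖ cancels. Arguing by contradiction avoids dividing by zero. -/
theorem l2Norm_le_of_sq_sub_sq (hh : 0 ≤ h) (hτ : 0 ≤ τ) {x₀ x₁ y : ℕ → ℂ}
    (H : l2Norm h M x₁ ^ 2 - l2Norm h M x₀ ^ 2 =
      τ * (h * ∑ j ∈ Finset.range M, y j * star (x₁ j + x₀ j) : ℂ).im) :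
    l2Norm h M x₁ ≤ l2Norm h M x₀ + τ * l2Norm h M y := by
  have h1 : (h * ∑ j ∈ Finset.range M, y j * star (x₁ j + x₀ j) : ℂ).im
      ≤ l2Norm h M y * l2Norm h M (x₁ + x₀) := by
    refine (Complex.im_le_norm _).trans ?_
    rw [norm_mul, Complex.norm_real, Real.norm_of_nonneg hh]
    refine le_trans ?_ (sum_norm_mul_le hh y (x₁ + x₀))
    refine mul_le_mul_of_nonneg_left ((norm_sum_le _ _).trans_eq ?_) hh
    exact Finset.sum_congr rfl fun j _ => by rw [norm_mul, norm_star]; rfl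
  have h2 := l2Norm_add_le (M := M) hh x₁ x₀
  have n0 := l2Norm_nonneg (h := h) (M := M) x₀
  have n1 := l2Norm_nonneg (h := h) (M := M) x₁
  have ny := l2Norm_nonneg (h := h) (M := M) y
  by_contra! hc
  have h3 : τ * (h * ∑ j ∈ Finset.range M, y j * star (x₁ j + x₀ j) : ℂ).im
      ≤ τ * l2Norm h M y * (l2Norm h M x₁ + l2Norm h M x₀) := by
    rw [mul_assoc]
    exact mul_le_mul_of_nonneg_left (h1.trans (mul_le_mul_of_nonneg_left h2 ny)) hτ
  have h4 : 0 ≤ τ * l2Norm h M y := mul_nonneg hτ ny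
  nlinarith

/-- Test the step with the conjugate of v₁ + v₀: after summation by parts the second difference
contributes a real number, which drops out of the imaginary part. -/
theorem LinStep.l2_identity (hh : 0 < h) (hτ : τ ≠ 0) {v₀ v₁ g : ℕ → ℂ}
    (hs : LinStep h τ M v₀ v₁ g) (h₀ : ZeroBdry M v₀) (h₁ : ZeroBdry M v₁) :
    l2Norm h M v₁ ^ 2 - l2Norm h M v₀ ^ 2 =
      τ * (h * ∑ j ∈ Finset.range M, g j * star (v₁ j + v₀ j) : ℂ).im := by
  refine sq_sub_sq_of_real (r := 1 / 4 * l2Norm h M (deltaPlus h (v₁ + v₀)) ^ 2) hh.le hτ ?_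
  have h1 := sum_deltaSq_mul hh.ne' (v₁ + v₀) (h₁.add h₀)
  have h2 : ∑ j ∈ Finset.range M, deltaPlus h (v₁ + v₀) j * star (deltaPlus h (v₁ + v₀) j)
      = ((∑ j ∈ Finset.range M, ‖deltaPlus h (v₁ + v₀) j‖ ^ 2 : ℝ) : ℂ) := by
    push_cast
    exact Finset.sum_congr rfl fun j _ => Complex.mul_conj' _
  rw [l2Norm_sq hh.le]
  have h3 : ∑ j ∈ Finset.range M, Complex.I * ((v₁ j - v₀ j) / τ) * star (v₁ j + v₀ j)
      = -(1 / 4) * ∑ j ∈ Finset.range M, deltaSq h (v₁ + v₀) j * star ((v₁ + v₀) j)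
        + ∑ j ∈ Finset.range M, g j * star (v₁ j + v₀ j) := by
    rw [Finset.mul_sum, ← Finset.sum_add_distrib]
    refine Finset.sum_congr rfl fun j hj => ?_
    rcases Nat.eq_zero_or_pos j with rfl | hpos
    · simp [h₀.1, h₁.1]
    · rw [hs j hpos (Finset.mem_range.1 hj), deltaSq_half, Pi.add_apply]; ring
  rw [h3, h1, h2]
  push_cast
  ring

/-- Same argument with the second difference of v₁ + v₀ as test function. The hypothesis on g is
what allows its summation by parts, and it forces the residual to be extended by zero later on. -/
theorem LinStep.h1_identity (hh : 0 < h) (hτ : τ ≠ 0) {v₀ v₁ g : ℕ → ℂ}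
    (hs : LinStep h τ M v₀ v₁ g) (h₀ : ZeroBdry M v₀) (h₁ : ZeroBdry M v₁)
    (hg : ZeroBdry M g) :
    h1Norm h M v₁ ^ 2 - h1Norm h M v₀ ^ 2 =
      τ * (h * ∑ j ∈ Finset.range M,
        deltaPlus h g j * star (deltaPlus h v₁ j + deltaPlus h v₀ j) : ℂ).im := by
  set s := v₁ + v₀ with hsdef
  have hδ : ∀ j, deltaPlus h v₁ j + deltaPlus h v₀ j = deltaPlus h s j := fun j => by
    rw [hsdef, deltaPlus_add]; rfl
  have key : ∀ p : ℕ → ℂ, ZeroBdry M p →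
      ∑ j ∈ Finset.range M, deltaPlus h p j * star (deltaPlus h s j)
        = -∑ j ∈ Finset.range M, p j * star (deltaSq h s j) := by
    intro p hp
    have := congrArg star (sum_deltaSq_mul hh.ne' s hp)
    rw [star_neg, star_sum, star_sum] at this
    simp only [star_mul, star_star] at this
    rw [this, neg_neg]
  -- The sum starts at 1 because the scheme says nothing at the node 0; the terms there vanish by
  -- the boundary conditions.
  refine sq_sub_sq_of_real
    (r := h * ∑ j ∈ Finset.Ico 1 M, 1 / 4 * ‖deltaSq h s j‖ ^ 2) hh.le hτ ?_
  have hp : ZeroBdry M (fun j => Complex.I * ((v₁ j - v₀ j) / τ)) := by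
    simp [ZeroBdry, h₀.1, h₀.2, h₁.1, h₁.2]
  have e1 : ∀ j, Complex.I * ((deltaPlus h v₁ j - deltaPlus h v₀ j) / τ)
      = deltaPlus h (fun j => Complex.I * ((v₁ j - v₀ j) / τ)) j := by
    intro j; simp only [deltaPlus]; ring
  simp only [hδ, e1]
  rw [key _ hp, key _ hg]
  have e2 : ∑ j ∈ Finset.range M, Complex.I * ((v₁ j - v₀ j) / τ) * star (deltaSq h s j)
      = -((∑ j ∈ Finset.Ico 1 M, 1 / 4 * ‖deltaSq h s j‖ ^ 2 : ℝ) : ℂ)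
        + ∑ j ∈ Finset.range M, g j * star (deltaSq h s j) := by
    rcases Nat.eq_zero_or_pos M with rfl | hM
    · simp
    rw [Finset.range_eq_Ico, Finset.sum_eq_sum_Ico_succ_bot hM,
      Finset.sum_eq_sum_Ico_succ_bot hM (fun j => g j * star (deltaSq h s j)), h₀.1, h₁.1, hg.1]
    simp only [sub_zero, zero_div, mul_zero, zero_mul, zero_add]
    push_cast
    rw [← Finset.sum_neg_distrib, ← Finset.sum_add_distrib]
    refine Finset.sum_congr rfl fun j hj => ?_
    rw [Finset.mem_Ico] at hj
    rw [hs j hj.1 hj.2, deltaSq_half, ← hsdef, ← Complex.mul_conj', Complex.star_def]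
    ring
  rw [e2]
  push_cast
  ring

theorem LinStep.l2_le (hh : 0 < h) (hτ : 0 < τ) {v₀ v₁ g : ℕ → ℂ}
    (hs : LinStep h τ M v₀ v₁ g) (h₀ : ZeroBdry M v₀) (h₁ : ZeroBdry M v₁) :
    l2Norm h M v₁ ≤ l2Norm h M v₀ + τ * l2Norm h M g :=
  l2Norm_le_of_sq_sub_sq hh.le hτ.le (hs.l2_identity hh hτ.ne' h₀ h₁)

theorem LinStep.h1_le (hh : 0 < h) (hτ : 0 < τ) {v₀ v₁ g : ℕ → ℂ}
    (hs : LinStep h τ M v₀ v₁ g) (h₀ : ZeroBdry M v₀) (h₁ : ZeroBdry M v₁)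
    (hg : ZeroBdry M g) :
    h1Norm h M v₁ ≤ h1Norm h M v₀ + τ * h1Norm h M g :=
  l2Norm_le_of_sq_sub_sq hh.le hτ.le (hs.h1_identity hh hτ.ne' h₀ h₁ hg)

/-- Extension of the vector of interior values by zero. -/
def extendZero (N : ℕ) : (Fin N → ℂ) →ₗ[ℂ] (ℕ → ℂ) where
  toFun x l := if H : 1 ≤ l ∧ l - 1 < N then x ⟨l - 1, H.2⟩ else 0
  map_add' x y := by funext l; by_cases H : 1 ≤ l ∧ l - 1 < N <;> simp [H]
  map_smul' c x := by funext l; by_cases H : 1 ≤ l ∧ l - 1 < N <;> simp [H]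

theorem extendZero_succ {N : ℕ} (x : Fin N → ℂ) (k : Fin N) :
    extendZero N x (k + 1) = x k := by simp [extendZero]

theorem extendZero_apply {N : ℕ} (f : ℕ → ℂ) {l : ℕ} (h1 : 1 ≤ l) (h2 : l < N + 1) :
    extendZero N (fun k => f (k + 1)) l = f l := by
  have H : 1 ≤ l ∧ l - 1 < N := ⟨h1, by omega⟩
  simp [extendZero, H, Nat.sub_add_cancel h1]

theorem zeroBdry_extendZero {N : ℕ} (x : Fin N → ℂ) : ZeroBdry (N + 1) (extendZero N x) := by
  constructor <;> simp [extendZero]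

theorem l2Norm_extendZero (hh : 0 ≤ h) {N : ℕ} (x : Fin N → ℂ) :
    l2Norm h (N + 1) (extendZero N x) = √h * ‖WithLp.toLp 2 x‖ := by
  rw [l2Norm, Real.sqrt_mul hh, EuclideanSpace.norm_eq, Finset.sum_range_succ',
    (zeroBdry_extendZero x).1, Finset.sum_range]
  simp only [extendZero_succ]
  simp

/-- The interior values solve a square linear system; l² stability with zero data shows that its
kernel is trivial. -/
theorem exists_linStep (hh : 0 < h) (hτ : 0 < τ) {M : ℕ} (hM : 1 ≤ M) (v₀ g : ℕ → ℂ) :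
    ∃ v₁, ZeroBdry M v₁ ∧ LinStep h τ M v₀ v₁ g := by
  obtain ⟨N, rfl⟩ : ∃ N, M = N + 1 := ⟨M - 1, by omega⟩
  let A : (Fin N → ℂ) →ₗ[ℂ] (Fin N → ℂ) :=
    { toFun := fun x k => Complex.I * (extendZero N x (k + 1) / τ)
        + 1 / 4 * deltaSq h (extendZero N x) (k + 1)
      map_add' := fun x y => by
        funext k; simp only [map_add, Pi.add_apply, deltaSq]; ring
      map_smul' := fun c x => by
        funext k
        simp only [map_smul, Pi.smul_apply, deltaSq, smul_eq_mul, RingHom.id_apply]; ring }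
  have hA : ∀ x k, A x k = Complex.I * (extendZero N x (k + 1) / τ)
        + 1 / 4 * deltaSq h (extendZero N x) (k + 1) := fun _ _ => rfl
  have hinj : Function.Injective A := by
    rw [← LinearMap.ker_eq_bot, LinearMap.ker_eq_bot']
    intro x hx
    have hs : LinStep h τ (N + 1) 0 (extendZero N x) 0 := by
      intro j h1 h2
      obtain ⟨k, rfl⟩ : ∃ k, j = k + 1 := ⟨j - 1, by omega⟩
      have := congrFun hx ⟨k, by omega⟩
      rw [hA] at this
      simp only [deltaSq, Pi.zero_apply] at this ⊢
      linear_combination this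
    have h0 : ZeroBdry (N + 1) (0 : ℕ → ℂ) := ⟨rfl, rfl⟩
    have hz : l2Norm h (N + 1) (0 : ℕ → ℂ) = 0 := by simp [l2Norm]
    have := hs.l2_le hh hτ h0 (zeroBdry_extendZero x)
    rw [hz, mul_zero, add_zero] at this
    have h1 := eq_zero_of_l2Norm_eq_zero hh (le_antisymm this (l2Norm_nonneg _))
    funext k
    rw [← extendZero_succ x k]
    exact h1 _ (by omega)
  obtain ⟨x, hx⟩ := (LinearMap.injective_iff_surjective.1 hinj) fun k =>
    Complex.I * (v₀ (k + 1) / τ) - 1 / 4 * deltaSq h v₀ (k + 1) + g (k + 1)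
  refine ⟨extendZero N x, zeroBdry_extendZero x, fun j h1 h2 => ?_⟩
  obtain ⟨k, rfl⟩ : ∃ k, j = k + 1 := ⟨j - 1, by omega⟩
  have := congrFun hx ⟨k, by omega⟩
  rw [hA] at this
  simp only [deltaSq] at this ⊢
  linear_combination this

/-- Contraction principle for grid functions: the discrete `l²` distance is contracted on a ball
of the discrete `H¹` seminorm. -/
theorem exists_fixedPoint_grid (hh : 0 < h) {M : ℕ} (hM : 1 ≤ M) {R : ℝ} (hR : 0 ≤ R)
    (Φ : (ℕ → ℂ) → ℕ → ℂ) (hΦ : ∀ v, ZeroBdry M (Φ v))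
    (hmaps : ∀ v, ZeroBdry M v → h1Norm h M v ≤ R → h1Norm h M (Φ v) ≤ R)
    (hcontr : ∀ v w, ZeroBdry M v → ZeroBdry M w → h1Norm h M v ≤ R → h1Norm h M w ≤ R →
      l2Norm h M (Φ v - Φ w) ≤ 1 / 2 * l2Norm h M (v - w)) :
    ∃ v, ZeroBdry M v ∧ h1Norm h M v ≤ R ∧ ∀ j ≤ M, Φ v j = v j := by
  obtain ⟨N, rfl⟩ : ∃ N, M = N + 1 := ⟨M - 1, by omega⟩
  -- Restriction `r` and zero extension `e` identify zero-boundary grid functions with a Euclidean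
  -- space, where the l² distance is √h times the Euclidean one. The H¹ ball is closed there, hence
  -- complete.
  let r : (ℕ → ℂ) → EuclideanSpace ℂ (Fin N) := fun v => WithLp.toLp 2 fun k => v (k + 1)
  let e : EuclideanSpace ℂ (Fin N) → ℕ → ℂ := fun x => extendZero N (WithLp.ofLp x)
  have her : ∀ v, ZeroBdry (N + 1) v → ∀ j ≤ N + 1, e (r v) j = v j := by
    intro v hv j hj
    rcases Nat.eq_zero_or_pos j with rfl | hpos
    · rw [hv.1]; exact (zeroBdry_extendZero _).1
    · rcases hj.eq_or_lt with rfl | hlt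
      · rw [hv.2]; exact (zeroBdry_extendZero _).2
      · exact extendZero_apply v hpos hlt
  have hez : ∀ x, ZeroBdry (N + 1) (e x) := fun x => zeroBdry_extendZero _
  have hdist : ∀ x y, l2Norm h (N + 1) (e x - e y) = √h * dist x y := by
    intro x y
    rw [dist_eq_norm, ← l2Norm_extendZero hh.le (WithLp.ofLp (x - y))]
    congr 1
    exact (map_sub (extendZero N) (WithLp.ofLp x) (WithLp.ofLp y)).symm
  let s : Set (EuclideanSpace ℂ (Fin N)) := {x | h1Norm h (N + 1) (e x) ≤ R}
  let Ψ : EuclideanSpace ℂ (Fin N) → EuclideanSpace ℂ (Fin N) := fun x => r (Φ (e x))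
  have hcont : Continuous e := by
    have : Continuous (extendZero N) := LinearMap.continuous_on_pi _
    exact this.comp (PiLp.continuous_ofLp 2 _)
  have hsc : IsClosed s := by
    refine isClosed_le ?_ continuous_const
    unfold h1Norm l2Norm deltaPlus
    have hj : ∀ j, Continuous fun x => e x j := fun j => (continuous_apply j).comp hcont
    fun_prop
  have hmap : MapsTo Ψ s s := by
    intro x hx
    have h1 := hmaps (e x) (hez x) hx
    change h1Norm h (N + 1) (e (r (Φ (e x)))) ≤ R
    rwa [h1Norm_congr (her _ (hΦ _))]
  have hlip : ∀ x ∈ s, ∀ y ∈ s, dist (Ψ x) (Ψ y) ≤ 1 / 2 * dist x y := by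
    intro x hx y hy
    have h1 := hcontr (e x) (e y) (hez x) (hez y) hx hy
    have h2 : l2Norm h (N + 1) (Φ (e x) - Φ (e y)) = √h * dist (Ψ x) (Ψ y) := by
      rw [← hdist]
      refine l2Norm_congr fun j hj => ?_
      simp only [Pi.sub_apply, Ψ]
      rw [her _ (hΦ _) j hj.le, her _ (hΦ _) j hj.le]
    rw [h2, hdist] at h1
    have : 0 < √h := Real.sqrt_pos.2 hh
    nlinarith
  have hs0 : (0 : EuclideanSpace ℂ (Fin N)) ∈ s := by
    have : e 0 = 0 := map_zero (extendZero N)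
    change h1Norm h (N + 1) (e 0) ≤ R
    rw [this]
    simpa [h1Norm, l2Norm, deltaPlus] using hR
  have hK : ContractingWith (1 / 2 : NNReal) (hmap.restrict Ψ s s) := by
    refine ⟨by norm_num, LipschitzWith.of_dist_le_mul fun x y => ?_⟩
    have := hlip x x.2 y y.2
    simpa [Subtype.dist_eq] using this
  obtain ⟨x, hxs, hx, -⟩ := hK.exists_fixedPoint' hsc.isComplete hmap hs0 (edist_ne_top _ _)
  refine ⟨e x, hez x, hxs, fun j hj => ?_⟩
  rw [← her _ (hΦ _) j hj]
  exact congrFun (congrArg e hx) j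

end Step

end GPE

namespace GPE

/-! ### The nonlinear term -/

section Nonlinear

variable {h τ : ℝ} {M : ℕ} {V : ℕ → ℝ} {β : ℝ}

/-- The potential and nonlinear part of the Crank–Nicolson scheme. -/
noncomputable def cnTerm (V : ℕ → ℝ) (β : ℝ) (w p : ℕ → ℂ) (j : ℕ) : ℂ :=
  ((V j : ℂ) + (β : ℂ) / 2 * ((‖w j‖ : ℂ) ^ 2 + (‖p j‖ : ℂ) ^ 2)) * ((w j + p j) / 2)

theorem zeroBdry_cnTerm {w p : ℕ → ℂ} (hw : ZeroBdry M w) (hp : ZeroBdry M p) :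
    ZeroBdry M (cnTerm V β w p) := by
  simp [ZeroBdry, cnTerm, hw.1, hw.2, hp.1, hp.2]

/-- The properties shared by the discrete `l²` norm and the discrete `H¹` seminorm. -/
structure GridNorm (h : ℝ) (M : ℕ) (N : (ℕ → ℂ) → ℝ) : Prop where
  nonneg : ∀ v, 0 ≤ N v
  add_le : ∀ v w, N (v + w) ≤ N v + N w
  smul : ∀ (c : ℂ) v, N (c • v) = ‖c‖ * N v
  star : ∀ v, N (star v) = N v
  mul_le : ∀ v w, ZeroBdry M v → ZeroBdry M w → N (v * w) ≤ 2 * √(h * M) * h1Norm h M v * N w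
  step_le : ∀ {τ : ℝ} {v₀ v₁ g : ℕ → ℂ}, 0 < τ → LinStep h τ M v₀ v₁ g → ZeroBdry M v₀ →
    ZeroBdry M v₁ → ZeroBdry M g → N v₁ ≤ N v₀ + τ * N g

theorem gridNorm_l2Norm (hh : 0 < h) : GridNorm h M (l2Norm h M) where
  nonneg := l2Norm_nonneg
  add_le := l2Norm_add_le hh.le
  smul := l2Norm_smul
  star := l2Norm_star
  mul_le _ w hv _ := l2Norm_mul_le hh hv.1 w
  step_le hτ hs h₀ h₁ _ := hs.l2_le hh hτ h₀ h₁

theorem gridNorm_h1Norm (hh : 0 < h) : GridNorm h M (h1Norm h M) where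
  nonneg := h1Norm_nonneg
  add_le := h1Norm_add_le hh.le
  smul := h1Norm_smul
  star := h1Norm_star
  mul_le _ _ hv hw := h1Norm_mul_le hh hv.1 hw.1
  step_le hτ hs h₀ h₁ hg := hs.h1_le hh hτ h₀ h₁ hg

/-- `Vm` alone would do; the extra term gives the same constant as in the H¹ version. -/
theorem l2Norm_potential_mul_le (hh : 0 < h) {Vm Λ : ℝ} (hVm : ∀ j ≤ M, |V j| ≤ Vm)
    (hΛ : 0 ≤ Λ) (v : ℕ → ℂ) :
    l2Norm h M ((fun j => (V j : ℂ)) * v) ≤ (Vm + Λ * (h * M)) * l2Norm h M v := by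
  have h0 : 0 ≤ Vm := (abs_nonneg _).trans (hVm 0 (Nat.zero_le _))
  calc l2Norm h M ((fun j => (V j : ℂ)) * v) ≤ l2Norm h M ((Vm : ℂ) • v) := by
        refine l2Norm_mono hh.le fun j hj => ?_
        rw [Pi.mul_apply, Pi.smul_apply, norm_mul, norm_smul, Complex.norm_real,
          Complex.norm_real, Real.norm_of_nonneg h0]
        exact mul_le_mul_of_nonneg_right (hVm j hj.le) (norm_nonneg _)
    _ = Vm * l2Norm h M v := by rw [l2Norm_smul, Complex.norm_real, Real.norm_of_nonneg h0]
    _ ≤ _ := mul_le_mul_of_nonneg_right (le_add_of_nonneg_right (by positivity))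
      (l2Norm_nonneg _)

theorem h1Norm_potential_mul_le (hh : 0 < h) {Vm Λ : ℝ} (hVm : ∀ j ≤ M, |V j| ≤ Vm)
    (hΛ : 0 ≤ Λ) (hV : ∀ j < M, |V (j + 1) - V j| ≤ Λ * h) {v : ℕ → ℂ} (hv : ZeroBdry M v) :
    h1Norm h M ((fun j => (V j : ℂ)) * v) ≤ (Vm + Λ * (h * M)) * h1Norm h M v := by
  have h0 : 0 ≤ Vm := (abs_nonneg _).trans (hVm 0 (Nat.zero_le _))
  have e : deltaPlus h ((fun j => (V j : ℂ)) * v)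
      = (fun j => (V (j + 1) : ℂ) * deltaPlus h v j)
        + fun j => (((V (j + 1) - V j) / h : ℝ) : ℂ) * v j := by
    funext j
    simp only [deltaPlus, Pi.mul_apply, Pi.add_apply]
    push_cast; ring
  have key : ∀ {c : ℝ} (_ : 0 ≤ c) {a : ℕ → ℝ} (_ : ∀ j < M, |a j| ≤ c) (w : ℕ → ℂ),
      l2Norm h M (fun j => (a j : ℂ) * w j) ≤ c * l2Norm h M w := by
    intro c hc a ha w
    calc _ ≤ l2Norm h M ((c : ℂ) • w) := by
          refine l2Norm_mono hh.le fun j hj => ?_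
          rw [Pi.smul_apply, norm_mul, norm_smul, Complex.norm_real,
            Complex.norm_real, Real.norm_of_nonneg hc]
          exact mul_le_mul_of_nonneg_right (ha j hj) (norm_nonneg _)
      _ = _ := by rw [l2Norm_smul, Complex.norm_real, Real.norm_of_nonneg hc]
  have h1 := key h0 (a := fun j => V (j + 1)) (fun j hj => hVm (j + 1) hj) (deltaPlus h v)
  have h2 := key hΛ (a := fun j => (V (j + 1) - V j) / h) (fun j hj => by
    rw [abs_div, abs_of_pos hh, div_le_iff₀ hh]; exact hV j hj) v
  have h3 := l2Norm_le_h1Norm (M := M) hh hv.1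
  have h4 := mul_le_mul_of_nonneg_left h3 hΛ
  calc h1Norm h M ((fun j => (V j : ℂ)) * v) ≤ Vm * h1Norm h M v + Λ * l2Norm h M v := by
        rw [h1Norm, e]
        exact (l2Norm_add_le hh.le _ _).trans (add_le_add h1 h2)
    _ ≤ _ := by linarith

/-- Lipschitz constant of the nonlinear term on a ball of radius `R`. -/
noncomputable def lipConst (ℓ β cV R : ℝ) : ℝ := cV / 2 + 6 * |β| * ℓ * R ^ 2

/-- Proved for an abstract `GridNorm`, hence for l² and H¹ at once. The ball is always an H¹ ball,
since the factors that are not differences are measured in H¹. -/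
theorem cnTerm_sub_le {N : (ℕ → ℂ) → ℝ} (hN : GridNorm h M N) (hh : 0 < h) {cV R : ℝ}
    (hcV : 0 ≤ cV)
    (hV : ∀ v, ZeroBdry M v → N ((fun j => (V j : ℂ)) * v) ≤ cV * N v)
    {w p w' p' : ℕ → ℂ} (hw : ZeroBdry M w) (hp : ZeroBdry M p) (hw' : ZeroBdry M w')
    (hp' : ZeroBdry M p') (hwR : h1Norm h M w ≤ R) (hpR : h1Norm h M p ≤ R)
    (hwR' : h1Norm h M w' ≤ R) (hpR' : h1Norm h M p' ≤ R) :
    N (cnTerm V β w p - cnTerm V β w' p') ≤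
      lipConst (h * M) β cV R * (N (w - w') + N (p - p')) := by
  set d := w - w' with hd
  set q := p - p' with hq
  have zd : ZeroBdry M d := hw.sub hw'
  have zq : ZeroBdry M q := hp.sub hp'
  have hR : 0 ≤ R := (h1Norm_nonneg _).trans hwR
  set κ := 2 * √(h * M) with hκ
  have κ0 : 0 ≤ κ := by positivity
  have κ2 : κ ^ 2 = 4 * (h * M) := by
    rw [hκ, mul_pow, Real.sq_sqrt (by positivity)]; ring
  have mulN : ∀ {N' : (ℕ → ℂ) → ℝ}, GridNorm h M N' → ∀ {v x : ℕ → ℂ} {r s : ℝ},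
      ZeroBdry M v → ZeroBdry M x → h1Norm h M v ≤ r → N' x ≤ s → N' (v * x) ≤ κ * r * s := by
    intro N' hN' v x r s hv hx hr hs
    refine (hN'.mul_le v x hv hx).trans ?_
    have := (h1Norm_nonneg v).trans hr
    have := hN'.nonneg x
    gcongr
  have starR : ∀ {v : ℕ → ℂ}, h1Norm h M v ≤ R → h1Norm h M (star v) ≤ R := fun hv => by
    rwa [h1Norm_star]
  -- With |w|² written as w̄w the term is a polynomial, and |w|² - |w'|² = w̄d + w'd̄. The two cubic
  -- contributions are bounded by 2κ²R² and 4κ²R²; with the prefactor |β|/4 and κ² = 4hM this gives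
  -- the 6|β|(hM)R² of `lipConst`.
  have e : cnTerm V β w p - cnTerm V β w' p' =
      (1 / 2 : ℂ) • ((fun j => (V j : ℂ)) * (d + q)) +
      ((β / 4 : ℝ) : ℂ) • ((star w * w + star p * p) * (d + q)
        + (w' + p') * ((star w * d + w' * star d) + (star p * q + p' * star q))) := by
    funext j
    simp only [cnTerm, hd, hq, Pi.sub_apply, Pi.add_apply, Pi.smul_apply, Pi.mul_apply,
      Pi.star_apply, smul_eq_mul, ← Complex.mul_conj', Complex.star_def, map_sub]
    push_cast
    ring
  have nd := hN.nonneg d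
  have nq := hN.nonneg q
  have hdq : N (d + q) ≤ N d + N q := hN.add_le _ _
  have hwwR : ∀ {v : ℕ → ℂ}, ZeroBdry M v → h1Norm h M v ≤ R →
      h1Norm h M (star v * v) ≤ κ * R * R := fun hv hvR =>
    mulN (gridNorm_h1Norm hh) hv.star hv (starR hvR) hvR
  have t1 : N ((fun j => (V j : ℂ)) * (d + q)) ≤ cV * (N d + N q) :=
    (hV _ (zd.add zq)).trans (mul_le_mul_of_nonneg_left hdq hcV)
  have t2 : N ((star w * w + star p * p) * (d + q)) ≤ κ * (κ * R * R + κ * R * R) * (N d + N q) :=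
    mulN hN ((hw.mul_left _).add (hp.mul_left _)) (zd.add zq)
      ((h1Norm_add_le hh.le _ _).trans (add_le_add (hwwR hw hwR) (hwwR hp hpR))) hdq
  have t3 : N ((star w * d + w' * star d) + (star p * q + p' * star q))
      ≤ (κ * R * N d + κ * R * N d) + (κ * R * N q + κ * R * N q) := by
    refine (hN.add_le _ _).trans (add_le_add ?_ ?_)
    · exact (hN.add_le _ _).trans (add_le_add (mulN hN hw.star zd (starR hwR) le_rfl)
        (mulN hN hw' zd.star hwR' (hN.star d).le))
    · exact (hN.add_le _ _).trans (add_le_add (mulN hN hp.star zq (starR hpR) le_rfl)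
        (mulN hN hp' zq.star hpR' (hN.star q).le))
  have t4 : N ((w' + p') * ((star w * d + w' * star d) + (star p * q + p' * star q)))
      ≤ κ * (R + R) * ((κ * R * N d + κ * R * N d) + (κ * R * N q + κ * R * N q)) :=
    mulN hN (hw'.add hp') (((zd.mul_left _).add (zd.star.mul_left _)).add
      ((zq.mul_left _).add (zq.star.mul_left _)))
      ((h1Norm_add_le hh.le _ _).trans (add_le_add hwR' hpR')) t3
  rw [e]
  refine (hN.add_le _ _).trans ?_
  rw [hN.smul, hN.smul, Complex.norm_real, Real.norm_eq_abs, abs_div, abs_of_pos (by norm_num :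
    (0 : ℝ) < 4)]
  have n1 : ‖(1 / 2 : ℂ)‖ = 1 / 2 := by norm_num
  rw [n1]
  have t5 := (hN.add_le _ _).trans (add_le_add t2 t4)
  calc _ ≤ 1 / 2 * (cV * (N d + N q)) + |β| / 4 * (κ * (κ * R * R + κ * R * R) * (N d + N q)
        + κ * (R + R) * ((κ * R * N d + κ * R * N d) + (κ * R * N q + κ * R * N q))) := by
        gcongr
    _ = (cV / 2 + 6 * |β| / 4 * κ ^ 2 * R ^ 2) * (N d + N q) := by ring
    _ = _ := by rw [κ2, lipConst]; ring

theorem cnTerm_zero : cnTerm V β 0 0 = 0 := by funext j; simp [cnTerm]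

/-- Conservation of mass over one step. -/
theorem l2Norm_step_eq (hh : 0 < h) (hτ : 0 < τ) {w p : ℕ → ℂ} (hw : ZeroBdry M w)
    (hp : ZeroBdry M p) (hs : LinStep h τ M p w (cnTerm V β w p)) :
    l2Norm h M w = l2Norm h M p := by
  have h1 := hs.l2_identity hh hτ.ne' hp hw
  have h2 : (h * ∑ j ∈ Finset.range M, cnTerm V β w p j * star (w j + p j) : ℂ).im = 0 := by
    have : ∀ j, cnTerm V β w p j * star (w j + p j)
        = (((V j + β / 2 * (‖w j‖ ^ 2 + ‖p j‖ ^ 2)) / 2 * ‖w j + p j‖ ^ 2 : ℝ) : ℂ) := by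
      intro j
      push_cast
      rw [cnTerm, ← Complex.mul_conj' (w j + p j), Complex.star_def]
      ring
    simp only [this]
    rw [← Complex.ofReal_sum, ← Complex.ofReal_mul, Complex.ofReal_im]
  rw [h2, mul_zero, sub_eq_zero] at h1
  exact (pow_left_inj₀ (l2Norm_nonneg _) (l2Norm_nonneg _) two_ne_zero).1 h1

/-- Conservation of energy over one step. -/
theorem h1Norm_sq_step_eq (hh : 0 < h) {w p : ℕ → ℂ} (hw : ZeroBdry M w)
    (hp : ZeroBdry M p) (hs : LinStep h τ M p w (cnTerm V β w p)) :
    h1Norm h M w ^ 2 = h1Norm h M p ^ 2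
      - 2 * (h * ∑ j ∈ Finset.range M, (V j + β / 2 * (‖w j‖ ^ 2 + ‖p j‖ ^ 2))
          * (‖w j‖ ^ 2 - ‖p j‖ ^ 2)) := by
  have reMul : ∀ x y : ℂ, ((x + y) * star (x - y)).re = ‖x‖ ^ 2 - ‖y‖ ^ 2 := by
    intro x y
    rw [← Complex.normSq_eq_norm_sq, ← Complex.normSq_eq_norm_sq, Complex.normSq_apply,
      Complex.normSq_apply]
    simp only [Complex.mul_re, Complex.star_def,
      Complex.conj_re, Complex.conj_im, Complex.add_re, Complex.add_im, Complex.sub_re,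
      Complex.sub_im]
    ring
  have h1 : ∑ j ∈ Finset.range M, Complex.I * ((w j - p j) / τ) * star (w j - p j)
      = -(1 / 4) * ∑ j ∈ Finset.range M, deltaSq h (w + p) j * star ((w - p) j)
        + ∑ j ∈ Finset.range M, cnTerm V β w p j * star (w j - p j) := by
    rw [Finset.mul_sum, ← Finset.sum_add_distrib]
    refine Finset.sum_congr rfl fun j hj => ?_
    rcases Nat.eq_zero_or_pos j with rfl | hpos
    · simp [hw.1, hp.1]
    · rw [hs j hpos (Finset.mem_range.1 hj), deltaSq_half, Pi.sub_apply]; ring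
  rw [sum_deltaSq_mul hh.ne' _ (hw.sub hp)] at h1
  have h2 := congrArg Complex.re h1
  have e0 : (∑ j ∈ Finset.range M, Complex.I * ((w j - p j) / τ) * star (w j - p j)).re = 0 := by
    rw [Complex.re_sum]
    refine Finset.sum_eq_zero fun j _ => ?_
    have : Complex.I * ((w j - p j) / τ) * star (w j - p j)
        = ((‖w j - p j‖ ^ 2 / τ : ℝ) : ℂ) * Complex.I := by
      push_cast
      rw [← Complex.mul_conj' (w j - p j), Complex.star_def]; ring
    rw [this, Complex.re_ofReal_mul, Complex.I_re, mul_zero]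
  have e1 : (∑ j ∈ Finset.range M, deltaPlus h (w + p) j * star (deltaPlus h (w - p) j)).re
      = ∑ j ∈ Finset.range M, (‖deltaPlus h w j‖ ^ 2 - ‖deltaPlus h p j‖ ^ 2) := by
    rw [Complex.re_sum]
    refine Finset.sum_congr rfl fun j _ => ?_
    rw [← reMul]
    congr 2
    · rw [deltaPlus_add]; rfl
    · congr 1; simp only [deltaPlus, Pi.sub_apply]; ring
  have e2 : (∑ j ∈ Finset.range M, cnTerm V β w p j * star (w j - p j)).re
      = 1 / 2 * ∑ j ∈ Finset.range M, (V j + β / 2 * (‖w j‖ ^ 2 + ‖p j‖ ^ 2))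
          * (‖w j‖ ^ 2 - ‖p j‖ ^ 2) := by
    rw [Complex.re_sum, Finset.mul_sum]
    refine Finset.sum_congr rfl fun j _ => ?_
    have : cnTerm V β w p j * star (w j - p j)
        = (((V j + β / 2 * (‖w j‖ ^ 2 + ‖p j‖ ^ 2)) / 2 : ℝ) : ℂ)
          * ((w j + p j) * star (w j - p j)) := by
      push_cast; rw [cnTerm]; ring
    rw [this, Complex.re_ofReal_mul, reMul]; ring
  have e3 : ∀ z : ℂ, (-(1 / 4 : ℂ) * -z).re = 1 / 4 * z.re := by
    intro z
    have : (-(1 / 4 : ℂ) * -z) = ((1 / 4 : ℝ) : ℂ) * z := by push_cast; ring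
    rw [this, Complex.re_ofReal_mul]
  rw [Complex.add_re, e0, e3, e1, e2, Finset.sum_sub_distrib] at h2
  rw [h1Norm, h1Norm, l2Norm_sq hh.le, l2Norm_sq hh.le]
  linear_combination (-4 * h) * h2

/-- A bound for the discrete `H¹` seminorm after one step. -/
noncomputable def stepBound (ℓ β Vm B : ℝ) : ℝ :=
  2 * |β| * (ℓ * B) ^ 3 + (B ^ 2 + 4 * Vm * (ℓ * B) ^ 2 + 2 * |β| * (ℓ * B) ^ 3 * B) + 1

/-- An a priori bound for every solution of a step, without smallness of τ. Mass conservation fixes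
m = ‖w‖₂, and the Gagliardo–Nirenberg inequality bounds the quartic energy by a multiple of m³X,
where X is the H¹ seminorm of w. This is only linear in X, so X² absorbs it whatever the sign of β.
-/
theorem h1Norm_step_le (hh : 0 < h) (hτ : 0 < τ) {Vm B : ℝ} (hVm : ∀ j ≤ M, |V j| ≤ Vm)
    {w p : ℕ → ℂ} (hw : ZeroBdry M w) (hp : ZeroBdry M p) (hpB : h1Norm h M p ≤ B)
    (hs : LinStep h τ M p w (cnTerm V β w p)) :
    h1Norm h M w ≤ stepBound (h * M) β Vm B := by
  have hmass := l2Norm_step_eq hh hτ hw hp hs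
  have hen := h1Norm_sq_step_eq hh hw hp hs
  have h0 : 0 ≤ Vm := (abs_nonneg _).trans (hVm 0 (Nat.zero_le _))
  have hB : 0 ≤ B := (h1Norm_nonneg _).trans hpB
  set X := h1Norm h M w
  set Y := h1Norm h M p
  set m := l2Norm h M p with hm
  have hX : 0 ≤ X := h1Norm_nonneg _
  have hY : 0 ≤ Y := h1Norm_nonneg _
  have hm0 : 0 ≤ m := l2Norm_nonneg _
  set A := h * (M : ℝ) * B
  have hmA : m ≤ A := (l2Norm_le_h1Norm hh hp.1).trans
    (mul_le_mul_of_nonneg_left hpB (by positivity))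
  have sw : h * ∑ j ∈ Finset.range M, ‖w j‖ ^ 2 = m ^ 2 := by rw [← l2Norm_sq hh.le, hmass]
  have sp : h * ∑ j ∈ Finset.range M, ‖p j‖ ^ 2 = m ^ 2 := by rw [← l2Norm_sq hh.le]
  have hterm : ∀ j ∈ Finset.range M, -((V j + β / 2 * (‖w j‖ ^ 2 + ‖p j‖ ^ 2))
          * (‖w j‖ ^ 2 - ‖p j‖ ^ 2))
      ≤ (Vm + |β| / 2 * (2 * m * X)) * ‖w j‖ ^ 2
        + (Vm + |β| / 2 * (2 * m * Y)) * ‖p j‖ ^ 2 := by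
    intro j hj
    have hj' := (Finset.mem_range.1 hj).le
    have bw : ‖w j‖ ^ 2 ≤ 2 * m * X := by rw [← hmass]; exact norm_sq_le hh hw hj'
    have bp : ‖p j‖ ^ 2 ≤ 2 * m * Y := norm_sq_le hh hp hj'
    have v1 := abs_le.1 (hVm j hj')
    have a1 : -β ≤ |β| := neg_le_abs β
    have a2 : β ≤ |β| := le_abs_self β
    have w0 : 0 ≤ ‖w j‖ ^ 2 := sq_nonneg _
    have p0 : 0 ≤ ‖p j‖ ^ 2 := sq_nonneg _
    generalize ‖w j‖ ^ 2 = s at *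
    generalize ‖p j‖ ^ 2 = r at *
    have i1 : -V j * s ≤ Vm * s := mul_le_mul_of_nonneg_right (by linarith) w0
    have i2 : V j * r ≤ Vm * r := mul_le_mul_of_nonneg_right (by linarith) p0
    have i3 : -β * (s * s) ≤ |β| * (2 * m * X * s) :=
      mul_le_mul a1 (mul_le_mul_of_nonneg_right bw w0) (mul_nonneg w0 w0) (abs_nonneg _)
    have i4 : β * (r * r) ≤ |β| * (2 * m * Y * r) :=
      mul_le_mul a2 (mul_le_mul_of_nonneg_right bp p0) (mul_nonneg p0 p0) (abs_nonneg _)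
    linarith
  have hsum := mul_le_mul_of_nonneg_left (Finset.sum_le_sum hterm) hh.le
  rw [Finset.sum_neg_distrib, Finset.sum_add_distrib, ← Finset.mul_sum, ← Finset.mul_sum] at hsum
  have hX2 : X ^ 2 ≤ Y ^ 2 + 4 * Vm * m ^ 2 + 2 * |β| * m ^ 3 * (X + Y) := by
    have : h * ((Vm + |β| / 2 * (2 * m * X)) * ∑ j ∈ Finset.range M, ‖w j‖ ^ 2
        + (Vm + |β| / 2 * (2 * m * Y)) * ∑ j ∈ Finset.range M, ‖p j‖ ^ 2)
        = (Vm + |β| / 2 * (2 * m * X)) * m ^ 2 + (Vm + |β| / 2 * (2 * m * Y)) * m ^ 2 := by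
      linear_combination (Vm + |β| / 2 * (2 * m * X)) * sw + (Vm + |β| / 2 * (2 * m * Y)) * sp
    rw [this] at hsum
    rw [hen]
    linarith
  have hX3 : X ^ 2 ≤ B ^ 2 + 4 * Vm * A ^ 2 + 2 * |β| * A ^ 3 * (X + B) :=
    hX2.trans (by gcongr)
  unfold stepBound
  change X ≤ 2 * |β| * A ^ 3 + (B ^ 2 + 4 * Vm * A ^ 2 + 2 * |β| * A ^ 3 * B) + 1
  have hA : 0 ≤ A := hm0.trans hmA
  set c := 2 * |β| * A ^ 3
  have hc : 0 ≤ c := by positivity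
  have hD : 0 ≤ B ^ 2 + 4 * Vm * A ^ 2 + c * B := by positivity
  -- From X² ≤ D + cX and X > c + D + 1 one would get X² - cX > X(D + 1) ≥ D.
  by_contra! hlt
  nlinarith

theorem LinStep.congr {v₀ v₁ w₀ w₁ : ℕ → ℂ} (h₀ : ∀ j ≤ M, v₀ j = w₀ j)
    (h₁ : ∀ j ≤ M, v₁ j = w₁ j) (hs : LinStep h τ M v₀ v₁ (cnTerm V β v₁ v₀)) :
    LinStep h τ M w₀ w₁ (cnTerm V β w₁ w₀) := by
  intro j h1 h2
  have e := hs j h1 h2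
  simp only [deltaSq, cnTerm] at e ⊢
  rwa [h₀ j h2.le, h₁ j h2.le, h₀ (j + 1) h2, h₁ (j + 1) h2, h₀ (j - 1) (by omega),
    h₁ (j - 1) (by omega)] at e

/-- Solvability of one step in a ball of the discrete `H¹` seminorm. -/
theorem exists_step (hh : 0 < h) (hτ : 0 < τ) (hM : 1 ≤ M) {cV B R : ℝ} (hcV : 0 ≤ cV)
    (hVl : ∀ v, ZeroBdry M v → l2Norm h M ((fun j => (V j : ℂ)) * v) ≤ cV * l2Norm h M v)
    (hVh : ∀ v, ZeroBdry M v → h1Norm h M ((fun j => (V j : ℂ)) * v) ≤ cV * h1Norm h M v)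
    (hBR : B + 1 ≤ R) (h1 : τ * lipConst (h * M) β cV R ≤ 1 / 2)
    (h2 : τ * (lipConst (h * M) β cV R * (R + B)) ≤ 1)
    {p : ℕ → ℂ} (hp : ZeroBdry M p) (hpB : h1Norm h M p ≤ B) :
    ∃ w, ZeroBdry M w ∧ h1Norm h M w ≤ R ∧ LinStep h τ M p w (cnTerm V β w p) := by
  choose S hS0 hS using fun g => exists_linStep hh hτ hM p g
  have hB : 0 ≤ B := (h1Norm_nonneg _).trans hpB
  have hR : 0 ≤ R := by linarith
  have hpR : h1Norm h M p ≤ R := by linarith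
  have z0 : ZeroBdry M (0 : ℕ → ℂ) := ⟨rfl, rfl⟩
  have n0 : h1Norm h M (0 : ℕ → ℂ) = 0 := by simp [h1Norm, l2Norm, deltaPlus]
  have hL : 0 ≤ lipConst (h * M) β cV R := by unfold lipConst; positivity
  suffices H : ∃ w, ZeroBdry M w ∧ h1Norm h M w ≤ R ∧
      ∀ j ≤ M, S (cnTerm V β w p) j = w j by
    obtain ⟨w, hw0, hwR, hw⟩ := H
    refine ⟨w, hw0, hwR, fun j j1 j2 => ?_⟩
    have := hS (cnTerm V β w p) j j1 j2
    simp only [deltaSq] at this ⊢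
    rwa [hw j j2.le, hw (j + 1) j2, hw (j - 1) (by omega)] at this
  refine exists_fixedPoint_grid hh hM hR (fun w => S (cnTerm V β w p)) (fun w => hS0 _) ?_ ?_
  · intro v hv hvR
    -- The ball is preserved by H¹ stability: the image has norm at most B + 1 ≤ R. The contraction
    -- below is only measured in l².
    have e1 := (hS (cnTerm V β v p)).h1_le hh hτ hp (hS0 _) (zeroBdry_cnTerm hv hp)
    have e2 := cnTerm_sub_le (β := β) (gridNorm_h1Norm hh) hh hcV hVh hv hp z0 z0 hvR hpR
      (n0.le.trans hR) (n0.le.trans hR)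
    rw [cnTerm_zero, sub_zero, sub_zero, sub_zero] at e2
    have e3 : τ * h1Norm h M (cnTerm V β v p) ≤ 1 := by
      refine le_trans (mul_le_mul_of_nonneg_left (e2.trans ?_) hτ.le) h2
      gcongr
    linarith
  · intro v w hv hw hvR hwR
    have e1 := ((hS (cnTerm V β v p)).sub (hS (cnTerm V β w p))).l2_le hh hτ (hp.sub hp)
      ((hS0 _).sub (hS0 _))
    have e2 := cnTerm_sub_le (β := β) (gridNorm_l2Norm hh) hh hcV hVl hv hp hw hp hvR hpR hwR hpR
    have z : l2Norm h M (p - p) = 0 := by simp [l2Norm]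
    rw [z, add_zero] at e2
    rw [z, zero_add] at e1
    refine e1.trans ((mul_le_mul_of_nonneg_left e2 hτ.le).trans ?_)
    rw [← mul_assoc]
    exact mul_le_mul_of_nonneg_right h1 (l2Norm_nonneg _)

/-- Propagation of the error over one step. -/
theorem error_step {N : (ℕ → ℂ) → ℝ} (hN : GridNorm h M N) (hh : 0 < h) (hτ : 0 < τ) {cV R : ℝ}
    (hcV : 0 ≤ cV)
    (hV : ∀ v, ZeroBdry M v → N ((fun j => (V j : ℂ)) * v) ≤ cV * N v)
    {w p w' p' r : ℕ → ℂ} (hw : ZeroBdry M w) (hp : ZeroBdry M p) (hw' : ZeroBdry M w')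
    (hp' : ZeroBdry M p') (hr : ZeroBdry M r)
    (hwR : h1Norm h M w ≤ R) (hpR : h1Norm h M p ≤ R)
    (hwR' : h1Norm h M w' ≤ R) (hpR' : h1Norm h M p' ≤ R)
    (hs : LinStep h τ M p w (cnTerm V β w p + r))
    (hs' : LinStep h τ M p' w' (cnTerm V β w' p')) :
    N (w - w') ≤ N (p - p') +
      τ * (lipConst (h * M) β cV R * (N (w - w') + N (p - p')) + N r) := by
  have e1 := hN.step_le hτ (hs.sub hs') (hp.sub hp') (hw.sub hw')
    (((zeroBdry_cnTerm hw hp).add hr).sub (zeroBdry_cnTerm hw' hp'))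
  have e2 := cnTerm_sub_le (β := β) hN hh hcV hV hw hp hw' hp' hwR hpR hwR' hpR'
  have e3 : cnTerm V β w p + r - cnTerm V β w' p' = (cnTerm V β w p - cnTerm V β w' p') + r := by
    ring
  rw [e3] at e1
  refine e1.trans ?_
  gcongr
  exact (hN.add_le _ _).trans (by gcongr)

/-- Uniqueness of one step in a ball of the discrete `H¹` seminorm. -/
theorem step_unique (hh : 0 < h) (hτ : 0 < τ) {cV R : ℝ} (hcV : 0 ≤ cV)
    (hVl : ∀ v, ZeroBdry M v → l2Norm h M ((fun j => (V j : ℂ)) * v) ≤ cV * l2Norm h M v)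
    (h1 : τ * lipConst (h * M) β cV R ≤ 1 / 2)
    {w w' p : ℕ → ℂ} (hw : ZeroBdry M w) (hw' : ZeroBdry M w') (hp : ZeroBdry M p)
    (hwR : h1Norm h M w ≤ R) (hwR' : h1Norm h M w' ≤ R) (hpR : h1Norm h M p ≤ R)
    (hs : LinStep h τ M p w (cnTerm V β w p)) (hs' : LinStep h τ M p w' (cnTerm V β w' p)) :
    ∀ j ≤ M, w j = w' j := by
  have z0 : ZeroBdry M (0 : ℕ → ℂ) := ⟨rfl, rfl⟩
  have e := error_step (r := 0) (β := β) (gridNorm_l2Norm hh) hh hτ hcV hVl hw hp hw' hp z0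
    hwR hpR hwR' hpR (by rwa [add_zero]) hs'
  have z : l2Norm h M (p - p) = 0 := by simp [l2Norm]
  have z' : l2Norm h M (0 : ℕ → ℂ) = 0 := by simp [l2Norm]
  rw [z, z', zero_add, add_zero, add_zero, ← mul_assoc] at e
  have n := l2Norm_nonneg (h := h) (M := M) (w - w')
  have e0 : l2Norm h M (w - w') = 0 := by nlinarith
  intro j hj
  rcases hj.eq_or_lt with rfl | hlt
  · rw [hw.2, hw'.2]
  · exact sub_eq_zero.1 (eq_zero_of_l2Norm_eq_zero hh e0 j hlt)

end Nonlinear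
end GPE

namespace GPE

/-! ### Convergence of the scheme from consistency -/

/-- The recursion is implicit: E (k + 1) also stands on the right, and τL ≤ 1/2 allows it to be
absorbed. -/
theorem discrete_gronwall {E : ℕ → ℝ} {L τ T ρ : ℝ} (hτ : 0 < τ) (hL : 0 ≤ L) (hρ : 0 ≤ ρ)
    (hτL : τ * L ≤ 1 / 2) (hE : E 0 = 0) {n : ℕ} (hn : n * τ ≤ T)
    (hstep : ∀ k < n, E (k + 1) ≤ E k + τ * (L * (E (k + 1) + E k) + ρ)) :
    E n ≤ 2 * T * Real.exp (4 * L * T) * ρ := by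
  have hx : 0 ≤ τ * L := by positivity
  have key : ∀ k ≤ n, E k ≤ 2 * (k * τ) * ρ * (1 + 4 * (τ * L)) ^ k := by
    intro k
    induction k with
    | zero => intro _; simp [hE]
    | succ k ih =>
      intro hk
      have h1 := ih (by omega)
      have h2 := hstep k (by omega)
      have hq : 1 ≤ (1 + 4 * (τ * L)) ^ (k + 1) := one_le_pow₀ (by linarith)
      set A := 2 * (k * τ) * ρ * (1 + 4 * (τ * L)) ^ k with hA
      have hA0 : 0 ≤ A := by positivity
      have h3 : (1 - τ * L) * E (k + 1) ≤ (1 + τ * L) * A + τ * ρ := by nlinarith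
      -- For 0 ≤ x ≤ 1/2 one has 1 + x ≤ (1 - x)(1 + 4x) and 1 ≤ 2(1 - x).
      have h4 : (1 + τ * L) * A + τ * ρ
          ≤ (1 - τ * L) * ((1 + 4 * (τ * L)) * A + 2 * (τ * ρ)) := by
        have : 0 ≤ τ * ρ := by positivity
        nlinarith [mul_nonneg (mul_nonneg hx (by linarith : 0 ≤ 1 / 2 - τ * L)) hA0,
          mul_nonneg this (by linarith : 0 ≤ 1 / 2 - τ * L)]
      have h5 : E (k + 1) ≤ (1 + 4 * (τ * L)) * A + 2 * (τ * ρ) :=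
        le_of_mul_le_mul_left (h3.trans h4) (by linarith)
      have h6 : (1 + 4 * (τ * L)) * A = 2 * (k * τ) * ρ * (1 + 4 * (τ * L)) ^ (k + 1) := by
        rw [hA]; ring
      have h7 : 2 * (τ * ρ) ≤ 2 * (τ * ρ) * (1 + 4 * (τ * L)) ^ (k + 1) :=
        le_mul_of_one_le_right (by positivity) hq
      rw [h6] at h5
      push_cast
      linarith
  have hT : 0 ≤ T := le_trans (by positivity) hn
  calc E n ≤ 2 * (n * τ) * ρ * (1 + 4 * (τ * L)) ^ n := key n le_rfl
    _ ≤ 2 * T * ρ * Real.exp (4 * L * T) := by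
        have h1 : (1 + 4 * (τ * L)) ^ n ≤ Real.exp (4 * L * T) := by
          calc (1 + 4 * (τ * L)) ^ n ≤ Real.exp (4 * (τ * L)) ^ n :=
                pow_le_pow_left₀ (by linarith) (by linarith [Real.add_one_le_exp (4 * (τ * L))]) n
            _ = Real.exp (4 * L * (n * τ)) := by rw [← Real.exp_nat_mul]; ring_nf
            _ ≤ _ := Real.exp_le_exp.2 (by gcongr)
        gcongr
    _ = _ := by ring

/-- Here P is the exact solution on the grid and r its residual; τ₁ and C are chosen before the
grid. The bound ρ with Cρ ≤ 1 only serves the bootstrap, while the error estimates accept any δ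
dominating the residuals. The same u therefore yields both the h^{3/2} rate and the optimal one. -/
theorem cnfd_convergence {ℓ Vm Λ T K : ℝ} (β : ℝ) (hℓ : 0 < ℓ) (hVm : 0 ≤ Vm) (hΛ : 0 ≤ Λ)
    (hT : 0 < T) (hK : 0 ≤ K) :
    ∃ τ₁ > (0 : ℝ), ∃ C > (0 : ℝ), ∀ (M : ℕ) (h τ : ℝ) (V : ℕ → ℝ) (P r : ℕ → ℕ → ℂ) (ρ : ℝ),
      1 ≤ M → 0 < h → h * M = ℓ → 0 < τ → τ ≤ τ₁ →
      (∀ j ≤ M, |V j| ≤ Vm) → (∀ j < M, |V (j + 1) - V j| ≤ Λ * h) →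
      0 ≤ ρ → C * ρ ≤ 1 →
      (∀ n : ℕ, n * τ ≤ T → ZeroBdry M (P n) ∧ h1Norm h M (P n) ≤ K) →
      (∀ n : ℕ, (n + 1 : ℕ) * τ ≤ T → ZeroBdry M (r n) ∧
        LinStep h τ M (P n) (P (n + 1)) (cnTerm V β (P (n + 1)) (P n) + r n) ∧
        h1Norm h M (r n) ≤ ρ) →
      ∃ u : ℕ → ℕ → ℂ, u 0 = P 0 ∧
        (∀ n : ℕ, (n + 1 : ℕ) * τ ≤ T → ZeroBdry M (u (n + 1)) ∧
          LinStep h τ M (u n) (u (n + 1)) (cnTerm V β (u (n + 1)) (u n))) ∧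
        (∀ n : ℕ, n * τ ≤ T → h1Norm h M (P n - u n) ≤ 1) ∧
        (∀ n : ℕ, n * τ ≤ T → ∀ δ : ℝ, 0 ≤ δ →
          ((∀ k < n, l2Norm h M (r k) ≤ δ) → l2Norm h M (P n - u n) ≤ C * δ) ∧
          ((∀ k < n, h1Norm h M (r k) ≤ δ) → h1Norm h M (P n - u n) ≤ C * δ)) ∧
        (∀ w : ℕ → ℕ → ℂ, (∀ j ≤ M, w 0 j = P 0 j) →
          (∀ n : ℕ, (n + 1 : ℕ) * τ ≤ T → ZeroBdry M (w (n + 1)) ∧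
            LinStep h τ M (w n) (w (n + 1)) (cnTerm V β (w (n + 1)) (w n))) →
          ∀ n : ℕ, n * τ ≤ T → ∀ j ≤ M, w n j = u n j) := by
  set B := K + 1 with hB
  -- B bounds the numerical solution: K for P plus 1 for the error. R leaves room for the
  -- contraction and also contains every competing solution of a step.
  set R := max (B + 1) (stepBound ℓ β Vm B) with hR
  set cV := Vm + Λ * ℓ with hcV
  set L := lipConst ℓ β cV R with hLdef
  have hBR : B + 1 ≤ R := le_max_left _ _
  have hR0 : 0 ≤ R := by linarith
  have hcV0 : 0 ≤ cV := by positivity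
  have hL : 0 ≤ L := by rw [hLdef, lipConst]; positivity
  have hD : 0 < 2 * (L * (1 + R + B) + 1) := by
    have : 0 ≤ 1 + R + B := by linarith
    positivity
  -- This τ₁ ensures both τL ≤ 1/2 (contraction, Gronwall, uniqueness) and τL(R + B) ≤ 1 (invariance
  -- of the ball). C is the Gronwall constant.
  refine ⟨1 / (2 * (L * (1 + R + B) + 1)), by positivity, 2 * T * Real.exp (4 * L * T),
    by positivity, ?_⟩
  intro M h τ V P r ρ hM hh hhM hτ hτ1 hV1 hV2 hρ hCρ hP hr
  rw [le_div_iff₀ hD] at hτ1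
  have hτL : τ * L ≤ 1 / 2 := by
    have : 0 ≤ τ * (L * (R + B)) := mul_nonneg hτ.le (mul_nonneg hL (by linarith))
    nlinarith
  have hτL2 : τ * (L * (R + B)) ≤ 1 := by
    have : 0 ≤ τ * L := by positivity
    nlinarith
  have hVl : ∀ v, ZeroBdry M v → l2Norm h M ((fun j => (V j : ℂ)) * v) ≤ cV * l2Norm h M v :=
    fun v _ => by rw [hcV, ← hhM]; exact l2Norm_potential_mul_le hh hV1 hΛ v
  have hVh : ∀ v, ZeroBdry M v → h1Norm h M ((fun j => (V j : ℂ)) * v) ≤ cV * h1Norm h M v :=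
    fun v hv => by rw [hcV, ← hhM]; exact h1Norm_potential_mul_le hh hV1 hΛ hV2 hv
  have hstep : ∀ p, ZeroBdry M p → h1Norm h M p ≤ B →
      ∃ w, ZeroBdry M w ∧ h1Norm h M w ≤ R ∧ LinStep h τ M p w (cnTerm V β w p) :=
    fun p hp hpB => exists_step hh hτ hM hcV0 hVl hVh hBR (by rwa [hhM]) (by rwa [hhM]) hp hpB
  -- S is a total function, so u is defined by plain recursion; that its iterates stay in the region
  -- where S solves the step is proved afterwards in `hbd`.
  choose! S hS0 hSR hS using hstep
  let u : ℕ → ℕ → ℂ := fun n => Nat.rec (P 0) (fun _ p => S p) n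
  have hu0 : u 0 = P 0 := rfl
  have husucc : ∀ n, u (n + 1) = S (u n) := fun _ => rfl
  have hKB : K ≤ B := by linarith
  have P0 := hP 0 (by simpa using hT.le)
  have herr : ∀ {N : (ℕ → ℂ) → ℝ}, GridNorm h M N →
      (∀ v, ZeroBdry M v → N ((fun j => (V j : ℂ)) * v) ≤ cV * N v) →
      ∀ n : ℕ, n * τ ≤ T → (∀ k < n, ZeroBdry M (u k) ∧ h1Norm h M (u k) ≤ B) →
      ∀ δ, 0 ≤ δ → (∀ k < n, N (r k) ≤ δ) →
        N (P n - u n) ≤ 2 * T * Real.exp (4 * L * T) * δ := by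
    intro N hN hNV n hn hu δ hδ hrδ
    have hz : N 0 = 0 := by simpa using hN.smul 0 0
    refine discrete_gronwall (E := fun n => N (P n - u n)) hτ hL hδ hτL
      (by simp [hu0, hz]) hn fun k hk => ?_
    have hkT : ((k + 1 : ℕ) : ℝ) * τ ≤ T := by
      refine le_trans ?_ hn
      gcongr; exact hk
    have hkT' : (k : ℝ) * τ ≤ T := le_trans (by gcongr; exact k.le_succ) hkT
    obtain ⟨r0, rs, -⟩ := hr k hkT
    have hP1 := hP (k + 1) hkT
    have hPk := hP k hkT'
    obtain ⟨uz, uB⟩ := hu k hk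
    have e := error_step hN hh hτ hcV0 hNV hP1.1 hPk.1 (hS0 _ uz uB) uz r0
      (by linarith [hP1.2]) (by linarith [hPk.2]) (hSR _ uz uB) (by linarith) rs (hS _ uz uB)
    rw [hhM, ← husucc] at e
    refine e.trans ?_
    have := hrδ k hk
    gcongr
  -- Bootstrap: while the earlier iterates are bounded by B, Gronwall bounds the H¹ error at n by Cρ
  -- ≤ 1, so u n is bounded by K + 1 = B again.
  have hbd : ∀ n : ℕ, n * τ ≤ T →
      ZeroBdry M (u n) ∧ h1Norm h M (P n - u n) ≤ 1 ∧ h1Norm h M (u n) ≤ B := by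
    intro n
    induction n using Nat.strong_induction_on with
    | _ n ih =>
      intro hn
      have hlt : ∀ k < n, ((k + 1 : ℕ) : ℝ) * τ ≤ T := fun k hk =>
        le_trans (by gcongr; exact hk) hn
      have hlt' : ∀ k < n, (k : ℝ) * τ ≤ T := fun k hk =>
        le_trans (by gcongr) hn
      have hu : ∀ k < n, ZeroBdry M (u k) ∧ h1Norm h M (u k) ≤ B := fun k hk =>
        ⟨(ih k hk (hlt' k hk)).1, (ih k hk (hlt' k hk)).2.2⟩
      have h1 : h1Norm h M (P n - u n) ≤ 1 :=
        (herr (gridNorm_h1Norm hh) hVh n hn hu ρ hρ fun k hk => (hr k (hlt k hk)).2.2).trans hCρ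
      refine ⟨?_, h1, ?_⟩
      · cases n with
        | zero => exact P0.1
        | succ k => exact hS0 _ (hu k k.lt_succ_self).1 (hu k k.lt_succ_self).2
      · have e : u n = P n + (-1 : ℂ) • (P n - u n) := by
          funext j; simp
        have e2 := h1Norm_add_le (M := M) hh.le (P n) ((-1 : ℂ) • (P n - u n))
        rw [← e, h1Norm_smul, norm_neg, norm_one, one_mul] at e2
        linarith [(hP n hn).2]
  have hpred : ∀ n : ℕ, ((n + 1 : ℕ) : ℝ) * τ ≤ T → (n : ℝ) * τ ≤ T := fun n hn =>
    le_trans (by gcongr; exact n.le_succ) hn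
  have hus : ∀ n : ℕ, (n + 1 : ℕ) * τ ≤ T → LinStep h τ M (u n) (u (n + 1))
      (cnTerm V β (u (n + 1)) (u n)) := fun n hn =>
    hS _ (hbd n (hpred n hn)).1 (hbd n (hpred n hn)).2.2
  have hmono : ∀ n : ℕ, (n : ℝ) * τ ≤ T → ∀ k < n, (k : ℝ) * τ ≤ T := fun n hn k hk =>
    le_trans (by gcongr) hn
  refine ⟨u, hu0, fun n hn => ⟨(hbd _ hn).1, hus n hn⟩, fun n hn => (hbd n hn).2.1,
    fun n hn δ hδ => ⟨?_, ?_⟩, ?_⟩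
  · exact herr (gridNorm_l2Norm hh) hVl n hn
      (fun k hk => ⟨(hbd k (hmono n hn k hk)).1, (hbd k (hmono n hn k hk)).2.2⟩) δ hδ
  · exact herr (gridNorm_h1Norm hh) hVh n hn
      (fun k hk => ⟨(hbd k (hmono n hn k hk)).1, (hbd k (hmono n hn k hk)).2.2⟩) δ hδ
  · intro w hw0 hw n
    induction n with
    | zero => intro _ j hj; rw [hw0 j hj, hu0]
    | succ n ih =>
      intro hn j hj
      obtain ⟨wz, ws⟩ := hw n hn
      have ws' := LinStep.congr (w₀ := u n) (w₁ := w (n + 1)) (ih (hpred n hn))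
        (fun _ _ => rfl) ws
      obtain ⟨uz, -, uB⟩ := hbd n (hpred n hn)
      -- The conservation laws bring an arbitrary solution into the ball in which a step is unique.
      have wR : h1Norm h M (w (n + 1)) ≤ R := by
        refine (h1Norm_step_le hh hτ hV1 wz uz uB ws').trans ?_
        rw [hhM]; exact le_max_right _ _
      exact step_unique hh hτ hcV0 hVl (by rwa [hhM]) wz (hbd _ hn).1 uz wR
        (by linarith [(hbd _ hn).2.2]) (by linarith) ws' (hus n hn) j hj

end GPE

namespace GPE

/-! ### Continuous representatives of Sobolev functions on an interval -/

theorem exists_Icc_of_isCompact {a b : ℝ} (hab : a < b) {K : Set ℝ} (hK : IsCompact K)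
    (hKab : K ⊆ Ioo a b) : ∃ α β, a < α ∧ β < b ∧ K ⊆ Icc α β := by
  have hK' : IsCompact (insert ((a + b) / 2) K) := hK.insert _
  have hne : (insert ((a + b) / 2) K).Nonempty := insert_nonempty _ _
  have hsub : insert ((a + b) / 2) K ⊆ Ioo a b :=
    insert_subset ⟨by linarith, by linarith⟩ hKab
  refine ⟨sInf (insert ((a + b) / 2) K), sSup (insert ((a + b) / 2) K),
    (hsub (hK'.sInf_mem hne)).1, (hsub (hK'.sSup_mem hne)).2, fun x hx => ⟨?_, ?_⟩⟩
  · exact (hK'.isLeast_sInf hne).2 (mem_insert_of_mem _ hx)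
  · exact (hK'.isGreatest_sSup hne).2 (mem_insert_of_mem _ hx)

/-- A smooth compactly supported function of zero mean has a compactly supported primitive. -/
theorem exists_test_primitive {a b : ℝ} (hab : a < b) {ζ : ℝ → ℝ} (hζ : ContDiff ℝ ∞ ζ)
    (hc : HasCompactSupport ζ) (hs : tsupport ζ ⊆ Ioo a b) (h0 : ∫ x, ζ x = 0) :
    ∃ Φ : ℝ → ℂ, IsTestFunction a b Φ ∧ ∀ x, deriv Φ x = ζ x := by
  obtain ⟨α, β, hα, hβ, hαβ⟩ := exists_Icc_of_isCompact hab hc hs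
  have hz : ∀ x, x ∉ Icc α β → ζ x = 0 := fun x hx =>
    image_eq_zero_of_notMem_tsupport fun h => hx (hαβ h)
  set Ψ : ℝ → ℝ := fun x => ∫ y in a..x, ζ y with hΨ
  have hd : ∀ x, HasDerivAt Ψ (ζ x) x := fun x =>
    intervalIntegral.integral_hasDerivAt_right (hζ.continuous.intervalIntegrable _ _)
      hζ.continuous.stronglyMeasurable.stronglyMeasurableAtFilter hζ.continuous.continuousAt
  have hΨs : ContDiff ℝ ∞ Ψ := by
    rw [contDiff_infty_iff_deriv]
    refine ⟨fun x => (hd x).differentiableAt, ?_⟩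
    rwa [show deriv Ψ = ζ from funext fun x => (hd x).deriv]
  have hΨ0 : ∀ x, x ∉ Icc α β → Ψ x = 0 := by
    intro x hx
    rcases lt_or_ge x α with h | h
    · refine intervalIntegral.integral_zero_ae (Filter.Eventually.of_forall fun y hy => hz y ?_)
      intro hy'
      have : y ≤ max a x := hy.2
      exact absurd (this.trans_lt (max_lt hα h)) (not_lt.2 hy'.1)
    · have hxβ : β < x := by
        by_contra! hle; exact hx ⟨h, hle⟩
      simp only [hΨ]
      rw [intervalIntegral.integral_eq_integral_of_support_subset, h0]
      intro y hy
      have hy' : y ∈ Icc α β := by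
        by_contra hn; exact hy (hz y hn)
      exact ⟨hα.trans_le hy'.1, hy'.2.trans hxβ.le⟩
  have hts : tsupport (fun x => (Ψ x : ℂ)) ⊆ Icc α β :=
    closure_minimal (fun x hx => by
      by_contra hn
      exact hx (by simp [hΨ0 x hn])) isClosed_Icc
  refine ⟨fun x => (Ψ x : ℂ), ⟨?_, ?_, ?_⟩, fun x => (hd x).ofReal_comp.deriv⟩
  · exact Complex.ofRealCLM.contDiff.comp hΨs
  · exact isCompact_Icc.of_isClosed_subset (isClosed_tsupport _) hts
  · exact hts.trans fun x hx => ⟨hα.trans_le hx.1, hx.2.trans_lt hβ⟩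

/-- The du Bois-Reymond lemma. -/
theorem ae_eq_const_of_weakDeriv_zero {a b : ℝ} (hab : a < b) {f : ℝ → ℂ}
    (hf : Integrable f (intervalMeasure a b))
    (H : ∀ φ : ℝ → ℂ, IsTestFunction a b φ → ∫ x in Ioo a b, f x * deriv φ x = 0) :
    ∃ c : ℂ, ∀ᵐ x ∂intervalMeasure a b, f x = c := by
  let B : ContDiffBump ((a + b) / 2) :=
    ⟨(b - a) / 8, (b - a) / 4, by linarith, by linarith⟩
  let η : ℝ → ℝ := B.normed volume
  have hη : ContDiff ℝ ∞ η := B.contDiff_normed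
  have hηc : HasCompactSupport η := B.hasCompactSupport_normed
  have hηs : tsupport η ⊆ Ioo a b := by
    have : tsupport η = Metric.closedBall ((a + b) / 2) ((b - a) / 4) := B.tsupport_normed_eq
    rw [this, Real.closedBall_eq_Icc]
    exact fun x hx => ⟨by linarith [hx.1], by linarith [hx.2]⟩
  have hη1 : ∫ x, η x = 1 := B.integral_normed
  have hint : ∀ ζ : ℝ → ℝ, Continuous ζ → HasCompactSupport ζ →
      Integrable (fun x => f x * (ζ x : ℂ)) (intervalMeasure a b) := by
    intro ζ h1 h2
    obtain ⟨C, hC⟩ := h2.exists_bound_of_continuous h1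
    refine hf.mul_bdd (c := C) (Complex.continuous_ofReal.comp h1).aestronglyMeasurable
      (Filter.Eventually.of_forall fun x => ?_)
    rw [Complex.norm_real]; exact hC x
  set c : ℂ := ∫ x in Ioo a b, f x * (η x : ℂ) with hc
  refine ⟨c, ?_⟩
  have hfc : Integrable (fun x => f x - c) (intervalMeasure a b) :=
    hf.sub (integrable_const c)
  have key := isOpen_Ioo.ae_eq_zero_of_integral_contDiff_smul_eq_zero
    (U := Ioo a b) (μ := volume) (f := fun x => f x - c) ?_ ?_
  · rw [ae_restrict_iff' measurableSet_Ioo]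
    filter_upwards [key] with x hx hxm
    exact sub_eq_zero.1 (hx hxm)
  · exact IntegrableOn.locallyIntegrableOn hfc
  · intro ζ hζ hζc hζs
    have hζi : Integrable ζ := hζ.continuous.integrable_of_hasCompactSupport hζc
    have hηi : Integrable η := hη.continuous.integrable_of_hasCompactSupport hηc
    -- ζ - mη has zero mean, hence is the derivative of a test function; testing with it gives ∫ fζ
    -- = m ∫ fη = c ∫ ζ.
    set m := ∫ x, ζ x with hm
    obtain ⟨Φ, hΦ, hΦd⟩ := exists_test_primitive hab (ζ := fun x => ζ x - m * η x)
      (hζ.sub (contDiff_const.mul hη)) (hζc.sub (hηc.mul_left))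
      ((tsupport_sub _ _).trans (union_subset hζs
        ((tsupport_mul_subset_right (f := fun _ => m)).trans hηs)))
      (by rw [integral_sub hζi (hηi.const_mul m), integral_const_mul, hη1, mul_one, sub_self])
    have h1 := H Φ hΦ
    have h2 : ∫ x in Ioo a b, f x * deriv Φ x
        = (∫ x in Ioo a b, f x * (ζ x : ℂ)) - m * c := by
      rw [hc, ← integral_const_mul, ← integral_sub (hint ζ hζ.continuous hζc)
        ((hint η hη.continuous hηc).const_mul _)]
      refine integral_congr_ae (Filter.Eventually.of_forall fun x => ?_)
      simp only [hΦd]; push_cast; ring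
    have hsupp : ∀ x, x ∉ Ioo a b → ζ x = 0 := fun x hx =>
      image_eq_zero_of_notMem_tsupport fun h => hx (hζs h)
    have h3 : ∫ x in Ioo a b, (ζ x : ℂ) = m := by
      rw [setIntegral_eq_integral_of_forall_compl_eq_zero (fun x hx => by simp [hsupp x hx])]
      exact integral_ofReal
    rw [← setIntegral_eq_integral_of_forall_compl_eq_zero (s := Ioo a b)
      (fun x hx => by simp [hsupp x hx])]
    have hζi' : Integrable (fun x => (ζ x : ℂ)) (intervalMeasure a b) :=
      hζi.integrableOn.ofReal
    have h4 : ∫ x in Ioo a b, ζ x • (f x - c)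
        = (∫ x in Ioo a b, f x * (ζ x : ℂ)) - c * ∫ x in Ioo a b, (ζ x : ℂ) := by
      rw [← integral_const_mul, ← integral_sub (hint ζ hζ.continuous hζc)
        (hζi'.const_mul _)]
      refine integral_congr_ae (Filter.Eventually.of_forall fun x => ?_)
      simp only [Complex.real_smul]; ring
    rw [h4, h3, mul_comm c, ← h2, h1]

/-- Integration by parts against the primitive of an integrable function. -/
theorem integral_primitive_mul {a b : ℝ} {g : ℝ → ℂ}
    (hg : Integrable g (intervalMeasure a b)) {φ : ℝ → ℂ} (hφ : ContDiff ℝ 1 φ) :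
    ∫ x in Ioo a b, (∫ y in Ioo a x, g y) * deriv φ x =
      (∫ y in Ioo a b, g y) * φ b - ∫ y in Ioo a b, g y * φ y := by
  have hφ' : Continuous (deriv φ) := hφ.continuous_deriv le_rfl
  have hi' : Integrable (deriv φ) (intervalMeasure a b) :=
    (hφ'.integrableOn_Icc (a := a) (b := b)).mono_set Ioo_subset_Icc_self
  -- Fubini on the triangle y < x.
  set F : ℝ → ℝ → ℂ := fun x y => if y < x then deriv φ x * g y else 0 with hF
  have hFi : Integrable (Function.uncurry F)
      ((intervalMeasure a b).prod (intervalMeasure a b)) := by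
    have h1 := (hi'.mul_prod hg).indicator
      (measurableSet_lt measurable_snd measurable_fst : MeasurableSet {z : ℝ × ℝ | z.2 < z.1})
    refine h1.congr (Filter.Eventually.of_forall fun z => ?_)
    simp [hF, Function.uncurry, indicator]
  have hsw := integral_integral_swap hFi
  have e1 : ∀ x ∈ Ioo a b, ∫ y in Ioo a b, F x y = (∫ y in Ioo a x, g y) * deriv φ x := by
    intro x hx
    have : ∀ y, F x y = (Iio x).indicator (fun y => deriv φ x * g y) y := fun y => by
      simp [hF, indicator]
    simp only [this]
    rw [integral_indicator measurableSet_Iio, Measure.restrict_restrict measurableSet_Iio,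
      integral_const_mul, mul_comm]
    congr 3
    ext y; simp only [mem_inter_iff, mem_Iio, mem_Ioo]
    exact ⟨fun h => ⟨h.2.1, h.1⟩, fun h => ⟨h.2, h.1, h.2.trans hx.2⟩⟩
  have e2 : ∀ y ∈ Ioo a b, ∫ x in Ioo a b, F x y = g y * φ b - g y * φ y := by
    intro y hy
    have : ∀ x, F x y = (Ioi y).indicator (fun x => deriv φ x * g y) x := fun x => by
      simp [hF, indicator]
    simp only [this]
    rw [integral_indicator measurableSet_Ioi, Measure.restrict_restrict measurableSet_Ioi,
      integral_mul_const]
    have hset : Ioi y ∩ Ioo a b = Ioo y b := by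
      ext x; simp only [mem_inter_iff, mem_Ioi, mem_Ioo]
      exact ⟨fun h => ⟨h.1, h.2.2⟩, fun h => ⟨h.1, hy.1.trans h.1, h.2⟩⟩
    rw [hset, ← integral_Ioc_eq_integral_Ioo, ← intervalIntegral.integral_of_le hy.2.le,
      intervalIntegral.integral_deriv_eq_sub (fun x _ => (hφ.differentiable one_ne_zero) x)
        (hφ'.intervalIntegrable _ _)]
    ring
  rw [setIntegral_congr_fun measurableSet_Ioo e1, setIntegral_congr_fun measurableSet_Ioo e2] at hsw
  rw [hsw]
  obtain ⟨C, hC⟩ := isCompact_Icc.exists_bound_of_continuousOn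
    (hφ.continuous.continuousOn (s := Icc a b))
  have hgφ : Integrable (fun y => g y * φ y) (intervalMeasure a b) := by
    refine hg.mul_bdd (c := C) hφ.continuous.aestronglyMeasurable ?_
    exact (ae_restrict_iff' measurableSet_Ioo).2
      (Filter.Eventually.of_forall fun x hx => hC x (Ioo_subset_Icc_self hx))
  rw [integral_sub (hg.mul_const _) hgφ, integral_mul_const]

end GPE

namespace GPE

/-! ### Point evaluation of the continuous representative as a continuous linear functional -/

section Rep

variable {a b : ℝ} {p : ℝ≥0∞} [hp : Fact (1 ≤ p)] {k : ℕ}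

/-- L^p embeds in L¹ on a bounded interval; this makes integration against a bounded weight
continuous on L^p. -/
theorem exists_integral_norm_le (a b : ℝ) (p : ℝ≥0∞) [hp : Fact (1 ≤ p)] :
    ∃ C : ℝ, 0 ≤ C ∧ ∀ f : Lp ℂ p (intervalMeasure a b), ∫ x in Ioo a b, ‖f x‖ ≤ C * ‖f‖ := by
  set c := intervalMeasure a b univ ^ (1 / (1 : ℝ≥0∞).toReal - 1 / p.toReal) with hc
  have hcT : c ≠ ⊤ := by
    refine ENNReal.rpow_ne_top_of_nonneg ?_ (measure_ne_top _ _)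
    rw [ENNReal.toReal_one, div_one, sub_nonneg, one_div]
    rcases eq_or_ne p ⊤ with rfl | hpT
    · simp
    · exact inv_le_one_of_one_le₀ (by
        rw [← ENNReal.toReal_one]; exact ENNReal.toReal_mono hpT hp.out)
  refine ⟨c.toReal, ENNReal.toReal_nonneg, fun f => ?_⟩
  have h1 := eLpNorm_le_eLpNorm_mul_rpow_measure_univ hp.out (Lp.aestronglyMeasurable f)
  rw [integral_norm_eq_lintegral_enorm (Lp.aestronglyMeasurable f), Lp.norm_def,
    ← eLpNorm_one_eq_lintegral_enorm, ← ENNReal.toReal_mul, mul_comm c]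
  exact ENNReal.toReal_mono (ENNReal.mul_ne_top (Lp.eLpNorm_ne_top f) hcT) h1

theorem integrable_coe (f : Lp ℂ p (intervalMeasure a b)) :
    Integrable f (intervalMeasure a b) := (Lp.memLp f).integrable hp.out

theorem integrable_mul_weight (f : Lp ℂ p (intervalMeasure a b)) {wt : ℝ → ℂ}
    (hwt : Measurable wt) {W : ℝ} (hW : ∀ x ∈ Ioo a b, ‖wt x‖ ≤ W) :
    Integrable (fun x => f x * wt x) (intervalMeasure a b) :=
  (integrable_coe f).mul_bdd (c := W) hwt.aestronglyMeasurable
    ((ae_restrict_iff' measurableSet_Ioo).2 (Filter.Eventually.of_forall hW))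

/-- Integration against a bounded measurable weight, as a continuous linear functional. -/
noncomputable def weightCLM (p : ℝ≥0∞) [hp : Fact (1 ≤ p)] {wt : ℝ → ℂ}
    (hwt : Measurable wt) {W : ℝ} (hW : ∀ x ∈ Ioo a b, ‖wt x‖ ≤ W) :
    Lp ℂ p (intervalMeasure a b) →L[ℝ] ℂ :=
  LinearMap.mkContinuousOfExistsBound
    { toFun := fun f => ∫ x in Ioo a b, f x * wt x
      map_add' := fun f g => by
        rw [← integral_add (integrable_mul_weight f hwt hW) (integrable_mul_weight g hwt hW)]
        refine integral_congr_ae ?_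
        filter_upwards [Lp.coeFn_add f g] with x hx
        rw [hx, Pi.add_apply, add_mul]
      map_smul' := fun c f => by
        rw [RingHom.id_apply, ← integral_smul]
        refine integral_congr_ae ?_
        filter_upwards [Lp.coeFn_smul c f] with x hx
        rw [hx, Pi.smul_apply, smul_mul_assoc] }
    (by
      obtain ⟨C, hC, H⟩ := exists_integral_norm_le a b p
      refine ⟨|W| * C, fun f => ?_⟩
      change ‖∫ x in Ioo a b, f x * wt x‖ ≤ _
      calc ‖∫ x in Ioo a b, f x * wt x‖ ≤ ∫ x in Ioo a b, ‖f x * wt x‖ :=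
            norm_integral_le_integral_norm _
        _ ≤ ∫ x in Ioo a b, ‖f x‖ * |W| := by
            refine setIntegral_mono_on (integrable_mul_weight f hwt hW).norm
              ((integrable_coe f).norm.mul_const _) measurableSet_Ioo fun x hx => ?_
            rw [norm_mul]
            exact mul_le_mul_of_nonneg_left ((hW x hx).trans (le_abs_self _)) (norm_nonneg _)
        _ = |W| * ∫ x in Ioo a b, ‖f x‖ := by rw [integral_mul_const, mul_comm]
        _ ≤ |W| * (C * ‖f‖) := mul_le_mul_of_nonneg_left (H f) (abs_nonneg _)
        _ = _ := by ring)

theorem weightCLM_apply {wt : ℝ → ℂ} (hwt : Measurable wt) {W : ℝ}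
    (hW : ∀ x ∈ Ioo a b, ‖wt x‖ ≤ W) (f : Lp ℂ p (intervalMeasure a b)) :
    weightCLM p hwt hW f = ∫ x in Ioo a b, f x * wt x := rfl

/-- The continuous representative of a function with integrable weak derivative. -/
noncomputable def contRep (a b : ℝ) (f g : ℝ → ℂ) (x : ℝ) : ℂ :=
  ((1 / (b - a) : ℝ) : ℂ) * ((∫ y in Ioo a b, f y) - ∫ y in Ioo a b, g y * ((b - y : ℝ) : ℂ))
    + ∫ y in Ioo a x, g y

/-- f minus the primitive of g has zero weak derivative, hence is constant by du Bois-Reymond. -/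
theorem contRep_ae_eq (hab : a < b) {f g : ℝ → ℂ} (hf : Integrable f (intervalMeasure a b))
    (hg : Integrable g (intervalMeasure a b)) (hw : IsWeakDeriv a b f g) :
    f =ᵐ[intervalMeasure a b] contRep a b f g := by
  set G : ℝ → ℂ := fun x => ∫ y in Ioo a x, g y with hG
  have hGc : ContinuousOn G (Icc a b) := by
    have : ContinuousOn (fun x => ∫ y in a..x, g y) (Icc a b) := by
      rw [← uIcc_of_le hab.le]
      refine intervalIntegral.continuousOn_primitive_interval (μ := volume) ?_
      rw [uIcc_of_le hab.le, integrableOn_Icc_iff_integrableOn_Ioo (μ := volume)]; exact hg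
    refine this.congr fun x hx => ?_
    simp only [hG]
    rw [intervalIntegral.integral_of_le hx.1, integral_Ioc_eq_integral_Ioo]
  have hGi : Integrable G (intervalMeasure a b) :=
    (hGc.integrableOn_Icc).mono_set Ioo_subset_Icc_self
  obtain ⟨c, hc⟩ := ae_eq_const_of_weakDeriv_zero hab (hf.sub hGi) fun φ hφ => by
    have hφ0 : φ b = 0 := image_eq_zero_of_notMem_tsupport fun h =>
      lt_irrefl b (hφ.support_subset h).2
    have hφ1 : ContDiff ℝ 1 φ := hφ.smooth.of_le (by exact_mod_cast le_top)
    have h1 := integral_primitive_mul hg hφ1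
    have h2 := hw φ hφ
    rw [hφ0, mul_zero, zero_sub] at h1
    have hφ' : Continuous (deriv φ) := hφ1.continuous_deriv le_rfl
    obtain ⟨C, hC⟩ := hφ.compact.deriv.exists_bound_of_continuous hφ'
    have hb : ∀ u : ℝ → ℂ, Integrable u (intervalMeasure a b) →
        Integrable (fun x => u x * deriv φ x) (intervalMeasure a b) := fun u hu =>
      hu.mul_bdd (c := C) hφ'.aestronglyMeasurable (Filter.Eventually.of_forall hC)
    have : ∀ x, (f - G) x * deriv φ x = f x * deriv φ x - G x * deriv φ x := fun x => by
      rw [Pi.sub_apply, sub_mul]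
    simp only [this]
    rw [integral_sub (hb f hf) (hb G hGi), h1, h2, sub_self]
  have hL : (b - a) ≠ 0 := sub_ne_zero.2 hab.ne'
  -- The constant is the mean of f - G, and integration by parts against y - b turns ∫ G into ∫
  -- g(y)(b - y). Only integrals against bounded weights remain, which is what makes `evalRep`
  -- continuous.
  have hce : c = ((1 / (b - a) : ℝ) : ℂ) *
      ((∫ y in Ioo a b, f y) - ∫ y in Ioo a b, g y * ((b - y : ℝ) : ℂ)) := by
    have h1 := integral_primitive_mul hg (φ := fun y => ((y - b : ℝ) : ℂ))
      (Complex.ofRealCLM.contDiff.comp (contDiff_id.sub contDiff_const))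
    have hd : ∀ x, deriv (fun y : ℝ => ((y - b : ℝ) : ℂ)) x = 1 := fun x => by
      have := ((hasDerivAt_id x).sub_const b).ofReal_comp
      simpa using this.deriv
    simp only [hd, mul_one, sub_self, Complex.ofReal_zero, mul_zero, zero_sub] at h1
    have h2 : ∫ y in Ioo a b, (f - G) y = ∫ _y in Ioo a b, c := integral_congr_ae hc
    have h3 : ∫ y in Ioo a b, (f - G) y = (∫ y in Ioo a b, f y) - ∫ y in Ioo a b, G y :=
      integral_sub hf hGi
    have h4 : ∫ y in Ioo a b, g y * ((b - y : ℝ) : ℂ)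
        = -∫ y in Ioo a b, g y * ((y - b : ℝ) : ℂ) := by
      rw [← integral_neg]
      refine integral_congr_ae (Filter.Eventually.of_forall fun y => ?_)
      push_cast; ring
    rw [h4, ← h1, ← h3, h2, setIntegral_const, Measure.real, Real.volume_Ioo,
      ENNReal.toReal_ofReal (sub_nonneg.2 hab.le), Complex.real_smul, ← mul_assoc,
      ← Complex.ofReal_mul, one_div, inv_mul_cancel₀ hL, Complex.ofReal_one, one_mul]
  filter_upwards [hc] with x hx
  rw [Pi.sub_apply, sub_eq_iff_eq_add] at hx
  rw [hx, contRep, ← hce]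

/-- Evaluation at `x` of the continuous representative of the `i`-th derivative. -/
noncomputable def evalRep (a b : ℝ) (k : ℕ) (p : ℝ≥0∞) [hp : Fact (1 ≤ p)] (i : Fin k) (x : ℝ) :
    sobolevSpace a b k p →L[ℝ] ℂ :=
  (1 / (b - a) : ℝ) •
    ((weightCLM (a := a) (b := b) p (wt := fun _ => 1) (W := 1) measurable_const (by simp)).comp
        ((ContinuousLinearMap.proj i.castSucc).comp (sobolevSpace a b k p).subtypeL)
      - (weightCLM (a := a) (b := b) p (wt := fun y => ((b - y : ℝ) : ℂ)) (W := b - a)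
          (by fun_prop) (fun y hy => by
            rw [Complex.norm_real, Real.norm_of_nonneg (by linarith [hy.2])]
            linarith [hy.1])).comp
        ((ContinuousLinearMap.proj i.succ).comp (sobolevSpace a b k p).subtypeL))
  + (weightCLM (a := a) (b := b) p (wt := (Iio x).indicator fun _ => 1) (W := 1)
      (measurable_const.indicator measurableSet_Iio) (fun y _ => by
        by_cases h : y < x <;> simp [indicator, h])).comp
        ((ContinuousLinearMap.proj i.succ).comp (sobolevSpace a b k p).subtypeL)

theorem evalRep_apply (i : Fin k) {x : ℝ} (hx : x ≤ b) (u : sobolevSpace a b k p) :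
    evalRep a b k p i x u = contRep a b (u.1 i.castSucc) (u.1 i.succ) x := by
  have h1 : ∫ y in Ioo a b, u.1 i.succ y * (Iio x).indicator (fun _ => (1 : ℂ)) y
      = ∫ y in Ioo a x, u.1 i.succ y := by
    have : ∀ y, u.1 i.succ y * (Iio x).indicator (fun _ => (1 : ℂ)) y
        = (Iio x).indicator (fun y => u.1 i.succ y) y := fun y => by
      by_cases h : y < x <;> simp [indicator, h]
    simp only [this]
    rw [integral_indicator measurableSet_Iio, Measure.restrict_restrict measurableSet_Iio]
    congr 2
    ext y; simp only [mem_inter_iff, mem_Iio, mem_Ioo]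
    exact ⟨fun h => ⟨h.2.1, h.1⟩, fun h => ⟨h.2, h.1, h.2.trans_le hx⟩⟩
  rw [contRep, ← h1]
  simp [evalRep, weightCLM_apply]

theorem evalRep_ae_eq (hab : a < b) (i : Fin k) (u : sobolevSpace a b k p) :
    u.1 i.castSucc =ᵐ[intervalMeasure a b] fun x => evalRep a b k p i x u := by
  have h1 := contRep_ae_eq hab (integrable_coe (u.1 i.castSucc)) (integrable_coe (u.1 i.succ))
    (u.2 i)
  filter_upwards [h1, ae_restrict_mem measurableSet_Ioo] with x hx hxm
  rw [hx, evalRep_apply i hxm.2.le]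

theorem intervalIntegrable_coe (f : Lp ℂ p (intervalMeasure a b)) {x y : ℝ} (hx : x ∈ Icc a b)
    (hy : y ∈ Icc a b) : IntervalIntegrable f volume x y := by
  have h1 : IntegrableOn f (Icc a b) volume :=
    (integrableOn_Icc_iff_integrableOn_Ioo (μ := volume)).2 (integrable_coe f)
  exact (h1.mono_set (uIcc_subset_Icc hx hy)).intervalIntegrable

theorem evalRep_sub (i : Fin k) (u : sobolevSpace a b k p) {x y : ℝ}
    (hx : x ∈ Icc a b) (hy : y ∈ Icc a b) :
    evalRep a b k p i y u - evalRep a b k p i x u = ∫ t in x..y, u.1 i.succ t := by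
  have ha : a ∈ Icc a b := left_mem_Icc.2 (hx.1.trans hx.2)
  rw [evalRep_apply i hx.2, evalRep_apply i hy.2, contRep, contRep, add_sub_add_left_eq_sub,
    ← integral_Ioc_eq_integral_Ioo, ← integral_Ioc_eq_integral_Ioo,
    ← intervalIntegral.integral_of_le hx.1, ← intervalIntegral.integral_of_le hy.1,
    intervalIntegral.integral_interval_sub_left (intervalIntegrable_coe _ ha hy)
      (intervalIntegrable_coe _ ha hx)]

theorem continuousOn_evalRep (hab : a < b) (i : Fin k) (u : sobolevSpace a b k p) :
    ContinuousOn (fun x => evalRep a b k p i x u) (Icc a b) := by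
  have ha : a ∈ Icc a b := left_mem_Icc.2 hab.le
  have : ContinuousOn (fun x => ∫ y in a..x, u.1 i.succ y) (Icc a b) := by
    rw [← uIcc_of_le hab.le]
    refine intervalIntegral.continuousOn_primitive_interval (μ := volume) ?_
    rw [uIcc_of_le hab.le, integrableOn_Icc_iff_integrableOn_Ioo (μ := volume)]
    exact integrable_coe _
  refine (this.const_add (evalRep a b k p i a u)).congr fun x hx => ?_
  change _ = _ + ∫ y in a..x, u.1 i.succ y
  rw [← evalRep_sub i u ha hx]; ring

theorem eqOn_of_ae_eq_interval (hab : a < b) {f g : ℝ → ℂ} (h : f =ᵐ[intervalMeasure a b] g)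
    (hf : ContinuousOn f (Icc a b)) (hg : ContinuousOn g (Icc a b)) : EqOn f g (Icc a b) := by
  refine Measure.eqOn_Icc_of_ae_eq volume hab.ne ?_ hf hg
  rwa [← restrict_Ioo_eq_restrict_Icc]

theorem evalRep_eq (hab : a < b) (i : Fin k) (u : sobolevSpace a b k p) {r : ℝ → ℂ}
    (hr : ContinuousOn r (Icc a b)) (h : u.1 i.castSucc =ᵐ[intervalMeasure a b] r) {x : ℝ}
    (hx : x ∈ Icc a b) : evalRep a b k p i x u = r x :=
  eqOn_of_ae_eq_interval hab ((evalRep_ae_eq hab i u).symm.trans h)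
    (continuousOn_evalRep hab i u) hr hx

/-- The weak derivative itself has a continuous representative when one more derivative is
available, so the representative is a primitive of a continuous function and is classically
differentiable up to the ends. -/
theorem hasDerivWithinAt_evalRep (hab : a < b) {i j : Fin k} (hij : i.succ = j.castSucc)
    (u : sobolevSpace a b k p) {x : ℝ} (hx : x ∈ Icc a b) :
    HasDerivWithinAt (fun y => evalRep a b k p i y u) (evalRep a b k p j x u) (Icc a b) x := by
  have ha : a ∈ Icc a b := left_mem_Icc.2 hab.le
  set r : ℝ → ℂ := fun y => evalRep a b k p j y u with hr
  have hrc : ContinuousOn r (Icc a b) := continuousOn_evalRep hab j u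
  have hev : ∀ y ∈ Icc a b, evalRep a b k p i y u
      = evalRep a b k p i a u + ∫ t in a..y, r t := by
    intro y hy
    rw [← sub_eq_iff_eq_add', evalRep_sub i u ha hy, hij]
    refine intervalIntegral.integral_congr_ae ?_
    rw [uIoc_of_le hy.1]
    have := evalRep_ae_eq hab j u
    rw [Filter.EventuallyEq, ae_restrict_iff' measurableSet_Ioo] at this
    filter_upwards [this, Measure.ae_ne volume b] with t ht htb htm
    exact ht ⟨htm.1, lt_of_le_of_ne (htm.2.trans hy.2) htb⟩
  have : Fact (x ∈ Icc a b) := ⟨hx⟩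
  have hd : HasDerivWithinAt (fun y => ∫ t in a..y, r t) (r x) (Icc a b) x := by
    refine intervalIntegral.integral_hasDerivWithinAt_right ?_ (t := Icc a b) ?_ (hrc x hx)
    · exact (hrc.mono (uIcc_subset_Icc ha hx)).intervalIntegrable
    · exact hrc.stronglyMeasurableAtFilter_nhdsWithin measurableSet_Icc x
  exact (hd.const_add (evalRep a b k p i a u)).congr (fun y hy => hev y hy) (hev x hx)

end Rep

/-! ### Pointwise and Lipschitz bounds from W^{k,∞} norms -/

section Bounded

variable {a b : ℝ} {k : ℕ}

theorem norm_component_le (u : sobolevSpace a b k ∞) (i : Fin (k + 1)) :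
    ∀ᵐ x ∂intervalMeasure a b, ‖u.1 i x‖ ≤ ‖u‖ := by
  have h1 : ‖u.1 i‖ ≤ ‖u‖ := norm_le_pi_norm u.1 i
  have h2 := ae_le_eLpNormEssSup (f := u.1 i) (μ := intervalMeasure a b)
  have h3 : eLpNormEssSup (u.1 i) (intervalMeasure a b) ≠ ⊤ := by
    rw [← eLpNorm_exponent_top]; exact Lp.eLpNorm_ne_top _
  filter_upwards [h2] with x hx
  refine le_trans ?_ h1
  rw [Lp.norm_def, eLpNorm_exponent_top, ← toReal_enorm]
  exact ENNReal.toReal_mono h3 hx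

theorem norm_le_of_ae_le (hab : a < b) {f : ℝ → ℂ} (hf : ContinuousOn f (Icc a b)) {K : ℝ}
    (h : ∀ᵐ x ∂intervalMeasure a b, ‖f x‖ ≤ K) : ∀ x ∈ Icc a b, ‖f x‖ ≤ K := by
  -- The inequality is recast as an a.e. equality of continuous functions, which then holds
  -- everywhere.
  have h1 : EqOn (fun x => max ‖f x‖ K) (fun _ => K) (Icc a b) := by
    refine Measure.eqOn_Icc_of_ae_eq volume hab.ne ?_ 
      (hf.norm.sup continuousOn_const) continuousOn_const
    rw [← restrict_Ioo_eq_restrict_Icc]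
    filter_upwards [h] with x hx using max_eq_right hx
  intro x hx
  have := h1 hx
  exact (le_max_left _ _).trans_eq this

theorem norm_evalRep_le (hab : a < b) (i : Fin k) (u : sobolevSpace a b k ∞) {x : ℝ}
    (hx : x ∈ Icc a b) : ‖evalRep a b k ∞ i x u‖ ≤ ‖u‖ := by
  refine norm_le_of_ae_le hab (continuousOn_evalRep hab i u) ?_ x hx
  filter_upwards [norm_component_le u i.castSucc, evalRep_ae_eq hab i u] with y h1 h2
  rwa [← h2]

/-- Any norm estimate for a W^{1,∞}-valued curve in time thereby becomes a Lipschitz estimate in x,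
as needed for difference quotients of the residual. -/
theorem norm_evalRep_sub_le (i : Fin k) (u : sobolevSpace a b k ∞) {x y : ℝ}
    (hx : x ∈ Icc a b) (hy : y ∈ Icc a b) :
    ‖evalRep a b k ∞ i y u - evalRep a b k ∞ i x u‖ ≤ ‖u‖ * |y - x| := by
  rw [evalRep_sub i u hx hy]
  refine intervalIntegral.norm_integral_le_of_norm_le_const_ae ?_
  have := norm_component_le u i.succ
  rw [ae_restrict_iff' measurableSet_Ioo] at this
  filter_upwards [this, Measure.ae_ne volume b] with t ht htb htm
  have h1 := uIoc_subset_uIcc htm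
  have h2 := uIcc_subset_Icc hx hy h1
  have h3 : a < t := lt_of_le_of_lt (le_min hx.1 hy.1) htm.1
  exact ht ⟨h3, lt_of_le_of_ne h2.2 htb⟩

end Bounded

end GPE

namespace GPE

/-! ### Taylor estimates -/

section Taylor

variable {E : Type*} [NormedAddCommGroup E] [NormedSpace ℝ E]

theorem hasDerivWithinAt_comp_add {g : ℝ → E} {g' : E} {S S' : Set ℝ} {x s : ℝ}
    (hg : HasDerivWithinAt g g' S (x + s)) (hm : MapsTo (fun s => x + s) S' S) :
    HasDerivWithinAt (fun s => g (x + s)) g' S' s := by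
  have := hg.scomp s ((hasDerivAt_id s).const_add x).hasDerivWithinAt hm
  rwa [one_smul] at this

theorem hasDerivWithinAt_comp_sub {g : ℝ → E} {g' : E} {S S' : Set ℝ} {x s : ℝ}
    (hg : HasDerivWithinAt g g' S (x - s)) (hm : MapsTo (fun s => x - s) S' S) :
    HasDerivWithinAt (fun s => g (x - s)) (-g') S' s := by
  have := hg.scomp s ((hasDerivAt_id s).const_sub x).hasDerivWithinAt hm
  rwa [neg_one_smul] at this

/-- Mean value inequality on `[0, h]` for a function vanishing at `0`. -/
theorem norm_le_of_hasDerivWithinAt {D D' : ℝ → E} {h C : ℝ}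
    (hD : ∀ s ∈ Icc 0 h, HasDerivWithinAt D (D' s) (Icc 0 h) s)
    (hb : ∀ s ∈ Icc 0 h, ‖D' s‖ ≤ C) (h0 : D 0 = 0) : ∀ s ∈ Icc 0 h, ‖D s‖ ≤ C * h := by
  intro s hs
  have h0m : (0 : ℝ) ∈ Icc 0 h := left_mem_Icc.2 (hs.1.trans hs.2)
  have h1 := (convex_Icc (0 : ℝ) h).norm_image_sub_le_of_norm_hasDerivWithin_le hD hb h0m hs
  rw [h0, sub_zero, sub_zero, Real.norm_of_nonneg hs.1] at h1
  have hC : 0 ≤ C := (norm_nonneg _).trans (hb s hs)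
  exact h1.trans (mul_le_mul_of_nonneg_left hs.2 hC)

/-- The error of the central second difference quotient. -/
theorem norm_second_difference_le {g : ℕ → ℝ → E} {A B x h c : ℝ} (hA : A ≤ x - h)
    (hB : x + h ≤ B) (hh : 0 ≤ h)
    (hg : ∀ i < 4, ∀ y ∈ Icc A B, HasDerivWithinAt (g i) (g (i + 1) y) (Icc A B) y)
    (hc : ∀ y ∈ Icc A B, |y - x| ≤ h → ‖g 4 y‖ ≤ c) :
    ‖g 0 (x + h) - (2 : ℝ) • g 0 x + g 0 (x - h) - (h ^ 2) • g 2 x‖ ≤ 2 * c * h ^ 4 := by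
  have mp : MapsTo (fun s => x + s) (Icc 0 h) (Icc A B) := fun s hs =>
    ⟨by linarith [hs.1], by linarith [hs.2]⟩
  have mm : MapsTo (fun s => x - s) (Icc 0 h) (Icc A B) := fun s hs =>
    ⟨by linarith [hs.2], by linarith [hs.1]⟩
  have dp : ∀ i < 4, ∀ s ∈ Icc 0 h,
      HasDerivWithinAt (fun s => g i (x + s)) (g (i + 1) (x + s)) (Icc 0 h) s := fun i hi s hs =>
    hasDerivWithinAt_comp_add (hg i hi _ (mp hs)) mp
  have dm : ∀ i < 4, ∀ s ∈ Icc 0 h,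
      HasDerivWithinAt (fun s => g i (x - s)) (-g (i + 1) (x - s)) (Icc 0 h) s := fun i hi s hs =>
    hasDerivWithinAt_comp_sub (hg i hi _ (mm hs)) mm
  -- The defect is viewed as a function of the step s. It vanishes at s = 0 with its first three
  -- derivatives, so the bound on the fourth is integrated back four times.
  have b4 : ∀ s ∈ Icc 0 h, ‖g 4 (x + s) + g 4 (x - s)‖ ≤ 2 * c := by
    intro s hs
    have h1 := hc _ (mp hs) (by rw [add_sub_cancel_left, abs_of_nonneg hs.1]; exact hs.2)
    have h2 := hc _ (mm hs) (by rw [sub_sub_cancel_left, abs_neg, abs_of_nonneg hs.1]; exact hs.2)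
    exact (norm_add_le _ _).trans (by linarith)
  have b3 : ∀ s ∈ Icc 0 h, ‖g 3 (x + s) - g 3 (x - s)‖ ≤ 2 * c * h := by
    refine norm_le_of_hasDerivWithinAt (D' := fun s => g 4 (x + s) + g 4 (x - s))
      (fun s hs => ?_) b4 (by simp)
    refine ((dp 3 (by norm_num) s hs).sub (dm 3 (by norm_num) s hs)).congr_deriv ?_
    module
  have b2 : ∀ s ∈ Icc 0 h, ‖g 2 (x + s) + g 2 (x - s) - (2 : ℝ) • g 2 x‖ ≤ 2 * c * h * h := by
    refine norm_le_of_hasDerivWithinAt (D' := fun s => g 3 (x + s) - g 3 (x - s))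
      (fun s hs => ?_) b3 (by simp [two_smul])
    refine (((dp 2 (by norm_num) s hs).add
      (dm 2 (by norm_num) s hs)).sub_const ((2 : ℝ) • g 2 x)).congr_deriv ?_
    module
  have b1 : ∀ s ∈ Icc 0 h,
      ‖g 1 (x + s) - g 1 (x - s) - (2 * s) • g 2 x‖ ≤ 2 * c * h * h * h := by
    refine norm_le_of_hasDerivWithinAt
      (D' := fun s => g 2 (x + s) + g 2 (x - s) - (2 : ℝ) • g 2 x) (fun s hs => ?_) b2 (by simp)
    have h1 : HasDerivWithinAt (fun s : ℝ => (2 * s) • g 2 x) ((2 : ℝ) • g 2 x) (Icc 0 h) s := by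
      have := (((hasDerivAt_id s).const_mul 2).smul_const (g 2 x)).hasDerivWithinAt (s := Icc 0 h)
      simpa using this
    refine (((dp 1 (by norm_num) s hs).sub (dm 1 (by norm_num) s hs)).sub h1).congr_deriv ?_
    module
  have b0 : ∀ s ∈ Icc 0 h,
      ‖g 0 (x + s) - (2 : ℝ) • g 0 x + g 0 (x - s) - (s ^ 2) • g 2 x‖ ≤ 2 * c * h * h * h * h := by
    refine norm_le_of_hasDerivWithinAt
      (D' := fun s => g 1 (x + s) - g 1 (x - s) - (2 * s) • g 2 x) (fun s hs => ?_) b1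
      (by simp [two_smul])
    have h1 : HasDerivWithinAt (fun s : ℝ => (s ^ 2) • g 2 x) ((2 * s) • g 2 x) (Icc 0 h) s := by
      have := (((hasDerivAt_id s).pow 2).smul_const (g 2 x)).hasDerivWithinAt (s := Icc 0 h)
      simpa using this
    refine ((((dp 0 (by norm_num) s hs).sub_const ((2 : ℝ) • g 0 x)).add
        (dm 0 (by norm_num) s hs)).sub h1).congr_deriv ?_
    module
  have := b0 h (right_mem_Icc.2 hh)
  calc _ ≤ _ := this
    _ = _ := by ring

/-- The error of the trapezoidal rule. -/
theorem norm_trapezoid_le {F : ℕ → ℝ → E} {T K t τ : ℝ} (ht : 0 ≤ t) (htT : t + τ ≤ T)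
    (hτ : 0 ≤ τ)
    (hF : ∀ i < 3, ∀ s ∈ Icc 0 T, HasDerivWithinAt (F i) (F (i + 1) s) (Icc 0 T) s)
    (hK : ∀ s ∈ Icc 0 T, ‖F 3 s‖ ≤ K) :
    ‖F 0 (t + τ) - F 0 t - (τ / 2) • (F 1 (t + τ) + F 1 t)‖ ≤ K * τ ^ 3 := by
  have mp : MapsTo (fun s => t + s) (Icc 0 τ) (Icc 0 T) := fun s hs =>
    ⟨by linarith [hs.1], by linarith [hs.2]⟩
  have dp : ∀ i < 3, ∀ s ∈ Icc 0 τ,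
      HasDerivWithinAt (fun s => F i (t + s)) (F (i + 1) (t + s)) (Icc 0 τ) s := fun i hi s hs =>
    hasDerivWithinAt_comp_add (hF i hi _ (mp hs)) mp
  -- As a function of the step s, the trapezoidal defect has second derivative -(s/2) F₃(t + s).
  have b2 : ∀ s ∈ Icc 0 τ, ‖-((s / 2) • F 3 (t + s))‖ ≤ K * τ := by
    intro s hs
    have h1 := hK _ (mp hs)
    rw [norm_neg, norm_smul, Real.norm_of_nonneg (by linarith [hs.1])]
    have : s / 2 ≤ τ := by linarith [hs.1, hs.2]
    calc s / 2 * ‖F 3 (t + s)‖ ≤ τ * K :=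
          mul_le_mul this h1 (norm_nonneg _) hτ
      _ = _ := mul_comm _ _
  have hs2 : ∀ s, HasDerivWithinAt (fun s : ℝ => s / 2) (1 / 2) (Icc 0 τ) s := fun s =>
    ((hasDerivAt_id s).div_const 2).hasDerivWithinAt
  have b1 : ∀ s ∈ Icc 0 τ,
      ‖(1 / 2 : ℝ) • (F 1 (t + s) - F 1 t) - (s / 2) • F 2 (t + s)‖ ≤ K * τ * τ := by
    refine norm_le_of_hasDerivWithinAt (D' := fun s => -((s / 2) • F 3 (t + s)))
      (fun s hs => ?_) b2 (by simp)
    have h1 := ((dp 1 (by norm_num) s hs).sub_const (F 1 t)).const_smul (1 / 2 : ℝ)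
    have h2 := (hs2 s).smul (dp 2 (by norm_num) s hs)
    refine (h1.sub h2).congr_deriv ?_
    module
  have b0 : ∀ s ∈ Icc 0 τ,
      ‖F 0 (t + s) - F 0 t - (s / 2) • (F 1 (t + s) + F 1 t)‖ ≤ K * τ * τ * τ := by
    refine norm_le_of_hasDerivWithinAt
      (D' := fun s => (1 / 2 : ℝ) • (F 1 (t + s) - F 1 t) - (s / 2) • F 2 (t + s))
      (fun s hs => ?_) b1 (by simp)
    have h1 := (dp 0 (by norm_num) s hs).sub_const (F 0 t)
    have h2 := (hs2 s).smul ((dp 1 (by norm_num) s hs).add_const (F 1 t))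
    refine (h1.sub h2).congr_deriv ?_
    module
  have := b0 τ (right_mem_Icc.2 hτ)
  calc _ ≤ _ := this
    _ = _ := by ring

/-- Second-order Taylor expansion with a Lipschitz second derivative. -/
theorem norm_taylor_two_le {g : ℕ → ℝ → E} {a b e x K : ℝ} (he : e ∈ Icc a b)
    (hx : x ∈ Icc a b)
    (hg : ∀ i < 2, ∀ y ∈ Icc a b, HasDerivWithinAt (g i) (g (i + 1) y) (Icc a b) y)
    (hK : ∀ y ∈ Icc a b, ‖g 2 y - g 2 e‖ ≤ K * |y - e|) :
    ‖g 0 x - g 0 e - (x - e) • g 1 e - ((x - e) ^ 2 / 2) • g 2 e‖ ≤ K * |x - e| ^ 3 := by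
  have hsub : uIcc e x ⊆ Icc a b := uIcc_subset_Icc he hx
  have hd : ∀ i < 2, ∀ y ∈ uIcc e x, HasDerivWithinAt (g i) (g (i + 1) y) (uIcc e x) y :=
    fun i hi y hy => (hg i hi y (hsub hy)).mono hsub
  have hr : ∀ y ∈ uIcc e x, |y - e| ≤ |x - e| := fun y hy => abs_sub_left_of_mem_uIcc hy
  have hK0 : 0 ≤ K * |x - e| := (norm_nonneg _).trans (hK x hx)
  have b2 : ∀ y ∈ uIcc e x, ‖g 2 y - g 2 e‖ ≤ K * |x - e| := by
    intro y hy
    rcases eq_or_ne x e with rfl | hne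
    · have : y = x := by simpa using hy
      simp [this]
    · have hKp : 0 ≤ K := nonneg_of_mul_nonneg_left hK0 (abs_pos.2 (sub_ne_zero.2 hne))
      exact (hK y (hsub hy)).trans (mul_le_mul_of_nonneg_left (hr y hy) hKp)
  have b1 : ∀ y ∈ uIcc e x, ‖g 1 y - g 1 e - (y - e) • g 2 e‖ ≤ K * |x - e| * |x - e| := by
    intro y hy
    have h1 := (convex_uIcc e x).norm_image_sub_le_of_norm_hasDerivWithin_le
      (f := fun y => g 1 y - g 1 e - (y - e) • g 2 e) (f' := fun y => g 2 y - g 2 e)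
      (fun y hy => by
        refine (((hd 1 (by norm_num) y hy).sub_const (g 1 e)).sub
          ((((hasDerivAt_id y).sub_const e).smul_const (g 2 e)).hasDerivWithinAt)).congr_deriv ?_
        module) b2 left_mem_uIcc hy
    simp only [sub_self, zero_smul, sub_zero, Real.norm_eq_abs] at h1
    exact h1.trans (mul_le_mul_of_nonneg_left (hr y hy) hK0)
  have h0 := (convex_uIcc e x).norm_image_sub_le_of_norm_hasDerivWithin_le
      (f := fun y => g 0 y - g 0 e - (y - e) • g 1 e - ((y - e) ^ 2 / 2) • g 2 e)
      (f' := fun y => g 1 y - g 1 e - (y - e) • g 2 e)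
      (fun y hy => by
        have h3 : HasDerivAt (fun y : ℝ => (y - e) ^ 2 / 2) (y - e) y := by
          have := ((((hasDerivAt_id y).sub_const e).pow 2).div_const 2)
          refine this.congr_deriv ?_
          simp
        refine ((((hd 0 (by norm_num) y hy).sub_const (g 0 e)).sub
          ((((hasDerivAt_id y).sub_const e).smul_const (g 1 e)).hasDerivWithinAt)).sub
          (h3.smul_const (g 2 e)).hasDerivWithinAt).congr_deriv ?_
        module) b1 left_mem_uIcc right_mem_uIcc
  simp only [sub_self, zero_smul, sub_zero, Real.norm_eq_abs, ne_eq, OfNat.ofNat_ne_zero,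
    not_false_eq_true, zero_pow, zero_div] at h0
  calc _ ≤ _ := h0
    _ = _ := by ring

/-- The successive derivatives of a `C^m` curve on `[0, T]`. -/
theorem exists_derivs_of_contDiffOn {T : ℝ} (hT : 0 < T) {m : ℕ} {F : ℝ → E}
    (hF : ContDiffOn ℝ m F (Icc 0 T)) :
    ∃ G : ℕ → ℝ → E, G 0 = F ∧
      (∀ i < m, ∀ s ∈ Icc 0 T, HasDerivWithinAt (G i) (G (i + 1) s) (Icc 0 T) s) ∧
      ∀ i ≤ m, ContinuousOn (G i) (Icc 0 T) := by
  have hu : UniqueDiffOn ℝ (Icc 0 T) := uniqueDiffOn_Icc hT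
  refine ⟨fun i => iteratedDerivWithin i F (Icc 0 T), by simp, fun i hi s hs => ?_,
    fun i hi => hF.continuousOn_iteratedDerivWithin (by exact_mod_cast hi) hu⟩
  have h1 := (hF.differentiableOn_iteratedDerivWithin (by exact_mod_cast hi) hu s hs)
  have h2 := h1.hasDerivWithinAt
  rwa [← iteratedDerivWithin_succ] at h2

end Taylor

end GPE

namespace GPE

/-! ### Pointwise consequences of the regularity of the solution -/

/-- The spatial derivatives `f i` (`i ≤ 4`) and the time derivative `q` of the solution, with the
bounds provided by its Sobolev regularity. -/
structure SolutionData (a b T : ℝ) (V : ℝ → ℝ) (β : ℝ) (ψ : ℝ → ℝ → ℂ) (f : ℕ → ℝ → ℝ → ℂ)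
    (q : ℝ → ℝ → ℂ) (K : ℝ) : Prop where
  f_zero : ∀ t ∈ Icc 0 T, ∀ x ∈ Icc a b, f 0 x t = ψ x t
  f_deriv : ∀ t ∈ Icc 0 T, ∀ i < 4, ∀ x ∈ Icc a b,
    HasDerivWithinAt (fun y => f i y t) (f (i + 1) x t) (Icc a b) x
  f_bound : ∀ t ∈ Icc 0 T, ∀ i ≤ 4, ∀ x ∈ Icc a b, ‖f i x t‖ ≤ K
  f_lip : ∀ t ∈ Icc 0 T, ∀ x ∈ Icc a b, ∀ y ∈ Icc a b, ‖f 4 y t - f 4 x t‖ ≤ K * |y - x|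
  q_deriv : ∀ t ∈ Icc 0 T, ∀ x ∈ Icc a b, HasDerivWithinAt (fun s => ψ x s) (q x t) (Icc 0 T) t
  q_cont : ∀ t ∈ Icc 0 T, ContinuousOn (fun x => q x t) (Icc a b)
  boundary : ∀ t ∈ Icc 0 T, ψ a t = 0 ∧ ψ b t = 0
  q_boundary : ∀ t ∈ Icc 0 T, q a t = 0 ∧ q b t = 0
  equation : ∀ t ∈ Icc 0 T, ∀ x ∈ Ioo a b,
    Complex.I * q x t = -(1 / 2) * f 2 x t + (V x : ℂ) * ψ x t
      + (β : ℂ) * (‖ψ x t‖ : ℂ) ^ 2 * ψ x t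
  diff_bound : ∀ t ∈ Icc 0 T, ∀ s ∈ Icc 0 T, ∀ x ∈ Icc a b, ‖ψ x s - ψ x t‖ ≤ K * |s - t|
  diff_lip : ∀ t ∈ Icc 0 T, ∀ s ∈ Icc 0 T, ∀ x ∈ Icc a b, ∀ y ∈ Icc a b,
    ‖(ψ y s - ψ y t) - (ψ x s - ψ x t)‖ ≤ K * |s - t| * |y - x|
  trap_lip : ∀ t τ, 0 ≤ t → 0 ≤ τ → t + τ ≤ T → ∀ x ∈ Icc a b, ∀ y ∈ Icc a b,
    ‖(ψ y (t + τ) - ψ y t - (τ / 2 : ℝ) • (q y (t + τ) + q y t))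
      - (ψ x (t + τ) - ψ x t - (τ / 2 : ℝ) • (q x (t + τ) + q x t))‖ ≤ K * τ ^ 3 * |y - x|

section Data

variable {a b T β : ℝ} {V : ℝ → ℝ} {ψ₀ : ℝ → ℂ} {ψ : ℝ → ℝ → ℂ}

theorem IsSolution.continuousOn_space (hψ : IsSolution a b T V β ψ₀ ψ) {t : ℝ}
    (ht : t ∈ Icc 0 T) : ContinuousOn (fun x => ψ x t) (Icc a b) :=
  hψ.continuousOn.comp (f := fun x => (x, t)) (by fun_prop) fun _ hx => ⟨hx, ht⟩

theorem IsSolution.continuousOn_time (hψ : IsSolution a b T V β ψ₀ ψ) {x : ℝ}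
    (hx : x ∈ Icc a b) : ContinuousOn (fun t => ψ x t) (Icc 0 T) :=
  hψ.continuousOn.comp (f := fun t => (x, t)) (by fun_prop) fun _ ht => ⟨hx, ht⟩

theorem IsSolution.boundary_Icc (hab : a < b) (hT : 0 < T) (hψ : IsSolution a b T V β ψ₀ ψ) :
    ∀ t ∈ Icc 0 T, ψ a t = 0 ∧ ψ b t = 0 := by
  have key : ∀ x ∈ Icc a b, (∀ t ∈ Ioc 0 T, ψ x t = 0) → ∀ t ∈ Icc 0 T, ψ x t = 0 := by
    intro x hx h
    have h1 : EqOn (fun t => ψ x t) (fun _ => 0) (Ioc 0 T) := h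
    exact h1.of_subset_closure (hψ.continuousOn_time hx) continuousOn_const Ioc_subset_Icc_self
      (by rw [closure_Ioc hT.ne])
  exact fun t ht => ⟨key a (left_mem_Icc.2 hab.le) (fun t ht => (hψ.boundary t ht).1) t ht,
    key b (right_mem_Icc.2 hab.le) (fun t ht => (hψ.boundary t ht).2) t ht⟩

theorem exists_bound_norm {E : Type*} [NormedAddCommGroup E] {F : ℝ → E}
    (hF : ContinuousOn F (Icc 0 T)) : ∃ K, 0 ≤ K ∧ ∀ t ∈ Icc 0 T, ‖F t‖ ≤ K := by
  obtain ⟨K, hK⟩ := isCompact_Icc.exists_bound_of_continuousOn hF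
  exact ⟨|K|, abs_nonneg _, fun t ht => (hK t ht).trans (le_abs_self _)⟩

theorem evalRep_zero_eq (hab : a < b) (hψ : IsSolution a b T V β ψ₀ ψ) {k : ℕ} {p : ℝ≥0∞}
    [Fact (1 ≤ p)] (u : sobolevSpace a b (k + 1) p) {t : ℝ} (ht : t ∈ Icc 0 T)
    (hu : u.1 0 =ᵐ[intervalMeasure a b] fun x => ψ x t) {x : ℝ} (hx : x ∈ Icc a b) :
    evalRep a b (k + 1) p 0 x u = ψ x t :=
  evalRep_eq hab 0 u (hψ.continuousOn_space ht) hu hx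

/-- W^{5,∞} yields the space derivatives up to order 4, the last one Lipschitz. The curve of class
C³ in W^{1,∞} yields ψ_t and all time estimates. The equation extends from 0 < t < T to the closed
interval because evaluations are continuous in t. -/
theorem exists_solutionData (hab : a < b) (hT : 0 < T)
    (hψ : IsSolution a b T V β ψ₀ ψ) (hreg : Regular a b T ψ) :
    ∃ f q K, 0 ≤ K ∧ SolutionData a b T V β ψ f q K := by
  obtain ⟨F, hF, hFψ⟩ := hreg.c0_w5
  obtain ⟨H, hH, hHψ⟩ := hreg.c3_w1
  have hFc : ContinuousOn F (Icc 0 T) := hF.continuousOn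
  obtain ⟨G, hG0, hGd, hGc⟩ := exists_derivs_of_contDiffOn hT hH
  obtain ⟨K5, hK5, hF5⟩ := exists_bound_norm hFc
  obtain ⟨K1, hK1, hG1⟩ := exists_bound_norm (hGc 1 (by norm_num))
  obtain ⟨K3, hK3, hG3⟩ := exists_bound_norm (hGc 3 (by norm_num))
  set K := K5 + K1 + K3 with hK
  set f : ℕ → ℝ → ℝ → ℂ := fun i x t => if h : i < 5 then evalRep a b 5 ∞ ⟨i, h⟩ x (F t) else 0
    with hf
  have hfi : ∀ i (h : i < 5) x t, f i x t = evalRep a b 5 ∞ ⟨i, h⟩ x (F t) := fun i h x t => by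
    simp [hf, h]
  set ev : ℝ → sobolevSpace a b 1 ∞ →L[ℝ] ℂ := fun x => evalRep a b 1 ∞ 0 x with hev
  have evψ : ∀ t ∈ Icc 0 T, ∀ x ∈ Icc a b, ev x (G 0 t) = ψ x t := fun t ht x hx => by
    rw [hG0]; exact evalRep_zero_eq hab hψ (H t) ht (hHψ t ht) hx
  set q : ℝ → ℝ → ℂ := fun x t => ev x (G 1 t) with hq
  have evd : ∀ i < 3, ∀ t ∈ Icc 0 T, ∀ x,
      HasDerivWithinAt (fun s => ev x (G i s)) (ev x (G (i + 1) t)) (Icc 0 T) t :=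
    fun i hi t ht x => (ev x).hasFDerivAt.comp_hasDerivWithinAt t (hGd i hi t ht)
  have hqd : ∀ t ∈ Icc 0 T, ∀ x ∈ Icc a b,
      HasDerivWithinAt (fun s => ψ x s) (q x t) (Icc 0 T) t := fun t ht x hx =>
    (evd 0 (by norm_num) t ht x).congr (fun s hs => (evψ s hs x hx).symm) (evψ t ht x hx).symm
  have hf0 : ∀ t ∈ Icc 0 T, ∀ x ∈ Icc a b, f 0 x t = ψ x t := fun t ht x hx => by
    rw [hfi 0 (by norm_num)]; exact evalRep_zero_eq hab hψ (F t) ht (hFψ t ht) hx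
  have hfd : ∀ t ∈ Icc 0 T, ∀ i < 4, ∀ x ∈ Icc a b,
      HasDerivWithinAt (fun y => f i y t) (f (i + 1) x t) (Icc a b) x := by
    intro t ht i hi x hx
    rw [hfi (i + 1) (by omega)]
    simp only [hfi i (by omega : i < 5)]
    exact hasDerivWithinAt_evalRep hab rfl (F t) hx
  have hbd := hψ.boundary_Icc hab hT
  have hqb : ∀ x ∈ Icc a b, (∀ t ∈ Icc 0 T, ψ x t = 0) → ∀ t ∈ Icc 0 T, q x t = 0 := by
    intro x hx h t ht
    have h1 : HasDerivWithinAt (fun s => ψ x s) 0 (Icc 0 T) t :=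
      (hasDerivWithinAt_const t (Icc 0 T) (0 : ℂ)).congr h (h t ht)
    exact (uniqueDiffOn_Icc hT t ht).eq_deriv _ (hqd t ht x hx) h1
  have hdiff : ∀ t ∈ Icc 0 T, ∀ s ∈ Icc 0 T, ‖G 0 s - G 0 t‖ ≤ K1 * |s - t| := fun t ht s hs =>
    (convex_Icc 0 T).norm_image_sub_le_of_norm_hasDerivWithin_le
      (fun r hr => hGd 0 (by norm_num) r hr) hG1 ht hs
  -- The trapezoidal error is estimated in W^{1,∞}, which controls its variation in x as well as its
  -- size.
  have htrap : ∀ t τ, 0 ≤ t → 0 ≤ τ → t + τ ≤ T →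
      ‖G 0 (t + τ) - G 0 t - (τ / 2) • (G 1 (t + τ) + G 1 t)‖ ≤ K3 * τ ^ 3 :=
    fun t τ ht hτ htT => norm_trapezoid_le ht htT hτ hGd hG3
  have evtrap : ∀ t τ, 0 ≤ t → 0 ≤ τ → t + τ ≤ T → ∀ x ∈ Icc a b,
      ψ x (t + τ) - ψ x t - (τ / 2 : ℝ) • (q x (t + τ) + q x t)
        = ev x (G 0 (t + τ) - G 0 t - (τ / 2) • (G 1 (t + τ) + G 1 t)) := by
    intro t τ ht hτ htT x hx
    rw [map_sub, map_sub, map_smul, map_add, evψ t ⟨ht, by linarith⟩ x hx,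
      evψ (t + τ) ⟨by linarith, htT⟩ x hx]
  refine ⟨f, q, K, by positivity, hf0, hfd, ?_, ?_, hqd, ?_, hbd, ?_, ?_, ?_, ?_, ?_⟩
  · intro t ht i hi x hx
    rw [hfi i (by omega)]
    exact ((norm_evalRep_le hab _ _ hx).trans (hF5 t ht)).trans (by linarith)
  · intro t ht x hx y hy
    rw [hfi 4 (by norm_num), hfi 4 (by norm_num)]
    refine (norm_evalRep_sub_le _ _ hx hy).trans ?_
    exact mul_le_mul_of_nonneg_right ((hF5 t ht).trans (by linarith)) (abs_nonneg _)
  · intro t ht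
    exact continuousOn_evalRep hab _ _
  · exact fun t ht => ⟨hqb a (left_mem_Icc.2 hab.le) (fun t ht => (hbd t ht).1) t ht,
      hqb b (right_mem_Icc.2 hab.le) (fun t ht => (hbd t ht).2) t ht⟩
  · have main : ∀ x ∈ Ioo a b, EqOn (fun t => Complex.I * q x t)
        (fun t => -(1 / 2) * f 2 x t + (V x : ℂ) * ψ x t
          + (β : ℂ) * (‖ψ x t‖ : ℂ) ^ 2 * ψ x t) (Icc 0 T) := by
      intro x hx
      have hxI := Ioo_subset_Icc_self hx
      have hopen : EqOn (fun t => Complex.I * q x t)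
          (fun t => -(1 / 2) * f 2 x t + (V x : ℂ) * ψ x t
            + (β : ℂ) * (‖ψ x t‖ : ℂ) ^ 2 * ψ x t) (Ioo 0 T) := by
        intro t ht
        have htI := Ioo_subset_Icc_self ht
        have e := hψ.equation x hx t ht
        have d1 : deriv (fun s => ψ x s) t = q x t :=
          ((hqd t htI x hxI).hasDerivAt (Icc_mem_nhds ht.1 ht.2)).deriv
        have d2 : ∀ i < 4, ∀ y ∈ Ioo a b, HasDerivAt (fun y => f i y t) (f (i + 1) y t) y :=
          fun i hi y hy => (hfd t htI i hi y (Ioo_subset_Icc_self hy)).hasDerivAt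
            (Icc_mem_nhds hy.1 hy.2)
        have d3 : ∀ y ∈ Ioo a b, deriv (fun y => ψ y t) y = f 1 y t := by
          intro y hy
          refine ((d2 0 (by norm_num) y hy).congr_of_eventuallyEq ?_).deriv
          filter_upwards [Icc_mem_nhds hy.1 hy.2] with z hz using (hf0 t htI z hz).symm
        have d4 : iteratedDeriv 2 (fun y => ψ y t) x = f 2 x t := by
          rw [iteratedDeriv_succ, iteratedDeriv_one]
          refine ((d2 1 (by norm_num) x hx).congr_of_eventuallyEq ?_).deriv
          filter_upwards [Ioo_mem_nhds hx.1 hx.2] with z hz using d3 z hz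
        rw [d1, d4] at e
        exact e
      have c1 : ContinuousOn (fun t => q x t) (Icc 0 T) :=
        (ev x).continuous.comp_continuousOn (hGc 1 (by norm_num))
      have c2 : ContinuousOn (fun t => f 2 x t) (Icc 0 T) := by
        simp only [hfi 2 (by norm_num)]
        exact (evalRep a b 5 ∞ ⟨2, by norm_num⟩ x).continuous.comp_continuousOn hFc
      have c3 := hψ.continuousOn_time hxI
      have c4 : ContinuousOn (fun t => (‖ψ x t‖ : ℂ)) (Icc 0 T) :=
        Complex.continuous_ofReal.comp_continuousOn c3.norm
      refine hopen.of_subset_closure (by fun_prop) (by fun_prop) Ioo_subset_Icc_self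
        (by rw [closure_Ioo hT.ne])
    exact fun t ht x hx => main x hx ht
  · intro t ht s hs x hx
    rw [← evψ t ht x hx, ← evψ s hs x hx, ← map_sub]
    refine ((norm_evalRep_le hab _ _ hx).trans (hdiff t ht s hs)).trans ?_
    exact mul_le_mul_of_nonneg_right (by linarith) (abs_nonneg _)
  · intro t ht s hs x hx y hy
    rw [← evψ t ht x hx, ← evψ s hs x hx, ← map_sub, ← evψ t ht y hy, ← evψ s hs y hy,
      ← map_sub]
    refine (norm_evalRep_sub_le _ _ hx hy).trans ?_
    refine mul_le_mul_of_nonneg_right ((hdiff t ht s hs).trans ?_) (abs_nonneg _)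
    exact mul_le_mul_of_nonneg_right (by linarith) (abs_nonneg _)
  · intro t τ ht hτ htT x hx y hy
    rw [evtrap t τ ht hτ htT x hx, evtrap t τ ht hτ htT y hy]
    refine (norm_evalRep_sub_le _ _ hx hy).trans ?_
    refine mul_le_mul_of_nonneg_right ((htrap t τ ht hτ htT).trans ?_) (abs_nonneg _)
    exact mul_le_mul_of_nonneg_right (by linarith) (by positivity)

end Data

end GPE

namespace GPE

/-! ### Vanishing of the fourth derivative at the boundary -/

section Boundary

variable {a b T β K : ℝ} {V : ℝ → ℝ} {ψ₀ : ℝ → ℂ} {ψ : ℝ → ℝ → ℂ} {f : ℕ → ℝ → ℝ → ℂ}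
  {q : ℝ → ℝ → ℂ}

theorem SolutionData.f_zero_cont (hd : SolutionData a b T V β ψ f q K) {t : ℝ}
    (ht : t ∈ Icc 0 T) {i : ℕ} (hi : i < 4) : ContinuousOn (fun x => f i x t) (Icc a b) :=
  fun x hx => (hd.f_deriv t ht i hi x hx).continuousWithinAt

theorem SolutionData.f_lip_of_lt (hd : SolutionData a b T V β ψ f q K) {t : ℝ}
    (ht : t ∈ Icc 0 T) {i : ℕ} (hi : i < 4) {x y : ℝ} (hx : x ∈ Icc a b) (hy : y ∈ Icc a b) :
    ‖f i y t - f i x t‖ ≤ K * |y - x| :=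
  (convex_Icc a b).norm_image_sub_le_of_norm_hasDerivWithin_le
    (fun z hz => hd.f_deriv t ht i hi z hz) (fun z hz => hd.f_bound t ht (i + 1) hi z hz) hx hy

theorem SolutionData.equation_Icc (hab : a < b) (hV : ContinuousOn V (Icc a b))
    (hd : SolutionData a b T V β ψ f q K) {t : ℝ} (ht : t ∈ Icc 0 T) {x : ℝ}
    (hx : x ∈ Icc a b) :
    Complex.I * q x t = -(1 / 2) * f 2 x t + (V x : ℂ) * f 0 x t
      + (β : ℂ) * (‖f 0 x t‖ : ℂ) ^ 2 * f 0 x t := by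
  have h1 : EqOn (fun x => Complex.I * q x t) (fun x => -(1 / 2) * f 2 x t + (V x : ℂ) * f 0 x t
      + (β : ℂ) * (‖f 0 x t‖ : ℂ) ^ 2 * f 0 x t) (Ioo a b) := fun x hx => by
    have := hd.equation t ht x hx
    simpa only [hd.f_zero t ht x (Ioo_subset_Icc_self hx)] using this
  have c1 := hd.q_cont t ht
  have c2 := hd.f_zero_cont ht (i := 2) (by norm_num)
  have c0 := hd.f_zero_cont ht (i := 0) (by norm_num)
  have c3 : ContinuousOn (fun x => (‖f 0 x t‖ : ℂ)) (Icc a b) :=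
    Complex.continuous_ofReal.comp_continuousOn c0.norm
  have c4 : ContinuousOn (fun x => (V x : ℂ)) (Icc a b) :=
    Complex.continuous_ofReal.comp_continuousOn hV
  exact h1.of_subset_closure (by fun_prop) (by fun_prop) Ioo_subset_Icc_self
    (by rw [closure_Ioo hab.ne]) hx

theorem SolutionData.f_zero_boundary (hab : a < b) (hd : SolutionData a b T V β ψ f q K) {t : ℝ}
    (ht : t ∈ Icc 0 T) {e : ℝ} (he : e = a ∨ e = b) : f 0 e t = 0 := by
  rcases he with rfl | rfl
  · rw [hd.f_zero t ht _ (left_mem_Icc.2 hab.le)]; exact (hd.boundary t ht).1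
  · rw [hd.f_zero t ht _ (right_mem_Icc.2 hab.le)]; exact (hd.boundary t ht).2

theorem SolutionData.q_boundary' (hd : SolutionData a b T V β ψ f q K) {t : ℝ}
    (ht : t ∈ Icc 0 T) {e : ℝ} (he : e = a ∨ e = b) : q e t = 0 := by
  rcases he with rfl | rfl
  · exact (hd.q_boundary t ht).1
  · exact (hd.q_boundary t ht).2

theorem SolutionData.f_two_boundary (hab : a < b) (hV : ContinuousOn V (Icc a b))
    (hd : SolutionData a b T V β ψ f q K) {t : ℝ} (ht : t ∈ Icc 0 T) {e : ℝ}
    (he : e = a ∨ e = b) : f 2 e t = 0 := by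
  have heI : e ∈ Icc a b := by
    rcases he with rfl | rfl
    · exact left_mem_Icc.2 hab.le
    · exact right_mem_Icc.2 hab.le
  have h := hd.equation_Icc hab hV ht heI
  rw [hd.q_boundary' ht he, hd.f_zero_boundary hab ht he] at h
  simpa using h

/-- Expansion of the time derivative at an end point. -/
theorem SolutionData.exists_q_expansion (hab : a < b) (hT : 0 < T) (hV : ContinuousOn V (Icc a b))
    (hψ : IsSolution a b T V β ψ₀ ψ) (hreg : MemCW a b T 2 3 ∞ ψ)
    (hd : SolutionData a b T V β ψ f q K) {t : ℝ} (ht : t ∈ Icc 0 T) {e : ℝ}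
    (he : e = a ∨ e = b) :
    ∃ (k : ℂ) (C : ℝ), ∀ x ∈ Icc a b, ‖q x t - (x - e) • k‖ ≤ C * |x - e| ^ 3 := by
  have heI : e ∈ Icc a b := by
    rcases he with rfl | rfl
    · exact left_mem_Icc.2 hab.le
    · exact right_mem_Icc.2 hab.le
  obtain ⟨F, hF, hFψ⟩ := hreg
  obtain ⟨G, hG0, hGd, -⟩ := exists_derivs_of_contDiffOn hT hF
  set ev : ℕ → ℝ → sobolevSpace a b 3 ∞ →L[ℝ] ℂ :=
    fun i x => if h : i < 3 then evalRep a b 3 ∞ ⟨i, h⟩ x else 0 with hev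
  have hevi : ∀ i (h : i < 3) x, ev i x = evalRep a b 3 ∞ ⟨i, h⟩ x := fun i h x => by
    simp [hev, h]
  have hder : ∀ u, ∀ i < 2, ∀ x ∈ Icc a b,
      HasDerivWithinAt (fun y => ev i y u) (ev (i + 1) x u) (Icc a b) x := by
    intro u i hi x hx
    rw [hevi (i + 1) (by omega)]
    simp only [hevi i (by omega : i < 3)]
    exact hasDerivWithinAt_evalRep hab rfl u hx
  have hu := uniqueDiffOn_Icc hab
  have e0 : ∀ s ∈ Icc 0 T, ∀ x ∈ Icc a b, ev 0 x (F s) = f 0 x s := fun s hs x hx => by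
    rw [hd.f_zero s hs x hx, hevi 0 (by norm_num)]
    exact evalRep_zero_eq hab hψ (F s) hs (hFψ s hs) hx
  have enext : ∀ i < 2, (∀ s ∈ Icc 0 T, ∀ x ∈ Icc a b, ev i x (F s) = f i x s) →
      ∀ s ∈ Icc 0 T, ∀ x ∈ Icc a b, ev (i + 1) x (F s) = f (i + 1) x s := by
    intro i hi h s hs x hx
    refine (hu x hx).eq_deriv _ (hder (F s) i hi x hx) ?_
    exact (hd.f_deriv s hs i (by omega) x hx).congr (fun y hy => h s hs y hy) (h s hs x hx)
  have e2 := enext 1 (by norm_num) (enext 0 (by norm_num) e0)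
  have evd : ∀ i x, HasDerivWithinAt (fun s => ev i x (F s)) (ev i x (G 1 t)) (Icc 0 T) t :=
    fun i x => by
      have := (ev i x).hasFDerivAt.comp_hasDerivWithinAt t (hGd 0 (by norm_num) t ht)
      rwa [hG0] at this
  have hk0 : ∀ x ∈ Icc a b, ev 0 x (G 1 t) = q x t := fun x hx =>
    (uniqueDiffOn_Icc hT t ht).eq_deriv _ (evd 0 x) ((hd.q_deriv t ht x hx).congr
      (fun s hs => (e0 s hs x hx).trans (hd.f_zero s hs x hx))
      ((e0 t ht x hx).trans (hd.f_zero t ht x hx)))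
  have hz : ∀ s ∈ Icc 0 T, ev 2 e (F s) = 0 := fun s hs =>
    (e2 s hs e heI).trans (hd.f_two_boundary hab hV hs he)
  -- ψ_xx(e, ·) vanishes identically, hence so does its time derivative ψ_txx(e, t). Two space
  -- derivatives of ψ_t exist by the C² in W^{3,∞} regularity. The constant and quadratic Taylor
  -- terms of ψ_t at e thus both disappear.
  have hk2 : ev 2 e (G 1 t) = 0 :=
    (uniqueDiffOn_Icc hT t ht).eq_deriv _ (evd 2 e)
      ((hasDerivWithinAt_const t (Icc 0 T) (0 : ℂ)).congr hz (hz t ht))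
  refine ⟨ev 1 e (G 1 t), ‖G 1 t‖, fun x hx => ?_⟩
  have := norm_taylor_two_le (g := fun i y => ev i y (G 1 t)) heI hx (hder (G 1 t))
    (fun y hy => by
      rw [hevi 2 (by norm_num), hevi 2 (by norm_num)]
      exact norm_evalRep_sub_le _ _ heI hy)
  rwa [hk2, hk0 x hx, hk0 e heI, hd.q_boundary' ht he, smul_zero, sub_zero, sub_zero] at this

open Asymptotics Filter Topology in
theorem eq_zero_of_isLittleO_smul {l : Filter ℝ} [l.NeBot] {Y : ℝ → ℝ} (hY : ∀ᶠ x in l, Y x ≠ 0)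
    {c : ℂ} (h : (fun x => Y x • c) =o[l] Y) : c = 0 := by
  by_contra hc
  have h1 := isLittleO_iff.1 h (half_pos (norm_pos_iff.2 hc))
  obtain ⟨x, hx, hx'⟩ := (h1.and hY).exists
  rw [norm_smul, mul_comm] at hx
  have := le_of_mul_le_mul_right hx (norm_pos_iff.2 hx')
  linarith [norm_pos_iff.2 hc]

-- Formally, two differentiations of the equation at e leave ψ_xxxx = 4V'ψ_x. Since V is not assumed
-- twice differentiable, all terms are instead expanded at e up to o((x - e)²) and coefficients are
-- compared.
open Asymptotics Filter Topology in
theorem SolutionData.f_four_boundary (hab : a < b) (hT : 0 < T) (hV : ContinuousOn V (Icc a b))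
    (hψ : IsSolution a b T V β ψ₀ ψ) (hreg : MemCW a b T 2 3 ∞ ψ)
    (hd : SolutionData a b T V β ψ f q K) {t : ℝ} (ht : t ∈ Icc 0 T) {e V' : ℝ}
    (he : e = a ∨ e = b) (hV' : HasDerivWithinAt V V' (Icc a b) e)
    (hc : V' = 0 ∨ f 1 e t = 0) : f 4 e t = 0 := by
  have heI : e ∈ Icc a b := by
    rcases he with rfl | rfl
    · exact left_mem_Icc.2 hab.le
    · exact right_mem_Icc.2 hab.le
  have hne : (𝓝[Ioo a b] e).NeBot := by
    rcases he with rfl | rfl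
    · exact left_nhdsWithin_Ioo_neBot hab
    · exact right_nhdsWithin_Ioo_neBot hab
  set l := 𝓝[Ioo a b] e with hl
  set Y : ℝ → ℝ := fun x => x - e with hYdef
  have hmem : ∀ᶠ x in l, x ∈ Ioo a b := self_mem_nhdsWithin
  have hY0 : ∀ᶠ x in l, Y x ≠ 0 := by
    filter_upwards [hmem] with x hx
    rw [hYdef, sub_ne_zero]
    rcases he with rfl | rfl
    · exact hx.1.ne'
    · exact hx.2.ne
  have hYt : Tendsto Y l (𝓝 0) := by
    have : Tendsto Y (𝓝 e) (𝓝 (e - e)) := (continuous_id.sub continuous_const).tendsto e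
    rw [sub_self] at this
    exact this.mono_left nhdsWithin_le_nhds
  have h32 : (fun x => Y x ^ 3) =o[l] fun x => Y x ^ 2 := by
    have := ((isLittleO_one_iff ℝ).2 hYt).mul_isBigO (isBigO_refl (fun x => Y x ^ 2) l)
    refine this.congr (fun x => by ring) (fun x => by ring)
  have h21 : (fun x => Y x ^ 2) =o[l] Y := by
    have := ((isLittleO_one_iff ℝ).2 hYt).mul_isBigO (isBigO_refl Y l)
    refine this.congr (fun x => by ring) (fun x => by ring)
  have of_cube : ∀ {r : ℝ → ℂ} {C : ℝ}, (∀ x ∈ Icc a b, ‖r x‖ ≤ C * |x - e| ^ 3) →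
      r =o[l] fun x => Y x ^ 2 := by
    intro r C hr
    refine IsBigO.trans_isLittleO (IsBigO.of_bound C ?_) h32
    filter_upwards [hmem] with x hx
    rw [norm_pow, Real.norm_eq_abs]
    exact hr x (Ioo_subset_Icc_self hx)
  obtain ⟨k, C, hk⟩ := hd.exists_q_expansion hab hT hV hψ hreg ht he
  have r1 := of_cube hk
  have r2 := of_cube (r := fun x => f 2 x t - (x - e) • f 3 e t - ((x - e) ^ 2 / 2) • f 4 e t)
    (C := K) fun x hx => by
      have := norm_taylor_two_le (g := fun i y => f (i + 2) y t) heI hx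
        (fun i hi y hy => hd.f_deriv t ht (i + 2) (by omega) y hy)
        (fun y hy => hd.f_lip t ht e heI y hy)
      simpa only [zero_add, hd.f_two_boundary hab hV ht he, sub_zero] using this
  have r3' : ∀ x ∈ Icc a b, ‖f 0 x t - (x - e) • f 1 e t‖ ≤ K * |x - e| ^ 3 := fun x hx => by
      have := norm_taylor_two_le (g := fun i y => f i y t) heI hx
        (fun i hi y hy => hd.f_deriv t ht i (by omega) y hy)
        (fun y hy => hd.f_lip_of_lt ht (by norm_num) heI hy)
      rwa [hd.f_two_boundary hab hV ht he, hd.f_zero_boundary hab ht he, smul_zero, sub_zero,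
        sub_zero] at this
  have f0le : ∀ x ∈ Icc a b, ‖f 0 x t‖ ≤ K * |x - e| := fun x hx => by
    have := hd.f_lip_of_lt ht (i := 0) (by norm_num) heI hx
    rwa [hd.f_zero_boundary hab ht he, sub_zero] at this
  obtain ⟨Vm, hVm⟩ := isCompact_Icc.exists_bound_of_continuousOn hV
  have r3 := of_cube (r := fun x => (V x : ℂ) * (f 0 x t - (x - e) • f 1 e t))
    (C := |Vm| * K) fun x hx => by
      rw [norm_mul, Complex.norm_real, mul_assoc]
      exact mul_le_mul ((hVm x hx).trans (le_abs_self _)) (r3' x hx) (norm_nonneg _)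
        (abs_nonneg _)
  have r4 := of_cube (r := fun x => (β : ℂ) * (‖f 0 x t‖ : ℂ) ^ 2 * f 0 x t)
    (C := |β| * K ^ 3) fun x hx => by
      rw [norm_mul, norm_mul, norm_pow, Complex.norm_real, Complex.norm_real, norm_norm,
        Real.norm_eq_abs, mul_assoc, mul_assoc, ← pow_succ, ← mul_pow]
      exact mul_le_mul_of_nonneg_left (pow_le_pow_left₀ (norm_nonneg _) (f0le x hx) 3)
        (abs_nonneg _)
  -- ψ vanishes at e, so a first-order expansion of V gives Vψ to second order.
  have r5 : (fun x => ((V x - V e - (x - e) * V' : ℝ) : ℂ) * ((x - e : ℝ) * f 1 e t))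
      =o[l] fun x => Y x ^ 2 := by
    have h1 := (hasDerivWithinAt_iff_isLittleO.1 hV').mono
      (nhdsWithin_mono e Ioo_subset_Icc_self)
    have h2 : (fun x => ((V x - V e - (x - e) * V' : ℝ) : ℂ)) =o[l] Y :=
      IsLittleO.of_norm_left (h1.norm_left.congr_left fun x => by
        rw [Complex.norm_real, smul_eq_mul])
    have h3 : (fun x => ((x - e : ℝ) * f 1 e t : ℂ)) =O[l] Y := by
      refine IsBigO.of_bound ‖f 1 e t‖ (Eventually.of_forall fun x => ?_)
      rw [norm_mul, Complex.norm_real, mul_comm]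
    exact (h2.mul_isBigO h3).congr_right fun x => by ring
  -- The coefficient of x - e in the expanded equation; it must be shown to vanish before the
  -- quadratic coefficient can be read off.
  set c : ℂ := V e * f 1 e t - Complex.I * k - 1 / 2 * f 3 e t with hcdef
  have hVf : (V' : ℂ) * f 1 e t = 0 := by
    rcases hc with h | h <;> simp [h]
  have main : (fun x => (Y x ^ 2) • (1 / 4 * f 4 e t) - Y x • c) =o[l] fun x => Y x ^ 2 := by
    have hsum := (((r3.add r5).add r4).sub (r1.const_mul_left Complex.I)).sub
      (r2.const_mul_left (1 / 2))
    refine hsum.congr' ?_ EventuallyEq.rfl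
    filter_upwards [hmem] with x hx
    have heq := hd.equation_Icc hab hV ht (Ioo_subset_Icc_self hx)
    simp only [hYdef, Complex.real_smul, hcdef]
    push_cast
    linear_combination (-((x : ℂ) - e) ^ 2) * hVf - heq
  have hc0 : c = 0 := by
    refine eq_zero_of_isLittleO_smul hY0 ?_
    have h1 : (fun x => (Y x ^ 2) • (1 / 4 * f 4 e t)) =o[l] Y := by
      refine IsBigO.trans_isLittleO
        (IsBigO.of_bound ‖1 / 4 * f 4 e t‖ (Eventually.of_forall fun x => ?_)) h21
      rw [norm_smul, mul_comm]
    refine (h1.sub (main.trans h21)).congr_left fun x => by abel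
  have h4 : (1 / 4 * f 4 e t : ℂ) = 0 := by
    refine eq_zero_of_isLittleO_smul (Y := fun x => Y x ^ 2)
      (hY0.mono fun x hx => pow_ne_zero 2 hx) ?_
    refine main.congr_left fun x => ?_
    rw [hc0, smul_zero, sub_zero]
  simpa using h4

/-- Functions in `H²₀` have vanishing derivative at the boundary. -/
theorem SolutionData.f_one_boundary (hab : a < b) (hψ : IsSolution a b T V β ψ₀ ψ)
    (hH : MemCHZero a b T 2 ψ) (hd : SolutionData a b T V β ψ f q K) {t : ℝ} (ht : t ∈ Icc 0 T)
    {e : ℝ} (he : e = a ∨ e = b) : f 1 e t = 0 := by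
  have heI : e ∈ Icc a b := by
    rcases he with rfl | rfl
    · exact left_mem_Icc.2 hab.le
    · exact right_mem_Icc.2 hab.le
  obtain ⟨F, -, hF⟩ := hH
  obtain ⟨hF0, hFψ⟩ := hF t ht
  have h0 : ∀ x ∈ Icc a b, evalRep a b 2 2 0 x (F t) = f 0 x t := fun x hx => by
    rw [hd.f_zero t ht x hx]; exact evalRep_zero_eq hab hψ (F t) ht hFψ hx
  have h1 : evalRep a b 2 2 1 e (F t) = f 1 e t := by
    refine (uniqueDiffOn_Icc hab e heI).eq_deriv _
      (hasDerivWithinAt_evalRep (i := 0) (j := 1) hab rfl (F t) heI) ?_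
    exact (hd.f_deriv t ht 0 (by norm_num) e heI).congr h0 (h0 e heI)
  rw [← h1]
  -- Evaluating u' at e is continuous on H², so its kernel is closed; it contains the test functions
  -- and therefore H²₀.
  have hcl : IsClosed {u : sobolevSpace a b 2 2 | evalRep a b 2 2 1 e u = 0} :=
    isClosed_eq (evalRep a b 2 2 1 e).continuous continuous_const
  refine closure_minimal ?_ hcl hF0
  rintro u ⟨φ, hφ, hu⟩
  have h2 : ContinuousOn (iteratedDeriv 1 φ) (Icc a b) :=
    (hφ.smooth.continuous_iteratedDeriv 1 (by exact_mod_cast le_top)).continuousOn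
  have h3 := evalRep_eq hab 1 u h2 (hu 1) heI
  rw [mem_ofPred_eq, h3, iteratedDeriv_one]
  refine image_eq_zero_of_notMem_tsupport fun h => ?_
  have h4 := hφ.support_subset (tsupport_deriv_subset h)
  rcases he with rfl | rfl
  · exact lt_irrefl _ h4.1
  · exact lt_irrefl _ h4.2

end Boundary

end GPE

namespace GPE

/-! ### Consistency of the scheme -/

section Consistency

variable {a b T β K : ℝ} {V : ℝ → ℝ} {ψ₀ : ℝ → ℂ} {ψ : ℝ → ℝ → ℂ} {f : ℕ → ℝ → ℝ → ℂ}
  {q : ℝ → ℝ → ℂ}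

/-- The part of the local truncation error which is due to the time discretization. -/
noncomputable def timeResidual (β : ℝ) (ψ q : ℝ → ℝ → ℂ) (t τ x : ℝ) : ℂ :=
  Complex.I / τ * (ψ x (t + τ) - ψ x t - (τ / 2 : ℝ) • (q x (t + τ) + q x t))
    + (β : ℂ) / 4 * ((‖ψ x (t + τ)‖ : ℂ) ^ 2 - (‖ψ x t‖ : ℂ) ^ 2) * (ψ x (t + τ) - ψ x t)

/-- The truncation error of the central second difference quotient. -/
noncomputable def spaceResidual (f : ℕ → ℝ → ℝ → ℂ) (h t x : ℝ) : ℂ :=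
  (f 0 (x + h) t - 2 * f 0 x t + f 0 (x - h) t) / (h : ℂ) ^ 2 - f 2 x t

theorem timeResidual_of_boundary (hd : SolutionData a b T V β ψ f q K) (hab : a < b) {t τ e : ℝ}
    (ht : 0 ≤ t) (hτ : 0 ≤ τ) (htT : t + τ ≤ T) (he : e = a ∨ e = b) :
    timeResidual β ψ q t τ e = 0 := by
  have h0 : t ∈ Icc 0 T := ⟨ht, by linarith⟩
  have h1 : t + τ ∈ Icc 0 T := ⟨by linarith, htT⟩
  have heI : e ∈ Icc a b := by
    rcases he with rfl | rfl
    · exact left_mem_Icc.2 hab.le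
    · exact right_mem_Icc.2 hab.le
  have e0 := hd.f_zero_boundary hab h0 he
  have e1 := hd.f_zero_boundary hab h1 he
  rw [hd.f_zero _ h0 e heI] at e0
  rw [hd.f_zero _ h1 e heI] at e1
  simp [timeResidual, e0, e1, hd.q_boundary' h0 he, hd.q_boundary' h1 he]

/-- Both parts are O(τ²) together with their variation in x: the trapezoidal defect τ³ is divided by
τ, and the cubic part is a product of two increments of size τ. A size bound follows because the
time residual vanishes at the ends. -/
theorem timeResidual_lip (hd : SolutionData a b T V β ψ f q K) (hK : 0 ≤ K) {t τ : ℝ}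
    (ht : 0 ≤ t) (hτ : 0 < τ) (htT : t + τ ≤ T) {x y : ℝ} (hx : x ∈ Icc a b) (hy : y ∈ Icc a b) :
    ‖timeResidual β ψ q t τ y - timeResidual β ψ q t τ x‖
      ≤ (K + 2 * |β| * K ^ 3) * τ ^ 2 * |y - x| := by
  have h0 : t ∈ Icc 0 T := ⟨ht, by linarith⟩
  have h1 : t + τ ∈ Icc 0 T := ⟨by linarith, htT⟩
  have ψb : ∀ s ∈ Icc 0 T, ∀ x ∈ Icc a b, ‖ψ x s‖ ≤ K := fun s hs x hx => by
    rw [← hd.f_zero s hs x hx]; exact hd.f_bound s hs 0 (by norm_num) x hx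
  have ψl : ∀ s ∈ Icc 0 T, ‖ψ y s - ψ x s‖ ≤ K * |y - x| := fun s hs => by
    rw [← hd.f_zero s hs x hx, ← hd.f_zero s hs y hy]
    exact hd.f_lip_of_lt hs (by norm_num) hx hy
  have hτs : |t + τ - t| = τ := by rw [add_sub_cancel_left, abs_of_pos hτ]
  have D : ∀ x ∈ Icc a b, ‖ψ x (t + τ) - ψ x t‖ ≤ K * τ := fun x hx => by
    have := hd.diff_bound t h0 (t + τ) h1 x hx
    rwa [hτs] at this
  have Dl := hd.diff_lip t h0 (t + τ) h1 x hx y hy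
  rw [hτs] at Dl
  have El := hd.trap_lip t τ ht hτ.le htT x hx y hy
  have Dx := D x hx
  have Dy := D y hy
  have b0x := ψb t h0 x hx
  have b1y := ψb _ h1 y hy
  have b0y := ψb t h0 y hy
  have l0 := ψl t h0
  have l1 := ψl _ h1
  have hsq : ∀ z : ℂ, (‖z‖ : ℂ) ^ 2 = z * star z := fun z => (Complex.mul_conj' z).symm
  simp only [timeResidual, hsq]
  set p1y := ψ y (t + τ)
  set p0y := ψ y t
  set p1x := ψ x (t + τ)
  set p0x := ψ x t
  set Ey := p1y - p0y - (τ / 2 : ℝ) • (q y (t + τ) + q y t)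
  set Ex := p1x - p0x - (τ / 2 : ℝ) • (q x (t + τ) + q x t)
  set d := |y - x|
  have hd0 : 0 ≤ d := abs_nonneg _
  have hKτ : 0 ≤ K * τ := by positivity
  have hKd : 0 ≤ K * d := by positivity
  have mulb : ∀ {u v : ℂ} {r s : ℝ}, ‖u‖ ≤ r → ‖v‖ ≤ s → ‖u * v‖ ≤ r * s := by
    intro u v r s hu hv
    rw [norm_mul]
    exact mul_le_mul hu hv (norm_nonneg _) ((norm_nonneg _).trans hu)
  have ns : ∀ {u : ℂ} {r : ℝ}, ‖u‖ ≤ r → ‖star u‖ ≤ r := fun hu => by rwa [norm_star]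
  have e : Complex.I / τ * Ey + β / 4 * (p1y * star p1y - p0y * star p0y) * (p1y - p0y)
      - (Complex.I / τ * Ex + β / 4 * (p1x * star p1x - p0x * star p0x) * (p1x - p0x))
      = Complex.I / τ * (Ey - Ex) + β / 4 *
        (((p1y - p0y) * star p1y + p0y * star (p1y - p0y)) * ((p1y - p0y) - (p1x - p0x))
          + ((((p1y - p0y) - (p1x - p0x)) * star p1y + (p1x - p0x) * star (p1y - p1x))
            + ((p0y - p0x) * star (p1y - p0y)
              + p0x * star ((p1y - p0y) - (p1x - p0x)))) * (p1x - p0x)) := by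
    simp only [star_sub]; ring
  rw [e]
  have t1 : ‖Complex.I / τ * (Ey - Ex)‖ ≤ 1 / τ * (K * τ ^ 3 * d) :=
    mulb (by rw [norm_div, Complex.norm_I, Complex.norm_real, Real.norm_of_nonneg hτ.le]) El
  have t2 := mulb ((norm_add_le _ _).trans (add_le_add (mulb Dy (ns b1y)) (mulb b0y (ns Dy)))) Dl
  have t3 := mulb ((norm_add_le _ _).trans (add_le_add
    ((norm_add_le _ _).trans (add_le_add (mulb Dl (ns b1y)) (mulb Dx (ns l1))))
    ((norm_add_le _ _).trans (add_le_add (mulb l0 (ns Dy)) (mulb b0x (ns Dl)))))) Dx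
  have t4 : ‖(β : ℂ) / 4‖ ≤ |β| / 4 := by
    rw [norm_div, Complex.norm_real, Real.norm_eq_abs]; norm_num
  refine (norm_add_le _ _).trans ((add_le_add t1
    (mulb t4 ((norm_add_le _ _).trans (add_le_add t2 t3)))).trans ?_)
  have e1 : 1 / τ * (K * τ ^ 3 * d) = K * τ ^ 2 * d := by field_simp
  rw [e1]
  have : 0 ≤ |β| * K ^ 3 * τ ^ 2 * d := by positivity
  linarith

theorem norm_spaceResidual_le_of {h t x c : ℝ} (hd : SolutionData a b T V β ψ f q K)
    (hh : 0 < h) (ht : t ∈ Icc 0 T) (hx : a ≤ x - h) (hx' : x + h ≤ b)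
    (hc : ∀ y ∈ Icc a b, |y - x| ≤ h → ‖f 4 y t‖ ≤ c) :
    ‖spaceResidual f h t x‖ ≤ 2 * c * h ^ 2 := by
  have h1 := norm_second_difference_le (g := fun i y => f i y t) hx hx' hh.le
    (fun i hi y hy => hd.f_deriv t ht i hi y hy) hc
  have hne : (h : ℂ) ≠ 0 := Complex.ofReal_ne_zero.2 hh.ne'
  have e : spaceResidual f h t x = (f 0 (x + h) t - (2 : ℝ) • f 0 x t + f 0 (x - h) t
      - (h ^ 2) • f 2 x t) / (h : ℂ) ^ 2 := by
    rw [spaceResidual, Complex.real_smul, Complex.real_smul]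
    push_cast
    field_simp
  rw [e, norm_div, norm_pow, Complex.norm_real, Real.norm_of_nonneg hh.le,
    div_le_iff₀ (by positivity)]
  linarith

/-- The second-difference estimate is applied to y ↦ ψ(y + h) - ψ(y), whose fourth derivative is at
most Kh by the Lipschitz bound; no continuous fifth derivative is needed. -/
theorem norm_spaceResidual_sub_le {h t x : ℝ} (hd : SolutionData a b T V β ψ f q K)
    (hh : 0 < h) (ht : t ∈ Icc 0 T) (hx : a ≤ x - h) (hx' : x + h + h ≤ b) :
    ‖spaceResidual f h t (x + h) - spaceResidual f h t x‖ ≤ 2 * K * h ^ 3 := by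
  have m1 : ∀ y ∈ Icc a (b - h), y ∈ Icc a b := fun y hy => ⟨hy.1, by linarith [hy.2]⟩
  have m2 : ∀ y ∈ Icc a (b - h), y + h ∈ Icc a b := fun y hy =>
    ⟨by linarith [hy.1], by linarith [hy.2]⟩
  have h1 := norm_second_difference_le (g := fun i y => f i (y + h) t - f i y t)
    (A := a) (B := b - h) (x := x) (h := h) (c := K * h) hx (by linarith) hh.le
    (fun i hi y hy => by
      have d1 := hd.f_deriv t ht i hi (h + y) (by rw [add_comm]; exact m2 y hy)
      have d2 := hasDerivWithinAt_comp_add (S' := Icc a (b - h)) d1 fun z hz => by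
        change h + z ∈ Icc a b
        rw [add_comm]; exact m2 z hz
      simp only [add_comm h] at d2
      exact d2.sub ((hd.f_deriv t ht i hi y (m1 y hy)).mono fun z hz => m1 z hz))
    (fun y hy _ => by
      have := hd.f_lip t ht y (m1 y hy) (y + h) (m2 y hy)
      rwa [add_sub_cancel_left, abs_of_pos hh] at this)
  have hne : (h : ℂ) ≠ 0 := Complex.ofReal_ne_zero.2 hh.ne'
  have e : spaceResidual f h t (x + h) - spaceResidual f h t x
      = ((f 0 (x + h + h) t - f 0 (x + h) t) - (2 : ℝ) • (f 0 (x + h) t - f 0 x t)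
        + (f 0 (x - h + h) t - f 0 (x - h) t)
        - (h ^ 2) • (f 2 (x + h) t - f 2 x t)) / (h : ℂ) ^ 2 := by
    rw [spaceResidual, spaceResidual, Complex.real_smul, Complex.real_smul,
      add_sub_cancel_right, sub_add_cancel]
    push_cast
    field_simp
    ring
  rw [e, norm_div, norm_pow, Complex.norm_real, Real.norm_of_nonneg hh.le,
    div_le_iff₀ (by positivity)]
  refine h1.trans_eq ?_
  ring

/-- The local truncation error of the scheme, extended by zero to the boundary. -/
noncomputable def gridResidual (a : ℝ) (V : ℝ → ℝ) (β : ℝ) (ψ : ℝ → ℝ → ℂ) (M : ℕ)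
    (h τ : ℝ) (n j : ℕ) : ℂ :=
  if 1 ≤ j ∧ j < M then
    Complex.I * ((ψ (a + j * h) ((n + 1 : ℕ) * τ) - ψ (a + j * h) (n * τ)) / τ)
      + 1 / 2 * deltaSq h
        (fun l => (ψ (a + l * h) ((n + 1 : ℕ) * τ) + ψ (a + l * h) (n * τ)) / 2) j
      - cnTerm (fun j => V (a + j * h)) β (fun j => ψ (a + j * h) ((n + 1 : ℕ) * τ))
        (fun j => ψ (a + j * h) (n * τ)) j
  else 0

/-- Required by H¹ stability. Its price is the jump of the residual across the two end cells. -/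
theorem zeroBdry_gridResidual {M : ℕ} (h τ : ℝ) (n : ℕ) :
    ZeroBdry M (gridResidual a V β ψ M h τ n) := by simp [ZeroBdry, gridResidual]

theorem linStep_gridResidual {M : ℕ} (h τ : ℝ) (n : ℕ) :
    LinStep h τ M (fun j => ψ (a + j * h) (n * τ)) (fun j => ψ (a + j * h) ((n + 1 : ℕ) * τ))
      (cnTerm (fun j => V (a + j * h)) β (fun j => ψ (a + j * h) ((n + 1 : ℕ) * τ))
        (fun j => ψ (a + j * h) (n * τ)) + gridResidual a V β ψ M h τ n) := by
  intro j h1 h2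
  rw [Pi.add_apply, gridResidual, if_pos ⟨h1, h2⟩]
  ring

theorem grid_mem {M : ℕ} {h : ℝ} (hh : 0 < h) (hM : h * M = b - a) {j : ℕ} (hj : j ≤ M) :
    a + j * h ∈ Icc a b := by
  have : (j : ℝ) * h ≤ M * h := by gcongr
  exact ⟨by linarith [show 0 ≤ (j : ℝ) * h by positivity], by linarith⟩

/-- Subtract the mean of the equations at the two time levels. For the cubic term, with A_i =
|p_i|², (A₁p₁ + A₀p₀)/2 - (A₁ + A₀)(p₁ + p₀)/4 = (A₁ - A₀)(p₁ - p₀)/4, the second term of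
`timeResidual`; the potential term cancels exactly. -/
theorem gridResidual_eq (hd : SolutionData a b T V β ψ f q K) {M : ℕ} {h τ : ℝ} (hh : 0 < h)
    (hM : h * M = b - a) (hτ : 0 < τ) {n : ℕ} (hn : (n + 1 : ℕ) * τ ≤ T) {j : ℕ} (h1 : 1 ≤ j)
    (h2 : j < M) :
    gridResidual a V β ψ M h τ n j = timeResidual β ψ q (n * τ) τ (a + j * h)
      + 1 / 4 * (spaceResidual f h ((n + 1 : ℕ) * τ) (a + j * h)
        + spaceResidual f h (n * τ) (a + j * h)) := by
  have hs : ((n + 1 : ℕ) : ℝ) * τ = n * τ + τ := by push_cast; ring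
  have t0 : (n : ℝ) * τ ∈ Icc 0 T := ⟨by positivity, by rw [hs] at hn; linarith⟩
  have t1 : (n : ℝ) * τ + τ ∈ Icc 0 T := ⟨by positivity, by rw [hs] at hn; linarith⟩
  rw [gridResidual, if_pos ⟨h1, h2⟩, hs]
  obtain ⟨i, rfl⟩ : ∃ i, j = i + 1 := ⟨j - 1, by omega⟩
  have xp : a + ((i + 1 : ℕ) : ℝ) * h + h = a + ((i + 1 + 1 : ℕ) : ℝ) * h := by push_cast; ring
  have xm : a + ((i + 1 : ℕ) : ℝ) * h - h = a + (i : ℝ) * h := by push_cast; ring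
  have mp := grid_mem hh hM h2
  have mm := grid_mem hh hM (j := i) (by omega)
  have m0 := grid_mem hh hM h2.le
  have mI : a + ((i + 1 : ℕ) : ℝ) * h ∈ Ioo a b :=
    ⟨by linarith [mm.1], by have := mp.2; rw [Nat.succ_eq_add_one, ← xp] at this; linarith⟩
  have E0 := hd.equation _ t0 _ mI
  have E1 := hd.equation _ t1 _ mI
  have hne : (h : ℂ) ≠ 0 := Complex.ofReal_ne_zero.2 hh.ne'
  have hτne : (τ : ℂ) ≠ 0 := Complex.ofReal_ne_zero.2 hτ.ne'
  simp only [timeResidual, spaceResidual, deltaSq, cnTerm, xp, xm, Nat.add_sub_cancel,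
    hd.f_zero _ t0 _ mp, hd.f_zero _ t1 _ mp, hd.f_zero _ t0 _ mm, hd.f_zero _ t1 _ mm,
    hd.f_zero _ t0 _ m0, hd.f_zero _ t1 _ m0, Complex.real_smul]
  push_cast
  push_cast at E0 E1
  generalize hx : a + ((i : ℝ) + 1) * h = x at *
  field_simp
  field_simp at E0 E1
  linear_combination 4 * (h : ℂ) ^ 2 * τ * (E0 + E1)

end Consistency

end GPE

namespace GPE

/-! ### Bounds for the residual in the discrete norms -/

section Bounds

variable {a b T β K : ℝ} {V : ℝ → ℝ} {ψ₀ : ℝ → ℂ} {ψ : ℝ → ℝ → ℂ} {f : ℕ → ℝ → ℝ → ℂ}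
  {q : ℝ → ℝ → ℂ}

/-- The two end cells enter with weight √h only; a bound B = O(h) there costs h^{3/2}. -/
theorem l2Norm_le_of_bound_interior {h : ℝ} {M : ℕ} (hh : 0 ≤ h) {v : ℕ → ℂ} {A B : ℝ}
    (hA : 0 ≤ A) (hB : 0 ≤ B) (H1 : ∀ j < M, j ≠ 0 → j + 1 ≠ M → ‖v j‖ ≤ A)
    (H2 : ∀ j < M, ‖v j‖ ≤ B) : l2Norm h M v ≤ √(h * M) * A + 2 * √h * B := by
  have key : ∀ j ∈ Finset.range M, ‖v j‖ ^ 2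
      ≤ A ^ 2 + ((if j = 0 then B ^ 2 else 0) + if j = M - 1 then B ^ 2 else 0) := by
    intro j hj
    have hjM := Finset.mem_range.1 hj
    have hA2 := sq_nonneg A
    have hB2 := sq_nonneg B
    by_cases hbd : j = 0 ∨ j = M - 1
    · have h1 := pow_le_pow_left₀ (norm_nonneg _) (H2 j hjM) 2
      rcases hbd with h0 | h0
      · rw [if_pos h0]; split_ifs <;> linarith
      · rw [if_pos h0]; split_ifs <;> linarith
    · push Not at hbd
      have h1 := pow_le_pow_left₀ (norm_nonneg _) (H1 j hjM hbd.1 (by omega)) 2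
      rw [if_neg hbd.1, if_neg hbd.2]; linarith
  have hsum : ∑ j ∈ Finset.range M, ‖v j‖ ^ 2 ≤ M * A ^ 2 + 2 * B ^ 2 := by
    refine (Finset.sum_le_sum key).trans ?_
    rw [Finset.sum_add_distrib, Finset.sum_add_distrib, Finset.sum_ite_eq', Finset.sum_ite_eq']
    simp only [Finset.sum_const, Finset.card_range, nsmul_eq_mul]
    have hB2 := sq_nonneg B
    split_ifs <;> linarith
  have hs1 : √(h * M) ^ 2 = h * M := Real.sq_sqrt (by positivity)
  have hs2 : √h ^ 2 = h := Real.sq_sqrt hh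
  have hpos : 0 ≤ √(h * M) * A + 2 * √h * B := by positivity
  refine (pow_le_pow_iff_left₀ (l2Norm_nonneg _) hpos two_ne_zero).1 ?_
  rw [l2Norm_sq hh]
  have h3 : 0 ≤ √(h * M) * A * (√h * B) := by positivity
  calc h * ∑ j ∈ Finset.range M, ‖v j‖ ^ 2 ≤ h * (M * A ^ 2 + 2 * B ^ 2) :=
        mul_le_mul_of_nonneg_left hsum hh
    _ ≤ (√(h * M) * A + 2 * √h * B) ^ 2 := by
        have : (√(h * M) * A + 2 * √h * B) ^ 2 = √(h * M) ^ 2 * A ^ 2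
          + 4 * (√(h * M) * A * (√h * B)) + 4 * √h ^ 2 * B ^ 2 := by ring
        rw [this, hs1, hs2]
        have : 0 ≤ h * B ^ 2 := by positivity
        linarith

variable {M : ℕ} {h τ : ℝ} {n : ℕ}

theorem norm_gridResidual_le (hab : a < b) (hd : SolutionData a b T V β ψ f q K) (hK : 0 ≤ K)
    (hh : 0 < h) (hM : h * M = b - a) (hτ : 0 < τ) (hn : (n + 1 : ℕ) * τ ≤ T) (j : ℕ) :
    ‖gridResidual a V β ψ M h τ n j‖
      ≤ (K + 2 * |β| * K ^ 3) * τ ^ 2 * (b - a) + K * h ^ 2 := by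
  have hs : ((n + 1 : ℕ) : ℝ) * τ = n * τ + τ := by push_cast; ring
  have hba : 0 ≤ b - a := by linarith
  by_cases hj : 1 ≤ j ∧ j < M
  swap
  · rw [gridResidual, if_neg hj, norm_zero]; positivity
  rw [gridResidual_eq hd hh hM hτ hn hj.1 hj.2]
  obtain ⟨i, rfl⟩ : ∃ i, j = i + 1 := ⟨j - 1, by omega⟩
  have xp : a + ((i + 1 : ℕ) : ℝ) * h + h = a + ((i + 1 + 1 : ℕ) : ℝ) * h := by push_cast; ring
  have xm : a + ((i + 1 : ℕ) : ℝ) * h - h = a + (i : ℝ) * h := by push_cast; ring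
  have mp := grid_mem hh hM hj.2
  have mm := grid_mem hh hM (j := i) (by omega)
  have m0 := grid_mem hh hM hj.2.le
  rw [Nat.succ_eq_add_one, ← xp] at mp
  rw [← xm] at mm
  set x := a + ((i + 1 : ℕ) : ℝ) * h
  have hT0 : (n : ℝ) * τ + τ ≤ T := by rwa [hs] at hn
  have hn0 : 0 ≤ (n : ℝ) * τ := by positivity
  have b1 := timeResidual_lip hd hK hn0 hτ hT0 (left_mem_Icc.2 hab.le) m0
  rw [timeResidual_of_boundary hd hab hn0 hτ.le hT0 (Or.inl rfl), sub_zero,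
    abs_of_nonneg (sub_nonneg.2 m0.1)] at b1
  have b2 : ∀ t ∈ Icc 0 T, ‖spaceResidual f h t x‖ ≤ 2 * K * h ^ 2 := fun t ht =>
    norm_spaceResidual_le_of hd hh ht mm.1 mp.2 fun y hy _ => hd.f_bound t ht 4 le_rfl y hy
  have b3 := b2 _ (⟨by positivity, hn⟩ : ((n + 1 : ℕ) : ℝ) * τ ∈ Icc 0 T)
  have b4 := b2 _ (⟨hn0, by linarith⟩ : (n : ℝ) * τ ∈ Icc 0 T)
  refine (norm_add_le _ _).trans (add_le_add (b1.trans ?_) ?_)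
  · have := m0.2
    gcongr
  · rw [norm_mul]
    have := (norm_add_le (spaceResidual f h ((n + 1 : ℕ) * τ) x)
      (spaceResidual f h (n * τ) x))
    have h4 : ‖(1 / 4 : ℂ)‖ = 1 / 4 := by norm_num
    rw [h4]; linarith

/-- The residual at the grid points next to the end points. -/
theorem norm_gridResidual_le_of_near (hab : a < b) (hd : SolutionData a b T V β ψ f q K)
    (hK : 0 ≤ K) (hh : 0 < h) (hM : h * M = b - a) (hτ : 0 < τ) (hn : (n + 1 : ℕ) * τ ≤ T)
    {j : ℕ} (h1 : 1 ≤ j) (h2 : j < M) {e c : ℝ} (he : e = a ∨ e = b)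
    (hje : |a + j * h - e| = h)
    (hc : ∀ t ∈ Icc 0 T, ∀ y ∈ Icc a b, |y - (a + j * h)| ≤ h → ‖f 4 y t‖ ≤ c) :
    ‖gridResidual a V β ψ M h τ n j‖
      ≤ (K + 2 * |β| * K ^ 3) * τ ^ 2 * h + c * h ^ 2 := by
  have hs : ((n + 1 : ℕ) : ℝ) * τ = n * τ + τ := by push_cast; ring
  have heI : e ∈ Icc a b := by
    rcases he with rfl | rfl
    · exact left_mem_Icc.2 hab.le
    · exact right_mem_Icc.2 hab.le
  rw [gridResidual_eq hd hh hM hτ hn h1 h2]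
  obtain ⟨i, rfl⟩ : ∃ i, j = i + 1 := ⟨j - 1, by omega⟩
  have xp : a + ((i + 1 : ℕ) : ℝ) * h + h = a + ((i + 1 + 1 : ℕ) : ℝ) * h := by push_cast; ring
  have xm : a + ((i + 1 : ℕ) : ℝ) * h - h = a + (i : ℝ) * h := by push_cast; ring
  have mp := grid_mem hh hM h2
  have mm := grid_mem hh hM (j := i) (by omega)
  have m0 := grid_mem hh hM h2.le
  rw [Nat.succ_eq_add_one, ← xp] at mp
  rw [← xm] at mm
  set x := a + ((i + 1 : ℕ) : ℝ) * h
  have hT0 : (n : ℝ) * τ + τ ≤ T := by rwa [hs] at hn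
  have hn0 : 0 ≤ (n : ℝ) * τ := by positivity
  have b1 := timeResidual_lip hd hK hn0 hτ hT0 heI m0
  rw [timeResidual_of_boundary hd hab hn0 hτ.le hT0 he, sub_zero, hje] at b1
  have b2 : ∀ t ∈ Icc 0 T, ‖spaceResidual f h t x‖ ≤ 2 * c * h ^ 2 := fun t ht =>
    norm_spaceResidual_le_of hd hh ht mm.1 mp.2 (hc t ht)
  have b3 := b2 _ (⟨by positivity, hn⟩ : ((n + 1 : ℕ) : ℝ) * τ ∈ Icc 0 T)
  have b4 := b2 _ (⟨hn0, by linarith⟩ : (n : ℝ) * τ ∈ Icc 0 T)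
  refine (norm_add_le _ _).trans (add_le_add b1 ?_)
  rw [norm_mul]
  have := (norm_add_le (spaceResidual f h ((n + 1 : ℕ) * τ) x)
    (spaceResidual f h (n * τ) x))
  have h4 : ‖(1 / 4 : ℂ)‖ = 1 / 4 := by norm_num
  rw [h4]; linarith

theorem norm_gridResidual_sub_le (hd : SolutionData a b T V β ψ f q K)
    (hK : 0 ≤ K) (hh : 0 < h) (hM : h * M = b - a) (hτ : 0 < τ) (hn : (n + 1 : ℕ) * τ ≤ T)
    {j : ℕ} (h1 : 1 ≤ j) (h2 : j + 1 < M) :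
    ‖gridResidual a V β ψ M h τ n (j + 1) - gridResidual a V β ψ M h τ n j‖
      ≤ (K + 2 * |β| * K ^ 3) * τ ^ 2 * h + K * h ^ 3 := by
  have hs : ((n + 1 : ℕ) : ℝ) * τ = n * τ + τ := by push_cast; ring
  rw [gridResidual_eq hd hh hM hτ hn h1 (by omega),
    gridResidual_eq hd hh hM hτ hn (Nat.le_add_left 1 j) h2]
  obtain ⟨i, rfl⟩ : ∃ i, j = i + 1 := ⟨j - 1, by omega⟩
  have xp : a + ((i + 1 + 1 : ℕ) : ℝ) * h = a + ((i + 1 : ℕ) : ℝ) * h + h := by push_cast; ring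
  have xq : a + ((i + 1 + 1 + 1 : ℕ) : ℝ) * h = a + ((i + 1 : ℕ) : ℝ) * h + h + h := by
    push_cast; ring
  have xm : a + (i : ℝ) * h = a + ((i + 1 : ℕ) : ℝ) * h - h := by push_cast; ring
  have mq := grid_mem hh hM h2
  have mp := grid_mem hh hM h2.le
  have mm := grid_mem hh hM (j := i) (by omega)
  have m0 := grid_mem hh hM (j := i + 1) (by omega)
  rw [Nat.succ_eq_add_one, xq] at mq
  rw [xp] at mp ⊢
  rw [xm] at mm
  set x := a + ((i + 1 : ℕ) : ℝ) * h
  have hT0 : (n : ℝ) * τ + τ ≤ T := by rwa [hs] at hn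
  have hn0 : 0 ≤ (n : ℝ) * τ := by positivity
  have b1 := timeResidual_lip hd hK hn0 hτ hT0 m0 mp
  rw [add_sub_cancel_left, abs_of_pos hh] at b1
  have b2 : ∀ t ∈ Icc 0 T, ‖spaceResidual f h t (x + h) - spaceResidual f h t x‖
      ≤ 2 * K * h ^ 3 := fun t ht =>
    norm_spaceResidual_sub_le hd hh ht mm.1 mq.2
  have b3 := b2 _ (⟨by positivity, hn⟩ : ((n + 1 : ℕ) : ℝ) * τ ∈ Icc 0 T)
  have b4 := b2 _ (⟨hn0, by linarith⟩ : (n : ℝ) * τ ∈ Icc 0 T)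
  have h4 : ‖(1 / 4 : ℂ)‖ = 1 / 4 := by norm_num
  have h5 := norm_add_le
    (spaceResidual f h ((n + 1 : ℕ) * τ) (x + h) - spaceResidual f h ((n + 1 : ℕ) * τ) x)
    (spaceResidual f h (n * τ) (x + h) - spaceResidual f h (n * τ) x)
  have e : ∀ A A' B B' C C' : ℂ, A + 1 / 4 * (B + C) - (A' + 1 / 4 * (B' + C'))
      = (A - A') + 1 / 4 * ((B - B') + (C - C')) := by intros; ring
  rw [e]
  refine (norm_add_le _ _).trans (add_le_add b1 ?_)
  rw [norm_mul, h4]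
  linarith

/-- A bound of the divided differences of the residual from its values next to the boundary. -/
theorem norm_deltaPlus_gridResidual_bdry_le (hab : a < b)
    (hd : SolutionData a b T V β ψ f q K) (hK : 0 ≤ K) (hh : 0 < h) (hM : h * M = b - a)
    (hτ : 0 < τ) (hn : (n + 1 : ℕ) * τ ≤ T) {c : ℝ} (hc0 : 0 ≤ c)
    (hc : ∀ e, e = a ∨ e = b → ∀ t ∈ Icc 0 T, ∀ y ∈ Icc a b, |y - e| ≤ 2 * h → ‖f 4 y t‖ ≤ c)
    {j : ℕ} (hj : j < M) (hjb : j = 0 ∨ j + 1 = M) :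
    ‖deltaPlus h (gridResidual a V β ψ M h τ n) j‖
      ≤ (K + 2 * |β| * K ^ 3) * τ ^ 2 + c * h := by
  have hpos : 0 ≤ (K + 2 * |β| * K ^ 3) * τ ^ 2 * h + c * h ^ 2 := by positivity
  -- The stencil of a node at distance h from e reaches to distance 2h, whence the radius in the
  -- hypothesis on the fourth derivative.
  have near : ∀ i, 1 ≤ i → i < M → ∀ e, e = a ∨ e = b → |a + i * h - e| = h →
      ‖gridResidual a V β ψ M h τ n i‖ ≤ (K + 2 * |β| * K ^ 3) * τ ^ 2 * h + c * h ^ 2 :=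
    fun i h1 h2 e he hie => norm_gridResidual_le_of_near hab hd hK hh hM hτ hn h1 h2 he hie
      fun t ht y hy hyx => hc e he t ht y hy (by
        have := abs_add_le (y - (a + i * h)) (a + i * h - e)
        rw [sub_add_sub_cancel] at this
        linarith)
  have hz := zeroBdry_gridResidual (a := a) (V := V) (β := β) (ψ := ψ) (M := M) h τ n
  have hzn : ∀ i, ¬(1 ≤ i ∧ i < M) → gridResidual a V β ψ M h τ n i = 0 := fun i hi => by
    rw [gridResidual, if_neg hi]
  rw [deltaPlus, norm_div, Complex.norm_real, Real.norm_of_nonneg hh.le, div_le_iff₀ hh]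
  have e : ((K + 2 * |β| * K ^ 3) * τ ^ 2 + c * h) * h
      = (K + 2 * |β| * K ^ 3) * τ ^ 2 * h + c * h ^ 2 := by ring
  rw [e]
  rcases hjb with rfl | hjM
  · rw [hz.1, sub_zero]
    -- For M = 1 there is no interior node and the residual is identically zero.
    by_cases h1 : 0 + 1 < M
    · refine near _ le_rfl h1 a (Or.inl rfl) ?_
      push_cast
      rw [one_mul, add_sub_cancel_left, abs_of_pos hh]
    · rw [hzn _ (by omega), norm_zero]; exact hpos
  · rw [hjM, hz.2, zero_sub, norm_neg]
    by_cases h1 : 1 ≤ j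
    · refine near _ h1 hj b (Or.inr rfl) ?_
      have : ((j + 1 : ℕ) : ℝ) = M := by rw [hjM]
      push_cast at this
      have h3 : a + j * h - b = -h := by
        have : (j : ℝ) = M - 1 := by linarith
        rw [this]; linarith
      rw [h3, abs_neg, abs_of_pos hh]
    · rw [hzn _ (by omega), norm_zero]; exact hpos

theorem norm_deltaPlus_gridResidual_le (hd : SolutionData a b T V β ψ f q K)
    (hK : 0 ≤ K) (hh : 0 < h) (hM : h * M = b - a) (hτ : 0 < τ) (hn : (n + 1 : ℕ) * τ ≤ T)
    {j : ℕ} (hj : j < M) (h1 : j ≠ 0) (h2 : j + 1 ≠ M) :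
    ‖deltaPlus h (gridResidual a V β ψ M h τ n) j‖
      ≤ (K + 2 * |β| * K ^ 3) * τ ^ 2 + K * h ^ 2 := by
  have := norm_gridResidual_sub_le hd hK hh hM hτ hn (j := j) (by omega) (by omega)
  rw [deltaPlus, norm_div, Complex.norm_real, Real.norm_of_nonneg hh.le, div_le_iff₀ hh]
  linarith

/-- The solution is bounded by the maximum of its essential suprema. -/
theorem norm_le_maxNorm (hab : a < b) (hψ : IsSolution a b T V β ψ₀ ψ)
    (hd : SolutionData a b T V β ψ f q K) {t : ℝ} (ht : t ∈ Icc 0 T) {x : ℝ}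
    (hx : x ∈ Icc a b) : ‖ψ x t‖ ≤ maxNorm a b T ψ := by
  have hb : ∀ s ∈ Icc 0 T, eLpNorm (fun x => ψ x s) ⊤ (intervalMeasure a b)
      ≤ ENNReal.ofReal K := by
    intro s hs
    rw [eLpNorm_exponent_top]
    refine eLpNormEssSup_le_of_ae_bound ((ae_restrict_iff' measurableSet_Ioo).2
      (Filter.Eventually.of_forall fun y hy => ?_))
    rw [← hd.f_zero s hs y (Ioo_subset_Icc_self hy)]
    exact hd.f_bound s hs 0 (by norm_num) y (Ioo_subset_Icc_self hy)
  have h1 : ‖ψ x t‖ ≤ (eLpNorm (fun x => ψ x t) ⊤ (intervalMeasure a b)).toReal := by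
    refine norm_le_of_ae_le hab (hψ.continuousOn_space ht) ?_ x hx
    have hne : eLpNorm (fun x => ψ x t) ⊤ (intervalMeasure a b) ≠ ⊤ :=
      ((hb t ht).trans_lt ENNReal.ofReal_lt_top).ne
    rw [eLpNorm_exponent_top] at hne ⊢
    filter_upwards [ae_le_eLpNormEssSup (f := fun x => ψ x t) (μ := intervalMeasure a b)]
      with y hy
    rw [← toReal_enorm]
    exact ENNReal.toReal_mono hne hy
  refine h1.trans (le_csSup ⟨(ENNReal.ofReal K).toReal, ?_⟩ (mem_image_of_mem _ ht))
  rintro _ ⟨s, hs, rfl⟩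
  exact ENNReal.toReal_mono ENNReal.ofReal_ne_top (hb s hs)

end Bounds

end GPE

/-! ### The error estimates -/

set_option maxHeartbeats 2000000 in
theorem mainTheorem4 (a b T β : ℝ) (hab : a < b) (hT : 0 < T)
    (V : ℝ → ℝ) (hV : ContDiffOn ℝ 1 V (Set.Icc a b))
    (ψ₀ : ℝ → ℂ) (ψ : ℝ → ℝ → ℂ)
    (hψ : GPE.IsSolution a b T V β ψ₀ ψ) (hreg : GPE.Regular a b T ψ) :
    ∃ h₀ > (0 : ℝ), ∃ τ₀ > (0 : ℝ), ∃ C > (0 : ℝ),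
      ∀ (M : ℕ) (h τ : ℝ), 1 ≤ M → h = (b - a) / M → h ≤ h₀ → 0 < τ → τ ≤ τ₀ →
        ∃ u : ℕ → ℕ → ℂ,
          GPE.IsCNFD a T V β ψ₀ M h τ u ∧
          (∀ w : ℕ → ℕ → ℂ, GPE.IsCNFD a T V β ψ₀ M h τ w →
            ∀ n : ℕ, (n : ℝ) ≤ T / τ → ∀ j : ℕ, j ≤ M → w n j = u n j) ∧
          (∀ n : ℕ, (n : ℝ) ≤ T / τ →
            GPE.l2Norm h M (GPE.err a h τ ψ u n) ≤ C * (h ^ 2 + τ ^ 2) ∧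
            GPE.l2Norm h M (GPE.deltaPlus h (GPE.err a h τ ψ u n)) ≤
              C * (h ^ (3 / 2 : ℝ) + τ ^ (3 / 2 : ℝ)) ∧
            GPE.supNorm M (u n) ≤ 1 + GPE.maxNorm a b T ψ) ∧
          (((derivWithin V (Set.Icc a b) a = 0 ∧ derivWithin V (Set.Icc a b) b = 0) ∨
              GPE.MemCHZero a b T 2 ψ) →
            ∀ n : ℕ, (n : ℝ) ≤ T / τ →
              GPE.l2Norm h M (GPE.err a h τ ψ u n) +
                  GPE.l2Norm h M (GPE.deltaPlus h (GPE.err a h τ ψ u n)) ≤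
                C * (h ^ 2 + τ ^ 2) ∧
              GPE.supNorm M (u n) ≤ 1 + GPE.maxNorm a b T ψ) := by
  obtain ⟨f, q, K, hK, hd⟩ := GPE.exists_solutionData hab hT hψ hreg
  have hVc : ContinuousOn V (Icc a b) := hV.continuousOn
  have hu := uniqueDiffOn_Icc hab
  have hVd : DifferentiableOn ℝ V (Icc a b) := hV.differentiableOn one_ne_zero
  obtain ⟨Vm, hVm⟩ := isCompact_Icc.exists_bound_of_continuousOn hVc
  obtain ⟨Λ, hΛ⟩ := isCompact_Icc.exists_bound_of_continuousOn
    (hV.continuousOn_derivWithin hu le_rfl)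
  have haI : a ∈ Icc a b := left_mem_Icc.2 hab.le
  have hVm0 : 0 ≤ Vm := (norm_nonneg _).trans (hVm a haI)
  have hΛ0 : 0 ≤ Λ := (norm_nonneg _).trans (hΛ a haI)
  have hℓ : 0 < b - a := sub_pos.2 hab
  obtain ⟨τ₁, hτ₁, C₁, hC₁, hconv⟩ := GPE.cnfd_convergence β hℓ hVm0 hΛ0 hT
    (mul_nonneg (Real.sqrt_nonneg (b - a)) hK)
  set S := K + 2 * |β| * K ^ 3 with hS
  have hS0 : 0 ≤ S := by positivity
  set L := √(b - a) with hL
  have hL0 : 0 ≤ L := Real.sqrt_nonneg _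
  -- One constant dominating the three residual bounds: l², H¹ in general, and H¹ in the optimal
  -- case.
  set Cg := (L + 2) * (S + 2 * K) + L * (S * (b - a) + K) + 1 with hCg
  have hCg0 : 0 < Cg := by positivity
  have hε : 0 < 2 * (1 + L) * (C₁ * Cg) := by positivity
  -- These thresholds give (1 + L) C₁ Cg (h + τ) ≤ 1, which covers the bootstrap condition C₁ρ ≤ 1
  -- and the bound L C₁ρ ≤ 1 for the maximum of the error. The factor 2 in C accounts for the sum of
  -- two norms in the optimal estimate.
  refine ⟨min 1 (1 / (2 * (1 + L) * (C₁ * Cg))), by positivity,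
    min τ₁ (min 1 (1 / (2 * (1 + L) * (C₁ * Cg)))), by positivity, 2 * (C₁ * Cg), by positivity, ?_⟩
  intro M h τ hM hhM hh0 hτ hτ0
  have hMpos : (0 : ℝ) < M := by exact_mod_cast hM
  have hh : 0 < h := by rw [hhM]; positivity
  have hℓM : h * M = b - a := by rw [hhM, div_mul_cancel₀ _ hMpos.ne']
  have hh1 : h ≤ 1 := hh0.trans (min_le_left _ _)
  have hτ1 : τ ≤ 1 := hτ0.trans ((min_le_right _ _).trans (min_le_left _ _))
  have hhε := hh0.trans (min_le_right _ _)
  have hτε := hτ0.trans ((min_le_right _ _).trans (min_le_right _ _))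
  rw [le_div_iff₀ hε] at hhε hτε
  have h32 : h ^ (3 / 2 : ℝ) = √h * h := by
    rw [Real.sqrt_eq_rpow, ← Real.rpow_add_one hh.ne']; norm_num
  have hsq1 : √h ≤ 1 := Real.sqrt_le_one.2 hh1
  have hsq : h ≤ √h := by
    have h1 := Real.mul_self_sqrt hh.le
    nlinarith [Real.sqrt_nonneg h]
  have h32h : h ^ (3 / 2 : ℝ) ≤ h := by
    rw [h32]; exact mul_le_of_le_one_left hh.le hsq1
  have h2_32 : h ^ 2 ≤ h ^ (3 / 2 : ℝ) := by
    rw [h32, sq]; exact mul_le_mul_of_nonneg_right hsq hh.le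
  have hτ2 : τ ^ 2 ≤ τ := by nlinarith
  have hτ32 : τ ^ 2 ≤ τ ^ (3 / 2 : ℝ) := by
    rw [← Real.rpow_natCast]
    exact Real.rpow_le_rpow_of_exponent_ge hτ hτ1 (by norm_num)
  have h32n : 0 ≤ h ^ (3 / 2 : ℝ) := by positivity
  set P : ℕ → ℕ → ℂ := fun n j => ψ (a + j * h) (n * τ) with hP
  set r : ℕ → ℕ → ℂ := fun n => GPE.gridResidual a V β ψ M h τ n with hr
  set W : ℕ → ℝ := fun j => V (a + j * h) with hW
  -- Only the space error loses half an order; the rate τ^{3/2} of the statement is weaker than the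
  -- τ² obtained here.
  set ρ := Cg * (h ^ (3 / 2 : ℝ) + τ ^ 2) with hρ
  have hρ0 : 0 ≤ ρ := by positivity
  have hρ1 : (1 + L) * (C₁ * ρ) ≤ 1 := by
    have h1 : C₁ * ρ ≤ C₁ * (Cg * (h + τ)) := by rw [hρ]; gcongr
    have h2 : (1 + L) * (C₁ * ρ) ≤ (1 + L) * (C₁ * (Cg * (h + τ))) := by gcongr
    linarith
  have hCρ0 : 0 ≤ C₁ * ρ := by positivity
  have hC1ρ : C₁ * ρ ≤ 1 :=
    (le_mul_of_one_le_left hCρ0 (by linarith only [hL0])).trans hρ1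
  have tmem : ∀ n : ℕ, (n : ℝ) * τ ≤ T → (n : ℝ) * τ ∈ Icc 0 T := fun n hn =>
    ⟨by positivity, hn⟩
  have aM : a + (M : ℝ) * h = b := by linarith
  have hPz : ∀ n : ℕ, (n : ℝ) * τ ≤ T → GPE.ZeroBdry M (P n) := fun n hn => by
    have := hd.boundary _ (tmem n hn)
    refine ⟨?_, ?_⟩
    · simpa [hP] using this.1
    · simp only [hP, aM]; exact this.2
  have hPK : ∀ n : ℕ, (n : ℝ) * τ ≤ T → GPE.h1Norm h M (P n) ≤ L * K := by
    intro n hn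
    rw [hL, ← hℓM]
    refine GPE.l2Norm_le_of_bound hh.le hK fun j hj => ?_
    have m0 := GPE.grid_mem hh hℓM hj.le
    have m1 := GPE.grid_mem hh hℓM (j := j + 1) hj
    have := hd.f_lip_of_lt (tmem n hn) (i := 0) (by norm_num) m0 m1
    rw [hd.f_zero _ (tmem n hn) _ m0, hd.f_zero _ (tmem n hn) _ m1] at this
    have e : a + ((j + 1 : ℕ) : ℝ) * h - (a + j * h) = h := by push_cast; ring
    rw [e, abs_of_pos hh] at this
    rwa [GPE.deltaPlus, norm_div, Complex.norm_real, Real.norm_of_nonneg hh.le, div_le_iff₀ hh]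
  have hr2 : ∀ n : ℕ, (n + 1 : ℕ) * τ ≤ T → GPE.l2Norm h M (r n) ≤ Cg * (h ^ 2 + τ ^ 2) := by
    intro n hn
    refine (GPE.l2Norm_le_of_bound hh.le (c := S * τ ^ 2 * (b - a) + K * h ^ 2) (by positivity)
      fun j _ => GPE.norm_gridResidual_le hab hd hK hh hℓM hτ hn j).trans ?_
    rw [hℓM]
    have h1 : 0 ≤ (L + 2) * (S + 2 * K) + 1 := by positivity
    have h2 : 0 ≤ L * (S * (b - a)) * h ^ 2 := by positivity
    have h3 : 0 ≤ L * K * τ ^ 2 := by positivity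
    have h4 : 0 ≤ ((L + 2) * (S + 2 * K) + 1) * (h ^ 2 + τ ^ 2) := by positivity
    rw [hCg]
    linarith
  have hr1 : ∀ n : ℕ, (n + 1 : ℕ) * τ ≤ T → GPE.h1Norm h M (r n) ≤ ρ := by
    intro n hn
    have hint : ∀ j < M, j ≠ 0 → j + 1 ≠ M →
        ‖GPE.deltaPlus h (r n) j‖ ≤ S * τ ^ 2 + K * h ^ 2 := fun j hj h1 h2 =>
      GPE.norm_deltaPlus_gridResidual_le hd hK hh hℓM hτ hn hj h1 h2
    refine (GPE.l2Norm_le_of_bound_interior hh.le (A := S * τ ^ 2 + K * h ^ 2)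
      (B := S * τ ^ 2 + K * h) (by positivity) (by positivity) hint fun j hj => ?_).trans ?_
    · by_cases hjb : j = 0 ∨ j + 1 = M
      · exact GPE.norm_deltaPlus_gridResidual_bdry_le hab hd hK hh hℓM hτ hn hK
          (fun e _ t ht y hy _ => hd.f_bound t ht 4 le_rfl y hy) hj hjb
      · push Not at hjb
        refine (hint j hj hjb.1 hjb.2).trans ?_
        have : h ^ 2 ≤ h := by nlinarith
        gcongr
    · rw [hℓM]
      have h1 : 0 ≤ √h := Real.sqrt_nonneg h
      have h2 : √h * (S * τ ^ 2) ≤ S * τ ^ 2 := mul_le_of_le_one_left (by positivity) hsq1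
      have h3 : L * (K * h ^ 2) ≤ L * (K * h ^ (3 / 2 : ℝ)) := by gcongr
      have h4 : √h * (K * h) = K * h ^ (3 / 2 : ℝ) := by rw [h32]; ring
      have h5 : 0 ≤ (L * (S * (b - a) + K) + 1) * (h ^ (3 / 2 : ℝ) + τ ^ 2) := by positivity
      have h6 : 0 ≤ (L + 2) * S * h ^ (3 / 2 : ℝ) := by positivity
      have h7 : 0 ≤ (L + 2) * (2 * K) * τ ^ 2 := by positivity
      have h8 : 0 ≤ (L + 2) * K * h ^ (3 / 2 : ℝ) := by positivity
      have h9 : 2 * √h * (S * τ ^ 2 + K * h) = 2 * (√h * (S * τ ^ 2)) + 2 * (√h * (K * h)) := by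
        ring
      rw [h9, h4, hρ, hCg]
      linarith
  obtain ⟨u, hu0, hus, -, huerr, huniq⟩ := hconv M h τ W P r ρ hM hh hℓM hτ
    (hτ0.trans (min_le_left _ _)) (fun j hj => hVm _ (GPE.grid_mem hh hℓM hj))
    (fun j hj => by
      have m0 := GPE.grid_mem hh hℓM hj.le
      have m1 := GPE.grid_mem hh hℓM (j := j + 1) hj
      have := (convex_Icc a b).norm_image_sub_le_of_norm_derivWithin_le hVd hΛ m0 m1
      have e : a + ((j + 1 : ℕ) : ℝ) * h - (a + j * h) = h := by push_cast; ring
      rwa [e, Real.norm_of_nonneg hh.le, Real.norm_eq_abs] at this)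
    hρ0 hC1ρ (fun n hn => ⟨hPz n hn, hPK n hn⟩)
    (fun n hn => ⟨GPE.zeroBdry_gridResidual h τ n, GPE.linStep_gridResidual h τ n, hr1 n hn⟩)
  have hle : ∀ n : ℕ, (n : ℝ) ≤ T / τ ↔ (n : ℝ) * τ ≤ T := fun n => le_div_iff₀ hτ
  have hprev : ∀ n : ℕ, (n : ℝ) * τ ≤ T → ∀ k < n, ((k + 1 : ℕ) : ℝ) * τ ≤ T := fun n hn k hk =>
    le_trans (by gcongr; exact hk) hn
  have hP0 : ∀ j ≤ M, P 0 j = ψ₀ (a + j * h) := fun j hj => by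
    simp only [hP, Nat.cast_zero, zero_mul]
    exact hψ.initial _ (GPE.grid_mem hh hℓM hj)
  have herr : ∀ n, GPE.err a h τ ψ u n = P n - u n := fun n => rfl
  have el2 : ∀ n : ℕ, (n : ℝ) * τ ≤ T →
      GPE.l2Norm h M (P n - u n) ≤ C₁ * (Cg * (h ^ 2 + τ ^ 2)) := fun n hn =>
    (huerr n hn _ (by positivity)).1 fun k hk => hr2 k (hprev n hn k hk)
  have eh1 : ∀ n : ℕ, (n : ℝ) * τ ≤ T → GPE.h1Norm h M (P n - u n) ≤ C₁ * ρ := fun n hn =>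
    (huerr n hn _ hρ0).2 fun k hk => hr1 k (hprev n hn k hk)
  have huz : ∀ n : ℕ, (n : ℝ) * τ ≤ T → GPE.ZeroBdry M (u n) := by
    intro n hn
    cases n with
    | zero => rw [hu0]; exact hPz 0 hn
    | succ n => exact (hus n hn).1
  have hsup : ∀ n : ℕ, (n : ℝ) * τ ≤ T →
      GPE.supNorm M (u n) ≤ 1 + GPE.maxNorm a b T ψ := by
    intro n hn
    refine Finset.sup'_le _ _ fun j hj => ?_
    have hjM : j ≤ M := Nat.lt_succ_iff.1 (Finset.mem_range.1 hj)
    have h1 : ‖P n j‖ ≤ GPE.maxNorm a b T ψ :=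
      GPE.norm_le_maxNorm hab hψ hd (tmem n hn) (GPE.grid_mem hh hℓM hjM)
    -- The discrete Sobolev inequality makes the error at most L C₁ρ ≤ 1 at every node.
    have h2 := GPE.norm_le_h1Norm hh ((hPz n hn).sub (huz n hn)).1 hjM
    rw [hℓM] at h2
    have h3 : L * GPE.h1Norm h M (P n - u n) ≤ L * (C₁ * ρ) :=
      mul_le_mul_of_nonneg_left (eh1 n hn) hL0
    have h4 : ‖u n j‖ ≤ ‖(P n - u n) j‖ + ‖P n j‖ := by
      have := norm_sub_le (P n j) ((P n - u n) j)
      rw [Pi.sub_apply, sub_sub_cancel] at this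
      rw [Pi.sub_apply]; linarith
    linarith
  refine ⟨u, ⟨?_, ?_, ?_⟩, ?_, ?_, ?_⟩
  · intro n hn j h1 h2
    rw [hle] at hn
    exact (hus n hn).2 j h1 (by omega)
  · intro n hn
    rw [hle] at hn
    exact (hus n hn).1
  · intro j hj
    rw [hu0, hP0 j hj]
  · intro w hw n hn j hj
    rw [hle] at hn
    refine huniq w (fun j hj => (hw.initial j hj).trans (hP0 j hj).symm) (fun n hn => ?_) n hn j hj
    rw [← hle] at hn
    exact ⟨hw.boundary n hn, fun j h1 h2 => hw.scheme n hn j h1 (by omega)⟩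
  · intro n hn
    rw [hle] at hn
    rw [herr]
    refine ⟨(el2 n hn).trans ?_, (eh1 n hn).trans ?_, hsup n hn⟩
    · have : 0 ≤ C₁ * Cg * (h ^ 2 + τ ^ 2) := by positivity
      linarith
    · have h1 : C₁ * ρ ≤ C₁ * Cg * (h ^ (3 / 2 : ℝ) + τ ^ (3 / 2 : ℝ)) := by
        rw [hρ, ← mul_assoc]; gcongr
      have h2 : 0 ≤ C₁ * Cg * (h ^ (3 / 2 : ℝ) + τ ^ (3 / 2 : ℝ)) := by positivity
      linarith
  · intro hgood n hn
    rw [hle] at hn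
    refine ⟨?_, hsup n hn⟩
    have hf4 : ∀ e, e = a ∨ e = b → ∀ t ∈ Icc 0 T, f 4 e t = 0 := by
      intro e he t ht
      have heI : e ∈ Icc a b := by
        rcases he with rfl | rfl
        · exact left_mem_Icc.2 hab.le
        · exact right_mem_Icc.2 hab.le
      refine hd.f_four_boundary hab hT hVc hψ hreg.c2_w3 ht he (hVd e heI).hasDerivWithinAt ?_
      rcases hgood with ⟨ga, gb⟩ | hH
      · left
        rcases he with rfl | rfl
        · exact ga
        · exact gb
      · exact Or.inr (hd.f_one_boundary hab hψ hH ht he)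
    have hr1' : ∀ n : ℕ, (n + 1 : ℕ) * τ ≤ T →
        GPE.h1Norm h M (r n) ≤ Cg * (h ^ 2 + τ ^ 2) := by
      intro n hn
      refine (GPE.l2Norm_le_of_bound hh.le (c := S * τ ^ 2 + 2 * K * h ^ 2) (by positivity)
        fun j hj => ?_).trans ?_
      · by_cases hjb : j = 0 ∨ j + 1 = M
        -- The fourth derivative vanishes at e and is K-Lipschitz, so it is at most 2Kh within
        -- distance 2h; the end cells now satisfy an O(h² + τ²) bound as well.
        · refine (GPE.norm_deltaPlus_gridResidual_bdry_le hab hd hK hh hℓM hτ hn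
            (c := 2 * K * h) (by positivity) (fun e he t ht y hy hye => ?_) hj hjb).trans_eq
            (by ring)
          have heI : e ∈ Icc a b := by
            rcases he with rfl | rfl
            · exact left_mem_Icc.2 hab.le
            · exact right_mem_Icc.2 hab.le
          have h1 := hd.f_lip t ht e heI y hy
          rw [hf4 e he t ht, sub_zero] at h1
          have h2 := mul_le_mul_of_nonneg_left hye hK
          linarith
        · push Not at hjb
          refine (GPE.norm_deltaPlus_gridResidual_le hd hK hh hℓM hτ hn hj hjb.1 hjb.2).trans ?_
          have : 0 ≤ K * h ^ 2 := by positivity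
          linarith
      · rw [hℓM]
        have h1 : 0 ≤ (L * (S * (b - a) + K) + 1) * (h ^ 2 + τ ^ 2) := by positivity
        have h2 : 0 ≤ (L + 2) * S * h ^ 2 := by positivity
        have h3 : 0 ≤ (L + 2) * (2 * K) * τ ^ 2 := by positivity
        have h4 : 0 ≤ 2 * (2 * K) * h ^ 2 := by positivity
        have h5 : 0 ≤ 2 * S * τ ^ 2 := by positivity
        rw [hCg]
        linarith
    have e1 := (huerr n hn (Cg * (h ^ 2 + τ ^ 2)) (by positivity)).2
      fun k hk => hr1' k (hprev n hn k hk)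
    have e2 := el2 n hn
    rw [herr]
    unfold GPE.h1Norm at e1
    linarith
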